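/- Let $m\ge 1$ and let $$sA(\alpha_1,\dots,\alpha_{2m})=\sum_{i=1}^{2m}\sin\alpha_i+\sin\Bigl(-\sum_{i=1}^{2m}\alpha_i\Bigr)$$ be the signed area function of polygons with $n=2m+1$ vertices on the unit circle (in the angle coordinates of the reduced configuration space), and let $$f(x)=\tfrac16\Bigl(\bigl(\sum_{i=1}^{2m}x_i\bigr)^3-\sum_{i=1}^{2m}x_i^3\Bigr)$$ be its 3-jet at the degenerate star $\alpha=0$. Let $M_f=O_{2m,0}/J(f)$ be the real Milnor algebra: germs at $0$ of real analytic functions on $\mathbb R^{2m}$ modulo the ideal generated by the partial derivatives of $f$. Let $h_f$ be the Hessian determinant of $f$. Then $M_f$ is finite-dimensional, and for every $\omega\in\mathbb R$ there is exactly one linear function $l:M_f\to\mathbb R$ with $l([x_1x_2\cdots x_{2m}])=\omega$ and $l([\prod_{i\in S}x_i])=0$ for every proper subset $S\subsetneq\{1,\dots,2m\}$. For this $l$, let $\beta(g,h)=l(gh)$ on $M_f$, and let $B_{m,m}$ be the matrix with entries $\beta(x^\sigma,x^\tau)$, where $\sigma,\tau$ run over the $m$-element subsets of $\{1,\dots,2m\}$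 and $x^\sigma=\prod_{i\in\sigma}x_i$. Put $$b_p=(-1)^p\,\omega\,\frac{(2p)!!\,(2m-2p-1)!!}{(2m-1)!!}\quad(0\le p\le m),\qquad (-1)!!=0!!=1 .$$ 1. If $w_p$ is the class of a monomial of degree $2m$ with exactly $2p$ odd exponents, then $l(w_p)=b_{m-p}$. Hence the $(\sigma,\tau)$ entry of $B_{m,m}$ is $b_{|\sigma\cap\tau|}$. 2. The set of eigenvalues of $B_{m,m}$ is $\{\lambda_0,\dots,\lambda_m\}$, where $$\lambda_k=(-1)^m\,\frac{2m+1}{2m-2k+1}\,\omega .$$ If $\omega\ne0$, the eigenspace of $\lambda_k$ has dimension $\dfrac{(2m)!\,(2m-2k+1)}{k!\,(2m-k+1)!}$. 3. If $\omega>0$, then $l([h_f])>0$, all eigenvalues of $B_{m,m}$ have the sign $(-1)^m$, and the signature of $\beta$ on $M_f$ (the Eisenbud-Levine-Khimshiashvili index) is $2(-1)^m\binom{2m-1}{m-1}$. 4. The gradient vector field of $sA$ has an isolated zero at the degenerate star, and its index (local degree) there is $2(-1)^m\binom{2m-1}{m-1}$. -/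

import Mathlib

open Filter Topology Metric
open scoped Nat

/-! ## Germs of real analytic functions and the Milnor algebra -/

/-- Germs at the origin of real-valued functions on `ℝ^k` form an `ℝ`-algebra. -/
noncomputable instance germAlgebra (k : ℕ) :
    Algebra ℝ (Germ (𝓝 (0 : EuclideanSpace ℝ (Fin k))) ℝ) :=
  Algebra.ofModule
    (fun r x y => by
      induction x using Filter.Germ.inductionOn
      induction y using Filter.Germ.inductionOn
      exact congrArg Germ.ofFun (funext fun _ => smul_mul_assoc _ _ _))
    (fun r x y => by
      induction x using Filter.Germ.inductionOn
      induction y using Filter.Germ.inductionOn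
      exact congrArg Germ.ofFun (funext fun _ => mul_smul_comm _ _ _))

/-- The ring `O_{k,0}` of germs at the origin of real analytic functions on `ℝ^k`. -/
noncomputable def analyticGerms (k : ℕ) :
    Subalgebra ℝ (Germ (𝓝 (0 : EuclideanSpace ℝ (Fin k))) ℝ) where
  carrier := {g | ∃ f : EuclideanSpace ℝ (Fin k) → ℝ, AnalyticAt ℝ f 0 ∧ g = (f : Germ _ ℝ)}
  mul_mem' := by
    rintro _ _ ⟨f, hf, rfl⟩ ⟨g, hg, rfl⟩
    exact ⟨f * g, hf.mul hg, rfl⟩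
  add_mem' := by
    rintro _ _ ⟨f, hf, rfl⟩ ⟨g, hg, rfl⟩
    exact ⟨f + g, hf.add hg, rfl⟩
  algebraMap_mem' := by
    intro r
    refine ⟨fun _ => r, analyticAt_const, ?_⟩
    rw [Algebra.algebraMap_eq_smul_one]
    exact congrArg Germ.ofFun (funext fun _ => by simp)

/-- The germ at the origin of a function that is analytic there. -/
def germAt {k : ℕ} (f : EuclideanSpace ℝ (Fin k) → ℝ) (hf : AnalyticAt ℝ f 0) :
    analyticGerms k :=
  ⟨(f : Germ _ ℝ), f, hf, rfl⟩

lemma analyticAt_coord {k : ℕ} (i : Fin k) (p : EuclideanSpace ℝ (Fin k)) :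
    AnalyticAt ℝ (fun x : EuclideanSpace ℝ (Fin k) => x i) p :=
  (EuclideanSpace.proj i : EuclideanSpace ℝ (Fin k) →L[ℝ] ℝ).analyticAt p

/-- The germ of the coordinate function `x_i`. -/
def coordGerm {k : ℕ} (i : Fin k) : analyticGerms k :=
  germAt (fun x => x i) (analyticAt_coord i 0)

/-- The partial derivative `∂/∂x_i` on germs of arbitrary functions. -/
noncomputable def germPartial {k : ℕ} (i : Fin k)
    (g : Germ (𝓝 (0 : EuclideanSpace ℝ (Fin k))) ℝ) :
    Germ (𝓝 (0 : EuclideanSpace ℝ (Fin k))) ℝ :=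
  g.liftOn
    (fun f => ((fun x => fderiv ℝ f x (EuclideanSpace.single i 1)) :
      Germ (𝓝 (0 : EuclideanSpace ℝ (Fin k))) ℝ))
    (fun f₁ f₂ h => Germ.coe_eq.2 (by
      filter_upwards [EventuallyEq.fderiv (𝕜 := ℝ) h] with x hx
      rw [hx]))

/-- The partial derivative `∂/∂x_i` on germs of analytic functions. -/
noncomputable def pderivGerm {k : ℕ} (i : Fin k) (g : analyticGerms k) : analyticGerms k :=
  ⟨germPartial i g.1, by
    obtain ⟨_, f, hf, rfl⟩ := g
    exact ⟨_, AnalyticAt.comp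
      ((ContinuousLinearMap.apply ℝ ℝ (EuclideanSpace.single i (1 : ℝ))).analyticAt _)
      (AnalyticAt.fderiv hf), rfl⟩⟩

/-- The Jacobian ideal `J(f)`, generated by the partial derivatives of `f`. -/
noncomputable def jacobianIdeal {k : ℕ} (f : analyticGerms k) : Ideal (analyticGerms k) :=
  Ideal.span (Set.range fun i => pderivGerm i f)

/-- The (real) Milnor algebra `M_f = O_{k,0} / J(f)`. -/
abbrev MilnorAlgebra {k : ℕ} (f : analyticGerms k) : Type :=
  analyticGerms k ⧸ jacobianIdeal f

noncomputable instance milnorAlgebraCommRing {k : ℕ} (f : analyticGerms k) :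
    CommRing (MilnorAlgebra f) :=
  Ideal.Quotient.commRing (jacobianIdeal f)

noncomputable instance milnorAlgebraAlgebra {k : ℕ} (f : analyticGerms k) :
    Algebra ℝ (MilnorAlgebra f) :=
  Ideal.Quotient.algebra ℝ

/-- The germ `h_f` of the Hessian determinant of `f`. -/
noncomputable def hessianGerm {k : ℕ} (f : analyticGerms k) : analyticGerms k :=
  (Matrix.of fun i j => pderivGerm i (pderivGerm j f)).det

/-- The class in the Milnor algebra of the monomial `x^a`. -/
noncomputable def monomialClass {k : ℕ} (f : analyticGerms k) (a : Fin k → ℕ) :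
    MilnorAlgebra f :=
  Ideal.Quotient.mk (jacobianIdeal f) (∏ i, coordGerm i ^ a i)

/-- The class in the Milnor algebra of the monomial without repeated factors `∏_{i ∈ S} x_i`. -/
noncomputable def squarefreeClass {k : ℕ} (f : analyticGerms k) (S : Finset (Fin k)) :
    MilnorAlgebra f :=
  Ideal.Quotient.mk (jacobianIdeal f) (∏ i ∈ S, coordGerm i)

/-- The bilinear form `β(g, h) = l(g * h)` on the Milnor algebra. -/
noncomputable def milnorForm {k : ℕ} {f : analyticGerms k} (l : MilnorAlgebra f →ₗ[ℝ] ℝ) :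
    LinearMap.BilinForm ℝ (MilnorAlgebra f) :=
  LinearMap.mk₂ ℝ (fun g h => l (g * h))
    (fun g₁ g₂ h => by rw [add_mul, map_add])
    (fun c g h => by rw [Algebra.smul_mul_assoc, map_smul])
    (fun g h₁ h₂ => by rw [mul_add, map_add])
    (fun c g h => by rw [Algebra.mul_smul_comm, map_smul])

/-- The signature (positive index minus negative index) of a real bilinear form. -/
noncomputable def formSignature {M : Type*} [AddCommGroup M] [Module ℝ M]
    (β : LinearMap.BilinForm ℝ M) : ℤ :=
  (sigPos β.toQuadraticMap : ℤ) - (sigNeg β.toQuadraticMap : ℤ)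

/-! ## The signed area function and its 3-jet -/

/-- The signed area of the polygon with `2m+1` vertices on the unit circle, in the coordinates
`α_1, …, α_{2m}` of the reduced configuration space; the last angle is `-(α_1 + ⋯ + α_{2m})`
modulo `2π`. The degenerate star is `α = 0`. -/
noncomputable def signedArea (m : ℕ) (α : EuclideanSpace ℝ (Fin (2 * m))) : ℝ :=
  ∑ i, Real.sin (α i) + Real.sin (-∑ i, α i)

/-- The 3-jet of the signed area at the degenerate star. -/
noncomputable def cubicJet (m : ℕ) (x : EuclideanSpace ℝ (Fin (2 * m))) : ℝ :=
  ((∑ i, x i) ^ 3 - ∑ i, x i ^ 3) / 6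

lemma analyticAt_cubicJet (m : ℕ) : AnalyticAt ℝ (cubicJet m) 0 := by
  have hc := fun i => analyticAt_coord (k := 2 * m) i 0
  have h1 : AnalyticAt ℝ (fun x : EuclideanSpace ℝ (Fin (2 * m)) => ∑ i, x i) 0 :=
    Finset.analyticAt_fun_sum _ fun i _ => hc i
  have h2 : AnalyticAt ℝ (fun x : EuclideanSpace ℝ (Fin (2 * m)) => ∑ i, x i ^ 3) 0 :=
    Finset.analyticAt_fun_sum _ fun i _ => (hc i).fun_pow 3
  exact ((h1.fun_pow 3).fun_sub h2).fun_div analyticAt_const (by norm_num)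

/-- `cubicJet` is the Taylor polynomial of order 3 of `signedArea` at the degenerate star. -/
lemma signedArea_sub_cubicJet (m : ℕ) :
    (fun x => signedArea m x - cubicJet m x) =o[𝓝 0] fun x => ‖x‖ ^ 3 := by
  have hs : (fun t : ℝ => Real.sin t - (t - t ^ 3 / 6)) =o[𝓝 0] fun t : ℝ => t ^ 3 := by
    have hO : (fun t : ℝ => Real.sin t - (t - t ^ 3 / 6)) =O[𝓝 0] fun t : ℝ => t ^ 5 := by
      refine Asymptotics.IsBigO.of_bound (1 / 100) ?_
      filter_upwards [Metric.closedBall_mem_nhds (0 : ℝ) one_pos] with t ht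
      rw [mem_closedBall_zero_iff, Real.norm_eq_abs] at ht
      have := Real.sin_bound ht
      rw [Real.norm_eq_abs, Real.norm_eq_abs, abs_pow]
      linarith
    exact hO.trans_isLittleO (Asymptotics.isLittleO_pow_pow (by norm_num))
  have key : ∀ L : EuclideanSpace ℝ (Fin (2 * m)) →L[ℝ] ℝ,
      (fun x => Real.sin (L x) - (L x - L x ^ 3 / 6)) =o[𝓝 0] fun x => ‖x‖ ^ 3 := by
    intro L
    have hL : Tendsto L (𝓝 0) (𝓝 0) := by
      simpa using L.continuous.tendsto 0
    refine (hs.comp_tendsto hL).trans_isBigO ?_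
    exact ((L.isBigO_id (𝓝 0)).norm_right).pow 3
  have h1 := fun i => key (EuclideanSpace.proj i : EuclideanSpace ℝ (Fin (2 * m)) →L[ℝ] ℝ)
  have h2 := key (-∑ i, (EuclideanSpace.proj i : EuclideanSpace ℝ (Fin (2 * m)) →L[ℝ] ℝ))
  have h3 := (Asymptotics.IsLittleO.fun_sum (s := Finset.univ) fun i _ => h1 i).add h2
  refine h3.congr_left fun x => ?_
  have hL : (-∑ i, (EuclideanSpace.proj i : EuclideanSpace ℝ (Fin (2 * m)) →L[ℝ] ℝ)) x
      = -∑ i, x i := by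
    simp
  have hp : ∀ i, (EuclideanSpace.proj i : EuclideanSpace ℝ (Fin (2 * m)) →L[ℝ] ℝ) x = x i :=
    fun _ => rfl
  simp only [signedArea, cubicJet, hL, hp, Finset.sum_sub_distrib, ← Finset.sum_div]
  ring

/-- The germ of the 3-jet of the signed area at the degenerate star. -/
noncomputable def areaGerm (m : ℕ) : analyticGerms (2 * m) :=
  germAt (cubicJet m) (analyticAt_cubicJet m)

/-- The linear function `l` takes the value `ω` on `w_m = [x_1 x_2 ⋯ x_{2m}]` and vanishes on the
other monomials without repeated factors (all of lower degree). -/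
def IsNormalized {m : ℕ} (l : MilnorAlgebra (areaGerm m) →ₗ[ℝ] ℝ) (ω : ℝ) : Prop :=
  l (squarefreeClass (areaGerm m) Finset.univ) = ω ∧
    ∀ S : Finset (Fin (2 * m)), S ≠ Finset.univ → l (squarefreeClass (areaGerm m) S) = 0

/-- The block `B_{m,m}` of the matrix of `β`: rows and columns are indexed by the `m`-element
subsets `σ` of the variables, that is by the squarefree monomials `x^σ` of degree `m`. -/
noncomputable def blockB (m : ℕ) (l : MilnorAlgebra (areaGerm m) →ₗ[ℝ] ℝ) :
    Matrix {σ : Finset (Fin (2 * m)) // σ.card = m}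
      {σ : Finset (Fin (2 * m)) // σ.card = m} ℝ :=
  Matrix.of fun σ τ =>
    milnorForm l (squarefreeClass (areaGerm m) σ.1) (squarefreeClass (areaGerm m) τ.1)

/-- `b_p = (-1)^p ω (2p)!! (2m-2p-1)!! / (2m-1)!!` for `0 ≤ p ≤ m`; for `p = m` the truncated
subtraction gives `0‼ = 1 = (-1)!!`. -/
noncomputable def bCoeff (m : ℕ) (ω : ℝ) (p : ℕ) : ℝ :=
  (-1) ^ p * ω * ((2 * p)‼ : ℝ) * ((2 * m - 2 * p - 1)‼ : ℝ) / ((2 * m - 1)‼ : ℝ)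

/-- `λ_k = (-1)^m (2m+1)/(2m-2k+1) ω`. -/
noncomputable def lambdaEig (m : ℕ) (ω : ℝ) (k : ℕ) : ℝ :=
  (-1) ^ m * ((2 * m + 1 : ℝ) / (2 * m - 2 * k + 1 : ℝ)) * ω

/-! ## The index of a vector field at an isolated zero -/

/-- The `C^1` vector field `V` on `ℝ^k` has an isolated zero at `p`, of index (local degree) `d`:
in a closed ball around `p` without further zeros, every sufficiently small regular value `y` has
exactly `d` preimages, counted with the sign of the Jacobian determinant. -/
def HasIndexAt {k : ℕ} (V : EuclideanSpace ℝ (Fin k) → EuclideanSpace ℝ (Fin k))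
    (p : EuclideanSpace ℝ (Fin k)) (d : ℤ) : Prop :=
  V p = 0 ∧ ∃ r > 0, (∀ x ∈ closedBall p r, ContDiffAt ℝ 1 V x) ∧
    (∀ x ∈ closedBall p r, V x = 0 → x = p) ∧
    ∀ᶠ y in 𝓝 (0 : EuclideanSpace ℝ (Fin k)),
      (∀ x ∈ ball p r, V x = y → (fderiv ℝ V x).det ≠ 0) →
        ∑ᶠ x ∈ {x | x ∈ ball p r ∧ V x = y}, (SignType.sign (fderiv ℝ V x).det : ℤ) = d

/-!
# The signed area of polygons at the degenerate star

**The Milnor algebra.** Its relations say that `x_i ^ 2 = q` for all `i`, where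
`q = (∑ x_i) ^ 2`. Hence every monomial is a power of `q` times a squarefree monomial, and for
`i ≠ j` the element `x_i - x_j` is annihilated by `x_i + x_j`. Multiplying by `x_i - x_j` thus
leads to the same relations in two variables less; by induction
(`map_mul_prod_eq_zero`) every monomial lies in the span of the squarefree monomials of the same
degree, and vanishes if the degree exceeds `2m`. With Hadamard's lemma this makes the algebra
finite-dimensional and spanned by squarefree monomials, so a normalized functional is unique. One is
written down explicitly in `cubeFunctional`, a sum over the `2 ^ (2m)` points `ε ∈ {±1}^(2m)`,
where the partial derivatives `((∑ x_i) ^ 2 - x_i ^ 2) / 2` take the nonzero value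
`((∑ ε_i) ^ 2 - 1) / 2`: it adds up the `2m`-th derivatives of a germ in the directions `ε`, with
the weights `∏ ε_i / ((∑ ε_i) ^ 2 - 1)`. On a multiple of a partial derivative the denominators
cancel, and what remains pairs the character `∏ ε_i` of degree `2m` with a polynomial in `ε` of
smaller degree. By symmetry the value on a monomial of degree `2m` depends only on the number of
odd exponents, and the relation between consecutive elementary symmetric functions in
`mul_esymm_relations` gives the recursion that `b_p` satisfies.

**The block `B_{m,m}`.** For `T` a set of at most `m` indices let `v_T` be the indicator of the
`m`-sets that contain `T` (`inclVec`). The `v_T` with `|T| ≤ k` span a flag, whose dimensions are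
`(2m).choose k` because inclusion matrices have full rank
(`Finset.eq_zero_of_sum_powersetCard_eq_zero`). Newton's interpolation formula shows that `B` is
triangular with respect to this flag, the diagonal entries being multiples of iterated differences
of `b_p`, which evaluate to `λ_k` (`toLin'_inclVec_sub_mem`). Since the `λ_k` are distinct for
`ω ≠ 0`, the multiplicities are the jumps of the dimension. The degrees below `m` and those above
`m` span isotropic subspaces that are orthogonal to the middle degree, where the form is definite of
sign `(-1)^m`; so its signature is `(-1)^m (2m).choose m` (`formSignature_eq_finrank`).

**The index of the gradient.** With the last angle `-∑ α_i` and its label `0` included, the equation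
`∇ sA = y` says that `cos α_j - y_j` does not depend on `j`, and that the sum of the `2m + 1` angles
is zero. Let `y` have its maximum at the index `j₀`. Then `p = α_{j₀}` is the angle of least
absolute value, and the other angles are determined by `p` and the set `T` of those that are
negative (`branch`). So the solutions correspond to the zeros of functions `F_T` of the single
variable `p`, and the Jacobian determinant has the sign of `(-1)^|T| F_T'(p)`
(`finsum_sign_det_fderiv_gradient_signedArea`). The signed number of zeros of `F_T` in `[-A, A]` is
half the difference of its signs at the ends, which are those of `±1 + 2m - 2|T|`: only the
`(2m).choose m` sets `T` with `|T| = m` contribute, each with `(-1)^m`.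
-/

/-! ### Functions on the `d`-element subsets of a finite set -/

lemma Finset.eq_of_swap_invariant {α β : Type*} [DecidableEq α] {X : Finset α} {d : ℕ}
    {y : Finset α → β}
    (h : ∀ i ∈ X, ∀ j ∈ X, i ≠ j → ∀ T ⊆ (X.erase i).erase j, T.card + 1 = d →
      y (insert i T) = y (insert j T)) :
    ∀ S ∈ X.powersetCard d, ∀ S' ∈ X.powersetCard d, y S = y S' := by
  suffices H : ∀ n : ℕ, ∀ S ∈ X.powersetCard d, ∀ S' ∈ X.powersetCard d,
      (S \ S').card = n → y S = y S' from fun S hS S' hS' => H _ S hS S' hS' rfl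
  intro n
  induction n with
  | zero =>
    intro S hS S' hS' h0
    rw [Finset.mem_powersetCard] at hS hS'
    have hsub : S ⊆ S' := by
      rw [← Finset.sdiff_eq_empty_iff_subset]; exact Finset.card_eq_zero.1 h0
    rw [Finset.eq_of_subset_of_card_le hsub (by omega)]
  | succ n ih =>
    intro S hS S' hS' hn
    have hS0 := hS
    have hS0' := hS'
    rw [Finset.mem_powersetCard] at hS hS'
    obtain ⟨i, hi⟩ : (S \ S').Nonempty := by rw [← Finset.card_pos]; omega
    have hcard : (S' \ S).card = (S \ S').card := by
      have h1 := Finset.card_sdiff_add_card_inter S S'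
      have h2 := Finset.card_sdiff_add_card_inter S' S
      rw [Finset.inter_comm] at h2
      omega
    obtain ⟨j, hj⟩ : (S' \ S).Nonempty := by rw [← Finset.card_pos]; omega
    rw [Finset.mem_sdiff] at hi hj
    have hij : i ≠ j := by rintro rfl; exact hi.2 hj.1
    have hcS : (S.erase i).card + 1 = d := by rw [Finset.card_erase_add_one hi.1]; exact hS.2
    have hji : j ∉ S.erase i := fun hh => hj.2 (Finset.mem_of_mem_erase hh)
    have e1 : y S = y (insert j (S.erase i)) := by
      conv_lhs => rw [← Finset.insert_erase hi.1]
      refine h i (hS.1 hi.1) j (hS'.1 hj.1) hij _ ?_ hcS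
      intro t ht
      have ht' := Finset.mem_erase.1 ht
      exact Finset.mem_erase.2 ⟨fun e => hj.2 (e ▸ ht'.2),
        Finset.mem_erase.2 ⟨ht'.1, hS.1 ht'.2⟩⟩
    rw [e1]
    refine ih _ ?_ S' hS0' ?_
    · rw [Finset.mem_powersetCard, Finset.card_insert_of_notMem hji]
      refine ⟨Finset.insert_subset (hS'.1 hj.1) ((Finset.erase_subset _ _).trans hS.1), hcS⟩
    · have : insert j (S.erase i) \ S' = (S \ S').erase i := by
        ext t
        simp only [Finset.mem_sdiff, Finset.mem_insert, Finset.mem_erase]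
        constructor
        · rintro ⟨rfl | h1, h2⟩
          · exact absurd hj.1 h2
          · exact ⟨h1.1, h1.2, h2⟩
        · rintro ⟨h1, h2, h3⟩
          exact ⟨Or.inr ⟨h1, h2⟩, h3⟩
      rw [this, Finset.card_erase_of_mem (Finset.mem_sdiff.2 hi), hn]
      rfl

lemma Finset.sum_powersetCard_succ_insert {α M : Type*} [DecidableEq α] [AddCommMonoid M]
    {a : α} {X : Finset α} (ha : a ∉ X) (d : ℕ) (f : Finset α → M) :
    ∑ S ∈ (insert a X).powersetCard (d + 1), f S
      = ∑ S ∈ X.powersetCard (d + 1), f S + ∑ T ∈ X.powersetCard d, f (insert a T) := by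
  have hnot : ∀ k, ∀ T ∈ X.powersetCard k, a ∉ T := fun k T hT hh =>
    ha ((Finset.mem_powersetCard.1 hT).1 hh)
  rw [Finset.powersetCard_succ_insert ha, Finset.sum_union, Finset.sum_image]
  · intro S hS T hT hST
    rw [← Finset.erase_insert (hnot _ S hS), hST, Finset.erase_insert (hnot _ T hT)]
  · rw [Finset.disjoint_left]
    intro S hS hS'
    obtain ⟨T, _, rfl⟩ := Finset.mem_image.1 hS'
    exact hnot _ _ hS (Finset.mem_insert_self a T)

/-- The inclusion matrix of `k`-subsets against `s`-subsets has full rank when `k ≤ s` and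
`k + s ≤ |X|`: the difference of the conditions for two sets that differ by a swap of `i` and `j`
is a condition of the same kind, with `k - 1` and `s - 1`, on the set without `i` and `j`. -/
lemma Finset.eq_zero_of_sum_powersetCard_eq_zero {α : Type*} [DecidableEq α] (k : ℕ) :
    ∀ (s : ℕ) (X : Finset α) (y : Finset α → ℝ), k ≤ s → k + s ≤ X.card →
      (∀ σ ∈ X.powersetCard s, ∑ S ∈ σ.powersetCard k, y S = 0) →
      ∀ S ∈ X.powersetCard k, y S = 0 := by
  induction k with
  | zero =>
    intro s X y _ hX h S hS
    obtain ⟨σ, hσ⟩ := Finset.powersetCard_nonempty.2 (show s ≤ X.card by omega)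
    have := h σ hσ
    rw [Finset.powersetCard_zero, Finset.sum_singleton] at this
    rw [Finset.powersetCard_zero, Finset.mem_singleton] at hS
    rw [hS, this]
  | succ k ih =>
    intro s X y hks hX h S hS
    obtain ⟨s, rfl⟩ : ∃ t, s = t + 1 := ⟨s - 1, by omega⟩
    have hconst := Finset.eq_of_swap_invariant (X := X) (d := k + 1) (y := y) (by
      intro i hi j hj hij T hT hcard
      have hjX : j ∈ X.erase i := Finset.mem_erase.2 ⟨hij.symm, hj⟩
      refine sub_eq_zero.1 (ih s ((X.erase i).erase j)
        (fun T => y (insert i T) - y (insert j T)) (by omega) ?_ ?_ T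
        (Finset.mem_powersetCard.2 ⟨hT, by omega⟩))
      · rw [Finset.card_erase_of_mem hjX, Finset.card_erase_of_mem hi]; omega
      · intro ρ hρ
        rw [Finset.mem_powersetCard] at hρ
        have hiρ : i ∉ ρ := fun hh => by simpa using hρ.1 hh
        have hjρ : j ∉ ρ := fun hh => by simpa using hρ.1 hh
        have hsub : ρ ⊆ X := hρ.1.trans ((Finset.erase_subset _ _).trans (Finset.erase_subset _ _))
        have h1 := h (insert i ρ) (Finset.mem_powersetCard.2
          ⟨Finset.insert_subset hi hsub, by rw [Finset.card_insert_of_notMem hiρ, hρ.2]⟩)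
        have h2 := h (insert j ρ) (Finset.mem_powersetCard.2
          ⟨Finset.insert_subset hj hsub, by rw [Finset.card_insert_of_notMem hjρ, hρ.2]⟩)
        rw [Finset.sum_powersetCard_succ_insert hiρ] at h1
        rw [Finset.sum_powersetCard_succ_insert hjρ] at h2
        rw [Finset.sum_sub_distrib]
        linarith)
    obtain ⟨σ, hSσ, hσX, hσ⟩ := Finset.exists_subsuperset_card_eq
      (Finset.mem_powersetCard.1 hS).1 (n := s + 1)
      (by rw [(Finset.mem_powersetCard.1 hS).2]; omega) (by omega)
    have h1 := h σ (Finset.mem_powersetCard.2 ⟨hσX, hσ⟩)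
    rw [Finset.sum_congr rfl fun T hT => hconst T
      (Finset.powersetCard_mono hσX hT) S hS] at h1
    rw [Finset.sum_const, Finset.card_powersetCard, hσ, nsmul_eq_mul] at h1
    refine (mul_eq_zero.1 h1).resolve_left ?_
    exact_mod_cast (Nat.choose_pos hks).ne'

/-! ### Squarefree products in an algebra with `x_i ^ 2 = q = (∑ x_i) ^ 2` -/

lemma prod_pow_eq_pow_mul_prod {A ι : Type*} [CommRing A] [Fintype ι] {x : ι → A} {q : A}
    (hx : ∀ i, x i ^ 2 = q) (a : ι → ℕ) :
    ∏ i, x i ^ a i = q ^ (∑ i, a i / 2) * ∏ i with Odd (a i), x i := by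
  rw [Finset.prod_filter, ← Finset.prod_pow_eq_pow_sum, ← Finset.prod_mul_distrib]
  refine Finset.prod_congr rfl fun i _ => ?_
  rw [← hx i, ← pow_mul]
  split_ifs with h
  · rw [← pow_succ]; congr 1; obtain ⟨r, hr⟩ := h; omega
  · rw [mul_one]; congr 1; rw [Nat.not_odd_iff_even] at h; obtain ⟨r, hr⟩ := h; omega

lemma sum_eq_two_mul_sum_half_add_card_odd {ι : Type*} [Fintype ι] (a : ι → ℕ) :
    ∑ i, a i = (Finset.univ.filter fun i => Odd (a i)).card + 2 * ∑ i, a i / 2 := by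
  rw [Finset.card_filter, Finset.mul_sum, ← Finset.sum_add_distrib]
  refine Finset.sum_congr rfl fun i _ => ?_
  split_ifs with h
  · obtain ⟨r, hr⟩ := h; omega
  · rw [Nat.not_odd_iff_even] at h; obtain ⟨r, hr⟩ := h; omega

section Squarefree

variable {A ι : Type*} [CommRing A] [Algebra ℝ A] [DecidableEq ι]

lemma sum_mul_esymm_succ {x : ι → A} {q : A} (hx : ∀ i, x i ^ 2 = q) (X : Finset ι) (d : ℕ) :
    (∑ i ∈ X, x i) * ∑ S ∈ X.powersetCard (d + 1), ∏ i ∈ S, x i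
      = ((d : ℝ) + 2) • ∑ S ∈ X.powersetCard (d + 2), ∏ i ∈ S, x i
        + ((X.card : ℝ) - d) • (q * ∑ S ∈ X.powersetCard d, ∏ i ∈ S, x i) := by
  induction X using Finset.induction_on generalizing d with
  | empty =>
    have h : ∀ k, (∅ : Finset ι).powersetCard (k + 1) = ∅ := fun k =>
      Finset.powersetCard_eq_empty.2 (by simp)
    rcases d with _ | d
    · simp [h]
    · simp [h]
  | insert a X ha ih =>
    have hprod : ∀ k, ∑ T ∈ X.powersetCard k, ∏ i ∈ insert a T, x i
        = x a * ∑ T ∈ X.powersetCard k, ∏ i ∈ T, x i := by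
      intro k
      rw [Finset.mul_sum]
      refine Finset.sum_congr rfl fun T hT => ?_
      rw [Finset.prod_insert fun hh => ha ((Finset.mem_powersetCard.1 hT).1 hh)]
    rw [Finset.sum_insert ha, Finset.card_insert_of_notMem ha,
      Finset.sum_powersetCard_succ_insert ha d, Finset.sum_powersetCard_succ_insert ha (d + 1),
      hprod, hprod]
    have h1 := ih d
    rcases d with _ | d
    · simp only [Finset.powersetCard_zero, Finset.sum_singleton, Finset.prod_empty, zero_add,
        Finset.powersetCard_one, Finset.sum_map, Function.Embedding.coeFn_mk,
        Finset.prod_singleton, Algebra.smul_def, map_add, map_sub, map_natCast, Nat.cast_zero,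
        map_ofNat, map_zero, Nat.cast_add, Nat.cast_one, map_one] at h1 ⊢
      linear_combination h1 + hx a
    · rw [Finset.sum_powersetCard_succ_insert ha d, hprod]
      have h2 := ih d
      simp only [Algebra.smul_def, map_add, map_sub, map_natCast, Nat.cast_add, Nat.cast_one,
        map_ofNat, map_one] at h1 h2 ⊢
      linear_combination h1 + x a * h2 + (∑ S ∈ X.powersetCard (d + 1), ∏ i ∈ S, x i) * hx a

/-- On an element `w` with `(∑_{i ∈ X} x_i) ^ 2 * w = q * w`, the elementary symmetric functions of
the `x_i`, `i ∈ X`, of degrees `2j` and `2j + 1` differ by the factor `∑_{i ∈ X} x_i`, and those of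
degrees `2j` and `2j + 2` are proportional up to a factor `q`. -/
lemma mul_esymm_relations {x : ι → A} {q : A} (hx : ∀ i, x i ^ 2 = q) {X : Finset ι} {w : A}
    (hw : (∑ i ∈ X, x i) ^ 2 * w = q * w) (j : ℕ) :
    w * ∑ S ∈ X.powersetCard (2 * j + 1), ∏ i ∈ S, x i
        = (∑ i ∈ X, x i) * (w * ∑ S ∈ X.powersetCard (2 * j), ∏ i ∈ S, x i) ∧
    (2 * (j : ℝ) + 2) • (w * ∑ S ∈ X.powersetCard (2 * j + 2), ∏ i ∈ S, x i)
        = (2 * (j : ℝ) + 1 - X.card) • (q * (w * ∑ S ∈ X.powersetCard (2 * j), ∏ i ∈ S, x i)) := by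
  set e : ℕ → A := fun d => ∑ S ∈ X.powersetCard d, ∏ i ∈ S, x i with he
  set s : A := ∑ i ∈ X, x i with hs
  have hrec : ∀ d, s * e (d + 1) = ((d : ℝ) + 2) • e (d + 2)
      + ((X.card : ℝ) - d) • (q * e d) := sum_mul_esymm_succ hx X
  have h0 : e 1 = s * e 0 := by simp [he, hs, Finset.powersetCard_one]
  have hB : ∀ j, w * e (2 * j + 1) = s * (w * e (2 * j)) →
      (2 * (j : ℝ) + 2) • (w * e (2 * j + 2)) =
        (2 * (j : ℝ) + 1 - X.card) • (q * (w * e (2 * j))) := by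
    intro j hj
    have := hrec (2 * j)
    simp only [Algebra.smul_def, map_add, map_sub, map_natCast, Nat.cast_mul, Nat.cast_ofNat,
      map_ofNat, map_one, map_mul] at this ⊢
    linear_combination (-w) * this + s * hj + e (2 * j) * hw
  have hA : ∀ j, w * e (2 * j + 1) = s * (w * e (2 * j)) := by
    intro j
    induction j with
    | zero => simp only [mul_zero, zero_add, h0]; ring
    | succ j ih =>
      have hb := hB j ih
      have := hrec (2 * j + 1)
      have hinv : ((2 * (j : ℝ) + 3)) • (w * e (2 * j + 3))
          = (2 * (j : ℝ) + 3) • (s * (w * e (2 * j + 2))) := by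
        simp only [Algebra.smul_def, map_add, map_sub, map_natCast, Nat.cast_mul, Nat.cast_ofNat,
          map_ofNat, map_one, map_mul, Nat.cast_add, Nat.cast_one] at this hb ⊢
        linear_combination (-w) * this - s * hb
          - (X.card - (2 * (j : A) + 1)) * q * ih
      exact smul_right_injective A (by positivity) hinv
  exact ⟨hA j, hB j (hA j)⟩

/-- On an element `w` as in `mul_esymm_relations`, multiplication by `q` turns the `d`-th elementary
symmetric function of the `x_i`, `i ∈ X`, into a multiple of the `(d + 2)`-nd. The parity of `|X|`
keeps the factor `2j + 1 - |X|` away from `0`. -/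
lemma exists_mul_esymm_eq_smul {x : ι → A} {q : A} (hx : ∀ i, x i ^ 2 = q) {X : Finset ι}
    (hX : Even X.card) {w : A} (hw : (∑ i ∈ X, x i) ^ 2 * w = q * w) (d : ℕ) :
    ∃ c : ℝ, q * w * ∑ S ∈ X.powersetCard d, ∏ i ∈ S, x i
      = c • (w * ∑ S ∈ X.powersetCard (d + 2), ∏ i ∈ S, x i) := by
  obtain ⟨j, hd⟩ := Nat.even_or_odd' d
  have hne : (2 * (j : ℝ) + 1 - X.card) ≠ 0 := by
    intro h
    obtain ⟨r, hr⟩ := hX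
    rw [hr] at h
    have h' : 2 * (j : ℤ) + 1 - ((r : ℤ) + r) = 0 := by exact_mod_cast h
    omega
  obtain ⟨hA, hB⟩ := mul_esymm_relations hx hw j
  refine ⟨(2 * (j : ℝ) + 1 - X.card)⁻¹ * (2 * j + 2), ?_⟩
  rcases hd with rfl | rfl
  · rw [mul_smul, hB, smul_smul, inv_mul_cancel₀ hne, one_smul]
    ring
  · have h1 := (mul_esymm_relations hx hw (j + 1)).1
    rw [show 2 * (j + 1) + 1 = 2 * j + 1 + 2 by ring, show 2 * (j + 1) = 2 * j + 2 by ring] at h1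
    rw [h1, mul_smul, ← mul_smul_comm, hB, mul_smul_comm, smul_smul,
      inv_mul_cancel₀ hne, one_smul]
    linear_combination q * hA

/-- If a functional kills `w` times all squarefree products of degree `d + 2`, then it kills
`q * w` times those of degree `d`. Replacing `w` by `w * (x_i - x_j)` and `X` by `X \ {i, j}`, which
is allowed because `(x_i - x_j) * (x_i + x_j) = 0`, shows by induction that the value on
`q * w * ∏_{i ∈ S} x_i` is the same for all `d`-subsets `S`; and the sum of these values vanishes by
`exists_mul_esymm_eq_smul`. -/
lemma map_mul_prod_eq_zero {x : ι → A} {q : A} (hx : ∀ i, x i ^ 2 = q) (l : A →ₗ[ℝ] ℝ) (d : ℕ) :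
    ∀ (X : Finset ι) (w : A), Even X.card → (∑ i ∈ X, x i) ^ 2 * w = q * w →
      (∀ R ∈ X.powersetCard (d + 2), l (w * ∏ i ∈ R, x i) = 0) →
      ∀ S ∈ X.powersetCard d, l (q * w * ∏ i ∈ S, x i) = 0 := by
  induction d using Nat.strong_induction_on with
  | _ d ih =>
    intro X w hX hw hl S hS
    have hconst := Finset.eq_of_swap_invariant (X := X) (d := d)
      (y := fun S => l (q * w * ∏ i ∈ S, x i)) (by
      intro i hi j hj hij T hT hcard
      have hjX : j ∈ X.erase i := Finset.mem_erase.2 ⟨hij.symm, hj⟩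
      have hnot : ∀ T ⊆ (X.erase i).erase j, i ∉ T ∧ j ∉ T := fun T hT =>
        ⟨fun hh => by simpa using hT hh, fun hh => by simpa using hT hh⟩
      have hsub : (X.erase i).erase j ⊆ X :=
        (Finset.erase_subset _ _).trans (Finset.erase_subset _ _)
      have key := ih T.card (by omega) ((X.erase i).erase j) (w * (x i - x j)) ?_ ?_ ?_ T
        (Finset.mem_powersetCard.2 ⟨hT, rfl⟩)
      · have hT' := hnot T hT
        rw [← sub_eq_zero, ← map_sub, Finset.prod_insert hT'.1, Finset.prod_insert hT'.2]
        convert key using 2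
        ring
      · rw [Finset.card_erase_of_mem hjX, Finset.card_erase_of_mem hi]
        obtain ⟨r, hr⟩ := hX
        exact ⟨r - 1, by omega⟩
      · have hsum : ∑ i ∈ X, x i = x i + (x j + ∑ i ∈ (X.erase i).erase j, x i) := by
          rw [Finset.add_sum_erase _ _ hjX, Finset.add_sum_erase _ _ hi]
        rw [hsum] at hw
        linear_combination (x i - x j) * hw
          - w * (x i + x j + 2 * ∑ i ∈ (X.erase i).erase j, x i) * (hx i - hx j)
      · intro R hR
        rw [Finset.mem_powersetCard] at hR
        have hR' := hnot R hR.1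
        have h1 := hl (insert i R) (Finset.mem_powersetCard.2
          ⟨Finset.insert_subset hi (hR.1.trans hsub), by
            rw [Finset.card_insert_of_notMem hR'.1]; omega⟩)
        have h2 := hl (insert j R) (Finset.mem_powersetCard.2
          ⟨Finset.insert_subset hj (hR.1.trans hsub), by
            rw [Finset.card_insert_of_notMem hR'.2]; omega⟩)
        rw [Finset.prod_insert hR'.1] at h1
        rw [Finset.prod_insert hR'.2] at h2
        rw [show w * (x i - x j) * ∏ i ∈ R, x i
          = w * (x i * ∏ i ∈ R, x i) - w * (x j * ∏ i ∈ R, x i) by ring, map_sub, h1, h2, sub_zero])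
    obtain ⟨c, hc⟩ := exists_mul_esymm_eq_smul hx hX hw d
    have hsum : ∑ S ∈ X.powersetCard d, l (q * w * ∏ i ∈ S, x i) = 0 := by
      rw [← map_sum, ← Finset.mul_sum, hc, map_smul, Finset.mul_sum, map_sum,
        Finset.sum_eq_zero hl, smul_zero]
    rw [Finset.sum_congr rfl fun T hT => hconst T hT S hS, Finset.sum_const,
      Finset.card_powersetCard, nsmul_eq_mul] at hsum
    rw [Finset.mem_powersetCard] at hS
    refine (mul_eq_zero.1 hsum).resolve_left ?_
    exact_mod_cast (Nat.choose_pos (hS.2 ▸ Finset.card_le_card hS.1)).ne'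

lemma map_pow_mul_prod_eq_zero [Fintype ι] (hι : Even (Fintype.card ι)) {x : ι → A} {q : A}
    (hx : ∀ i, x i ^ 2 = q) (hq : (∑ i, x i) ^ 2 = q) (j : ℕ) :
    ∀ (l : A →ₗ[ℝ] ℝ) (S : Finset ι),
      (∀ R : Finset ι, R.card = S.card + 2 * j → l (∏ i ∈ R, x i) = 0) →
      l (q ^ j * ∏ i ∈ S, x i) = 0 := by
  induction j with
  | zero => intro l S h; simpa using h S (by simp)
  | succ j ih =>
    intro l S h
    have := ih (l ∘ₗ LinearMap.mulLeft ℝ q) S (by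
      intro R hR
      have := map_mul_prod_eq_zero hx l R.card Finset.univ 1 (by simpa using hι) (by simp [hq])
        (fun R' hR' => by
          rw [one_mul]
          refine h R' ?_
          rw [(Finset.mem_powersetCard.1 hR').2]; omega) R (by simp [Finset.mem_powersetCard])
      simpa using this)
    rw [LinearMap.comp_apply, LinearMap.mulLeft_apply] at this
    rw [pow_succ', mul_assoc]
    exact this

/-- A functional that kills the squarefree products of degree `D` kills all monomials of degree
`D`. For `D` above the number of variables the hypothesis is void. -/
lemma map_monomial_eq_zero [Fintype ι] (hι : Even (Fintype.card ι)) {x : ι → A} {q : A}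
    (hx : ∀ i, x i ^ 2 = q) (hq : (∑ i, x i) ^ 2 = q) (l : A →ₗ[ℝ] ℝ) (a : ι → ℕ)
    (h : ∀ R : Finset ι, R.card = ∑ i, a i → l (∏ i ∈ R, x i) = 0) :
    l (∏ i, x i ^ a i) = 0 := by
  rw [prod_pow_eq_pow_mul_prod hx]
  refine map_pow_mul_prod_eq_zero hι hx hq _ l _ fun R hR => h R ?_
  rw [hR, ← sum_eq_two_mul_sum_half_add_card_odd]

lemma prod_pow_eq_zero_of_card_lt [Fintype ι] (hι : Even (Fintype.card ι)) {x : ι → A} {q : A}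
    (hx : ∀ i, x i ^ 2 = q) (hq : (∑ i, x i) ^ 2 = q) {a : ι → ℕ}
    (ha : Fintype.card ι < ∑ i, a i) : ∏ i, x i ^ a i = 0 := by
  refine (Module.forall_dual_apply_eq_zero_iff ℝ _).1 fun l =>
    map_monomial_eq_zero hι hx hq l a fun R hR => ?_
  have := R.card_le_univ
  omega

end Squarefree

lemma Submodule.mul_algebraMap_mem {A : Type*} [CommRing A] [Algebra ℝ A] (N : Submodule ℝ A)
    {a : A} (ha : a ∈ N) (c : ℝ) : a * algebraMap ℝ A c ∈ N := by
  rw [mul_comm, ← Algebra.smul_def]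
  exact N.smul_mem c ha

/-! ### Germs of analytic functions: Hadamard's lemma and Taylor coefficients along lines -/

lemma AnalyticAt.exists_eventually_eq_add_apply {E : Type*} [NormedAddCommGroup E]
    [NormedSpace ℝ E] {f : E → ℝ} (hf : AnalyticAt ℝ f 0) :
    ∃ G : E → E →L[ℝ] ℝ, AnalyticAt ℝ G 0 ∧ ∀ᶠ x in 𝓝 0, f x = f 0 + G x x := by
  obtain ⟨p, r, hp⟩ := hf
  have hrad : 0 < p.shift.radius := by
    rw [FormalMultilinearSeries.radius_shift]; exact hp.r_pos.trans_le hp.r_le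
  have hG := p.shift.hasFPowerSeriesOnBall hrad
  refine ⟨p.shift.sum, hG.analyticAt, ?_⟩
  filter_upwards [hp.eventually_hasSum, hG.eventually_hasSum] with x hx hGx
  have h0 : p 0 (fun _ => x) = f 0 := by
    rw [← hp.coeff_zero (fun _ => 0)]
    congr 1
    exact Subsingleton.elim _ _
  have h1 : HasSum (fun k => p (k + 1) fun _ => x) (p.shift.sum (0 + x) x) := by
    refine ((ContinuousLinearMap.apply ℝ ℝ x).hasSum hGx).congr_fun fun k => ?_
    have hs : (Fin.snoc (fun _ => x) x : Fin (k + 1) → E) = fun _ => x := by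
      funext i
      refine Fin.lastCases ?_ (fun j => ?_) i <;> simp
    change p (k + 1) _ = p (k + 1) (Fin.snoc (fun _ => x) x)
    rw [hs]
  have h2 := h1.zero_add (f := fun k => p k fun _ => x)
  rw [zero_add] at hx h2
  rw [hx.unique h2, h0]

lemma algebraMap_germ_eq {k : ℕ} (c : ℝ) :
    ((algebraMap ℝ (analyticGerms k) c : analyticGerms k) :
      Germ (𝓝 (0 : EuclideanSpace ℝ (Fin k))) ℝ)
      = ((fun _ : EuclideanSpace ℝ (Fin k) => c) : Germ _ ℝ) := by
  change algebraMap ℝ (Germ (𝓝 (0 : EuclideanSpace ℝ (Fin k))) ℝ) c = _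
  rw [Algebra.algebraMap_eq_smul_one]
  exact congrArg Germ.ofFun (funext fun _ => by simp)

/-- **Hadamard's lemma** for analytic germs. -/
lemma exists_eq_algebraMap_add_sum_coordGerm_mul {k : ℕ} (g : analyticGerms k) :
    ∃ (c : ℝ) (h : Fin k → analyticGerms k),
      g = algebraMap ℝ _ c + ∑ i, coordGerm i * h i := by
  obtain ⟨_, f, hf, rfl⟩ := g
  obtain ⟨G, hG, hfG⟩ := hf.exists_eventually_eq_add_apply
  have hGi : ∀ i, AnalyticAt ℝ (fun x => G x (EuclideanSpace.single i (1 : ℝ))) 0 := fun i =>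
    AnalyticAt.comp
      ((ContinuousLinearMap.apply ℝ ℝ (EuclideanSpace.single i (1 : ℝ))).analyticAt _) hG
  refine ⟨f 0, fun i => germAt _ (hGi i), Subtype.ext ?_⟩
  have hsum : ((∑ i, coordGerm i * germAt _ (hGi i) : analyticGerms k) :
      Germ (𝓝 (0 : EuclideanSpace ℝ (Fin k))) ℝ)
      = ((∑ i, fun x : EuclideanSpace ℝ (Fin k) =>
          x i * G x (EuclideanSpace.single i (1 : ℝ)) : _ → ℝ) : Germ _ ℝ) := by
    rw [AddSubmonoidClass.coe_finsetSum, ← Germ.coe_coeAddHom, map_sum]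
    rfl
  rw [Subalgebra.coe_add, hsum, algebraMap_germ_eq, ← Germ.coe_add]
  refine Germ.coe_eq.2 ?_
  filter_upwards [hfG] with x hx
  rw [hx, Pi.add_apply, Finset.sum_apply]
  congr 1
  have h := congrArg (G x) ((EuclideanSpace.basisFun (Fin k) ℝ).sum_repr x)
  rw [map_sum] at h
  simpa using h.symm

/-- The `d`-th derivative at `0` of the restriction of an analytic germ to the line spanned by `v`.
-/
noncomputable def lineDerivGerm {k : ℕ} (v : EuclideanSpace ℝ (Fin k)) (d : ℕ) :
    analyticGerms k →ₗ[ℝ] ℝ where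
  toFun g := g.1.liftOn (fun f => iteratedDeriv d (fun t : ℝ => f (t • v)) 0) (by
    intro f₁ f₂ h
    refine Filter.EventuallyEq.iteratedDeriv_eq d ?_
    have ht : Tendsto (fun t : ℝ => t • v) (𝓝 0) (𝓝 0) := by
      have : Continuous fun t : ℝ => t • v := by fun_prop
      simpa using this.tendsto 0
    exact ht.eventually h)
  map_add' := by
    rintro ⟨_, f, hf, rfl⟩ ⟨_, g, hg, rfl⟩
    have hv : AnalyticAt ℝ (fun t : ℝ => t • v) 0 := by fun_prop
    have hf' : AnalyticAt ℝ (fun t : ℝ => f (t • v)) 0 :=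
      AnalyticAt.fun_comp (by simpa using hf) hv
    have hg' : AnalyticAt ℝ (fun t : ℝ => g (t • v)) 0 :=
      AnalyticAt.fun_comp (by simpa using hg) hv
    exact iteratedDeriv_fun_add hf'.contDiffAt hg'.contDiffAt
  map_smul' := by
    rintro c ⟨_, f, hf, rfl⟩
    exact iteratedDeriv_const_mul_field c fun t : ℝ => f (t • v)

lemma lineDerivGerm_algebraMap {k : ℕ} (v : EuclideanSpace ℝ (Fin k)) (d : ℕ) (c : ℝ) :
    lineDerivGerm v d (algebraMap ℝ _ c) = if d = 0 then c else 0 := by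
  rw [lineDerivGerm]
  simp only [LinearMap.coe_mk, AddHom.coe_mk]
  rw [algebraMap_germ_eq]
  exact iteratedDeriv_const

lemma lineDerivGerm_coordGerm_mul {k : ℕ} (v : EuclideanSpace ℝ (Fin k)) (d : ℕ) (i : Fin k)
    (g : analyticGerms k) :
    lineDerivGerm v d (coordGerm i * g) = d * v i * lineDerivGerm v (d - 1) g := by
  obtain ⟨_, f, hf, rfl⟩ := g
  have hv : AnalyticAt ℝ (fun t : ℝ => t • v) 0 := by fun_prop
  have hf' : AnalyticAt ℝ (fun t : ℝ => f (t • v)) 0 :=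
    AnalyticAt.fun_comp (by simpa using hf) hv
  change iteratedDeriv d (fun t : ℝ => (t * v i) * f (t • v)) 0
    = d * v i * iteratedDeriv (d - 1) (fun t : ℝ => f (t • v)) 0
  have e : (fun t : ℝ => (t * v i) * f (t • v)) = fun t : ℝ => v i * (t * f (t • v)) := by
    funext t; ring
  rw [e, iteratedDeriv_const_mul_field,
    iteratedDeriv_fun_mul (f := fun t : ℝ => t) contDiffAt_id hf'.contDiffAt]
  rcases d with _ | d
  · simp
  · rw [Finset.sum_eq_single 1]
    · simp [iteratedDeriv_one]; ring
    · intro j _ hj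
      rcases j with _ | j
      · simp
      · rw [show (fun x : ℝ => x) = id from rfl, iteratedDeriv_id]
        have hj' : j ≠ 0 := by omega
        simp [hj']
    · intro h; simp at h

lemma lineDerivGerm_sum_coordGerm_mul {k : ℕ} (v : EuclideanSpace ℝ (Fin k)) (d : ℕ)
    (g : analyticGerms k) :
    lineDerivGerm v d ((∑ i, coordGerm i) * g) = d * (∑ i, v i) * lineDerivGerm v (d - 1) g := by
  rw [Finset.sum_mul, map_sum]
  simp only [lineDerivGerm_coordGerm_mul]
  rw [Finset.mul_sum, Finset.sum_mul]

lemma lineDerivGerm_pow_mul {k : ℕ} (v : EuclideanSpace ℝ (Fin k)) (d : ℕ) (i : Fin k) (a : ℕ)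
    (g : analyticGerms k) :
    lineDerivGerm v d (coordGerm i ^ a * g)
      = d.descFactorial a * v i ^ a * lineDerivGerm v (d - a) g := by
  induction a generalizing g with
  | zero => simp
  | succ a ih =>
    rw [pow_succ, mul_assoc, ih, lineDerivGerm_coordGerm_mul, Nat.descFactorial_succ, Nat.sub_sub]
    push_cast
    ring

lemma lineDerivGerm_prod_mul {k : ℕ} (v : EuclideanSpace ℝ (Fin k)) (d : ℕ) (s : Finset (Fin k))
    (a : Fin k → ℕ) (g : analyticGerms k) :
    lineDerivGerm v d ((∏ i ∈ s, coordGerm i ^ a i) * g)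
      = d.descFactorial (∑ i ∈ s, a i) * (∏ i ∈ s, v i ^ a i)
        * lineDerivGerm v (d - ∑ i ∈ s, a i) g := by
  induction s using Finset.induction_on generalizing g with
  | empty => simp
  | insert i s hi ih =>
    have h := Nat.descFactorial_mul_descFactorial (n := d) (k := ∑ j ∈ s, a j)
      (m := a i + ∑ j ∈ s, a j) (by omega)
    rw [Nat.add_sub_cancel] at h
    rw [Finset.prod_insert hi, mul_comm (coordGerm i ^ a i), mul_assoc, ih, lineDerivGerm_pow_mul,
      Finset.sum_insert hi, Finset.prod_insert hi, ← h, Nat.sub_sub, add_comm (a i)]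
    push_cast
    ring

lemma lineDerivGerm_prod {k : ℕ} (v : EuclideanSpace ℝ (Fin k)) (d : ℕ) (s : Finset (Fin k))
    (a : Fin k → ℕ) :
    lineDerivGerm v d (∏ i ∈ s, coordGerm i ^ a i)
      = if ∑ i ∈ s, a i = d then (d ! : ℝ) * ∏ i ∈ s, v i ^ a i else 0 := by
  have h := lineDerivGerm_prod_mul v d s a 1
  rw [← map_one (algebraMap ℝ (analyticGerms k)), lineDerivGerm_algebraMap, map_one, mul_one] at h
  rw [h]
  split_ifs with h1 h2 h2
  · rw [h2, Nat.descFactorial_self, mul_one]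
  · rw [Nat.descFactorial_eq_zero_iff_lt.2 (by omega)]; simp
  · omega
  · rw [mul_zero]

lemma lineDerivGerm_prod_coordGerm {k : ℕ} (v : EuclideanSpace ℝ (Fin k)) (d : ℕ)
    (s : Finset (Fin k)) :
    lineDerivGerm v d (∏ i ∈ s, coordGerm i)
      = if s.card = d then (d ! : ℝ) * ∏ i ∈ s, v i else 0 := by
  simpa using lineDerivGerm_prod v d s 1

/-! ### Sums over sign vectors -/

/-- The vertex of the cube `[-1, 1]^k` with the given signs. -/
noncomputable def signVec {k : ℕ} (ε : Fin k → ℤˣ) : EuclideanSpace ℝ (Fin k) :=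
  WithLp.toLp 2 fun i => ((ε i : ℤ) : ℝ)

lemma signVec_sq {k : ℕ} (ε : Fin k → ℤˣ) (i : Fin k) : signVec ε i ^ 2 = 1 := by
  rcases Int.units_eq_one_or (ε i) with h | h <;> simp [signVec, h]

lemma sum_prod_signVec_eq_zero {k : ℕ} {R : Finset (Fin k)} (hR : R.Nonempty) :
    ∑ ε : Fin k → ℤˣ, ∏ i ∈ R, signVec ε i = 0 := by
  obtain ⟨i, hi⟩ := hR
  have h := Equiv.sum_comp (Equiv.mulLeft (Pi.mulSingle i (-1 : ℤˣ)))
    fun ε : Fin k → ℤˣ => ∏ j ∈ R, signVec ε j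
  have h2 : ∀ ε : Fin k → ℤˣ,
      ∏ j ∈ R, signVec (Equiv.mulLeft (Pi.mulSingle i (-1 : ℤˣ)) ε) j
        = - ∏ j ∈ R, signVec ε j := by
    intro ε
    rw [← Finset.mul_prod_erase _ _ hi, ← Finset.mul_prod_erase _ _ hi, ← neg_mul]
    congr 1
    · simp [signVec]
    · refine Finset.prod_congr rfl fun j hj => ?_
      simp [signVec, Pi.mulSingle_eq_of_ne (Finset.ne_of_mem_erase hj)]
  rw [Finset.sum_congr rfl fun ε _ => h2 ε, Finset.sum_neg_distrib] at h
  linarith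

/-- The `d`-th Taylor coefficients of a germ along the diagonals of the cube are values of a
polynomial of degree `d`, and so orthogonal to the characters of higher degree. -/
lemma sum_prod_signVec_mul_lineDerivGerm_eq_zero {k : ℕ} (d : ℕ) :
    ∀ (R : Finset (Fin k)) (g : analyticGerms k), d < R.card →
      ∑ ε : Fin k → ℤˣ, (∏ i ∈ R, signVec ε i) * lineDerivGerm (signVec ε) d g = 0 := by
  induction d with
  | zero =>
    intro R g hR
    obtain ⟨c, h, rfl⟩ := exists_eq_algebraMap_add_sum_coordGerm_mul g
    simp only [map_add, map_sum, lineDerivGerm_algebraMap, lineDerivGerm_coordGerm_mul]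
    simp only [if_true, Nat.cast_zero, zero_mul, Finset.sum_const_zero, add_zero]
    rw [← Finset.sum_mul, sum_prod_signVec_eq_zero (Finset.card_pos.1 hR), zero_mul]
  | succ d ih =>
    intro R g hR
    obtain ⟨c, h, rfl⟩ := exists_eq_algebraMap_add_sum_coordGerm_mul g
    simp only [map_add, map_sum, lineDerivGerm_algebraMap, lineDerivGerm_coordGerm_mul]
    simp only [Nat.add_eq_zero_iff, one_ne_zero, and_false, if_false, zero_add, Finset.mul_sum,
      Nat.add_sub_cancel]
    rw [Finset.sum_comm]
    refine Finset.sum_eq_zero fun i _ => ?_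
    by_cases hi : i ∈ R
    · have := ih (R.erase i) (h i) (by rw [Finset.card_erase_of_mem hi]; omega)
      rw [← mul_zero ((d + 1 : ℕ) : ℝ), ← this, Finset.mul_sum]
      refine Finset.sum_congr rfl fun ε _ => ?_
      rw [← Finset.mul_prod_erase _ _ hi]
      linear_combination ((d + 1 : ℕ) : ℝ) * (∏ j ∈ R.erase i, signVec ε j)
        * lineDerivGerm (signVec ε) d (h i) * signVec_sq ε i
    · have := ih (insert i R) (h i) (by rw [Finset.card_insert_of_notMem hi]; omega)
      rw [← mul_zero ((d + 1 : ℕ) : ℝ), ← this, Finset.mul_sum]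
      refine Finset.sum_congr rfl fun ε _ => ?_
      rw [Finset.prod_insert hi]
      ring

lemma sum_signVec_sq_sub_one_ne_zero {m : ℕ} (ε : Fin (2 * m) → ℤˣ) :
    (∑ i, signVec ε i) ^ 2 - 1 ≠ 0 := by
  have h1 : (∑ i, signVec ε i) = ((∑ i, (ε i : ℤ) : ℤ) : ℝ) := by simp [signVec]
  have h2 : Even (∑ i, (ε i : ℤ)) := by
    have h3 : ∑ i, (ε i : ℤ) = ∑ i, ((ε i : ℤ) - 1) + 2 * m := by simp
    rw [h3, even_iff_two_dvd]
    refine dvd_add (Finset.dvd_sum fun i _ => ?_) (dvd_mul_right _ _)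
    rcases Int.units_eq_one_or (ε i) with h | h <;> simp [h]
  obtain ⟨r, hr⟩ := h2
  rw [h1, hr]
  intro h
  have h' : (r + r) ^ 2 - 1 = (0 : ℤ) := by exact_mod_cast h
  have h3 : (2 : ℤ) ∣ 1 := ⟨2 * r ^ 2, by linarith⟩
  norm_num at h3

/-! ### The Milnor algebra of the cubic jet -/

lemma coe_sum_coordGerm {k : ℕ} :
    ((∑ i, coordGerm i : analyticGerms k) : Germ (𝓝 (0 : EuclideanSpace ℝ (Fin k))) ℝ)
      = ((fun x : EuclideanSpace ℝ (Fin k) => ∑ i, x i) : Germ _ ℝ) := by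
  have : (fun x : EuclideanSpace ℝ (Fin k) => ∑ i, x i)
      = ∑ i, fun x : EuclideanSpace ℝ (Fin k) => x i := by
    funext x; rw [Finset.sum_apply]
  rw [this, AddSubmonoidClass.coe_finsetSum, ← Germ.coe_coeAddHom, map_sum]
  rfl

lemma fderiv_cubicJet (m : ℕ) (x : EuclideanSpace ℝ (Fin (2 * m))) (i : Fin (2 * m)) :
    fderiv ℝ (cubicJet m) x (EuclideanSpace.single i 1)
      = 1 / 2 * ((∑ j, x j) ^ 2 - x i ^ 2) := by
  have hp : ∀ j, HasFDerivAt (fun x : EuclideanSpace ℝ (Fin (2 * m)) => x j)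
      (EuclideanSpace.proj j : EuclideanSpace ℝ (Fin (2 * m)) →L[ℝ] ℝ) x := fun j =>
    (EuclideanSpace.proj j : EuclideanSpace ℝ (Fin (2 * m)) →L[ℝ] ℝ).hasFDerivAt
  have h1 := ((HasFDerivAt.fun_sum (u := Finset.univ) fun j _ => hp j).pow 3)
  have h2 := HasFDerivAt.fun_sum (u := Finset.univ) fun j _ => (hp j).pow 3
  have h3 : HasFDerivAt (cubicJet m) _ x :=
    ((h1.sub h2).mul_const (1 / 6 : ℝ)).congr_of_eventuallyEq
    (Eventually.of_forall fun y => by simp [cubicJet, div_eq_mul_inv])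
  rw [h3.fderiv]
  simp
  ring

lemma pderivGerm_areaGerm (m : ℕ) (i : Fin (2 * m)) :
    pderivGerm i (areaGerm m)
      = algebraMap ℝ _ (1 / 2) * ((∑ j, coordGerm j) ^ 2 - coordGerm i ^ 2) := by
  refine Subtype.ext ?_
  rw [Subalgebra.coe_mul, AddSubgroupClass.coe_sub, SubmonoidClass.coe_pow, coe_sum_coordGerm,
    algebraMap_germ_eq]
  exact congrArg Germ.ofFun (funext fun x => fderiv_cubicJet m x i)

/-- The class of the coordinate `x_i` in the Milnor algebra. -/
noncomputable def coordClass (m : ℕ) (i : Fin (2 * m)) : MilnorAlgebra (areaGerm m) :=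
  Ideal.Quotient.mk (jacobianIdeal (areaGerm m)) (coordGerm i)

lemma coordClass_sq (m : ℕ) (i : Fin (2 * m)) :
    coordClass m i ^ 2 = (∑ j, coordClass m j) ^ 2 := by
  have h : pderivGerm i (areaGerm m) ∈ jacobianIdeal (areaGerm m) :=
    Ideal.subset_span ⟨i, rfl⟩
  have h2 := Ideal.mul_mem_left _ (algebraMap ℝ (analyticGerms (2 * m)) 2) h
  rw [pderivGerm_areaGerm, ← mul_assoc, ← map_mul, mul_one_div_cancel two_ne_zero, map_one,
    one_mul] at h2
  have h3 := Ideal.Quotient.eq_zero_iff_mem.2 h2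
  rw [map_sub, map_pow, map_pow, map_sum] at h3
  exact (sub_eq_zero.1 h3).symm

lemma squarefreeClass_eq (m : ℕ) (S : Finset (Fin (2 * m))) :
    squarefreeClass (areaGerm m) S = ∏ i ∈ S, coordClass m i := map_prod _ _ _

lemma monomialClass_eq (m : ℕ) (a : Fin (2 * m) → ℕ) :
    monomialClass (areaGerm m) a = ∏ i, coordClass m i ^ a i := by
  rw [monomialClass, map_prod]
  exact Finset.prod_congr rfl fun i _ => map_pow _ _ _

lemma map_monomialClass_eq_zero {m : ℕ} (l : MilnorAlgebra (areaGerm m) →ₗ[ℝ] ℝ)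
    (a : Fin (2 * m) → ℕ)
    (h : ∀ R : Finset (Fin (2 * m)), R.card = ∑ i, a i → l (squarefreeClass (areaGerm m) R) = 0) :
    l (monomialClass (areaGerm m) a) = 0 := by
  rw [monomialClass_eq]
  refine map_monomial_eq_zero (by simp) (coordClass_sq m) rfl l a fun R hR => ?_
  rw [← squarefreeClass_eq]
  exact h R hR

lemma map_pow_mul_squarefreeClass_eq_zero {m : ℕ} (l : MilnorAlgebra (areaGerm m) →ₗ[ℝ] ℝ) (j : ℕ)
    (S : Finset (Fin (2 * m)))
    (h : ∀ R : Finset (Fin (2 * m)), R.card = S.card + 2 * j →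
      l (squarefreeClass (areaGerm m) R) = 0) :
    l (((∑ i, coordClass m i) ^ 2) ^ j * squarefreeClass (areaGerm m) S) = 0 := by
  rw [squarefreeClass_eq]
  refine map_pow_mul_prod_eq_zero (by simp) (coordClass_sq m) rfl j l S fun R hR => ?_
  rw [← squarefreeClass_eq]
  exact h R hR

lemma monomialClass_eq_zero {m : ℕ} {a : Fin (2 * m) → ℕ} (ha : 2 * m < ∑ i, a i) :
    monomialClass (areaGerm m) a = 0 := by
  rw [monomialClass_eq]
  exact prod_pow_eq_zero_of_card_lt (by simp) (coordClass_sq m) rfl (by simpa using ha)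

/-- Hadamard's lemma, applied repeatedly, writes a germ as a polynomial plus a combination of
monomials of degree `2m + 1`, which vanish in the Milnor algebra. -/
lemma span_monomialClass_eq_top (m : ℕ) :
    Submodule.span ℝ (Set.range (monomialClass (areaGerm m))) = ⊤ := by
  set N := Submodule.span ℝ (Set.range (monomialClass (areaGerm m))) with hN
  have key : ∀ (D : ℕ) (a : Fin (2 * m) → ℕ) (g : analyticGerms (2 * m)),
      ∑ i, a i + D = 2 * m + 1 →
      monomialClass (areaGerm m) a * Ideal.Quotient.mk (jacobianIdeal (areaGerm m)) g ∈ N := by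
    intro D
    induction D with
    | zero =>
      intro a g ha
      rw [monomialClass_eq_zero (by omega), zero_mul]
      exact N.zero_mem
    | succ D ih =>
      intro a g ha
      obtain ⟨c, h, rfl⟩ := exists_eq_algebraMap_add_sum_coordGerm_mul g
      rw [map_add, map_sum, mul_add, Finset.mul_sum]
      refine N.add_mem ?_ (N.sum_mem fun i _ => ?_)
      · exact N.mul_algebraMap_mem (Submodule.subset_span ⟨a, rfl⟩) c
      · have := ih (a + Pi.single i 1) (h i) (by
          simp only [Pi.add_apply, Finset.sum_add_distrib, Finset.sum_pi_single', Finset.mem_univ,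
            if_true]
          omega)
        convert this using 1
        rw [map_mul, ← mul_assoc]
        congr 1
        rw [monomialClass_eq, monomialClass_eq]
        simp only [Pi.add_apply, pow_add, Finset.prod_mul_distrib]
        congr 1
        rw [Finset.prod_eq_single i]
        · simp [coordClass]
        · intro j _ hj; simp [hj]
        · simp
  rw [eq_top_iff]
  rintro g -
  obtain ⟨g, rfl⟩ := Ideal.Quotient.mk_surjective g
  have := key (2 * m + 1) 0 g (by simp)
  rwa [monomialClass_eq, Finset.prod_eq_one (by simp), one_mul] at this

lemma eq_zero_of_map_squarefreeClass {m : ℕ} {l : MilnorAlgebra (areaGerm m) →ₗ[ℝ] ℝ}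
    (h : ∀ S, l (squarefreeClass (areaGerm m) S) = 0) : l = 0 :=
  LinearMap.ext_on_range (span_monomialClass_eq_top m) fun a =>
    map_monomialClass_eq_zero l a fun R _ => h R

lemma span_squarefreeClass_eq_top (m : ℕ) :
    Submodule.span ℝ (Set.range (squarefreeClass (areaGerm m))) = ⊤ := by
  by_contra h
  obtain ⟨l, hl, hle⟩ := Submodule.exists_le_ker_of_lt_top _ (lt_top_iff_ne_top.2 h)
  exact hl (eq_zero_of_map_squarefreeClass fun S => hle (Submodule.subset_span ⟨S, rfl⟩))

instance finite_milnorAlgebra (m : ℕ) : Module.Finite ℝ (MilnorAlgebra (areaGerm m)) :=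
  ⟨span_squarefreeClass_eq_top m ▸ Submodule.fg_span (Set.finite_range _)⟩

lemma IsNormalized.unique {m : ℕ} {l l' : MilnorAlgebra (areaGerm m) →ₗ[ℝ] ℝ} {ω : ℝ}
    (h : IsNormalized l ω) (h' : IsNormalized l' ω) : l = l' := by
  rw [← sub_eq_zero]
  refine eq_zero_of_map_squarefreeClass fun S => ?_
  rw [LinearMap.sub_apply]
  by_cases hS : S = Finset.univ
  · rw [hS, h.1, h'.1, sub_self]
  · rw [h.2 S hS, h'.2 S hS, sub_self]

/-! ### The normalized functional -/

lemma LinearMap.exists_comp_eq_of_ker_le {V W : Type*} [AddCommGroup V] [Module ℝ V]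
    [AddCommGroup W] [Module ℝ W] {f : V →ₗ[ℝ] W} (hf : Function.Surjective f) {g : V →ₗ[ℝ] ℝ}
    (h : ∀ v, f v = 0 → g v = 0) : ∃ l : W →ₗ[ℝ] ℝ, l ∘ₗ f = g := by
  obtain ⟨s, hs⟩ := f.exists_rightInverse_of_surjective (LinearMap.range_eq_top.2 hf)
  refine ⟨g ∘ₗ s, LinearMap.ext fun v => ?_⟩
  have h1 := h (s (f v) - v) (by
    rw [map_sub, ← LinearMap.comp_apply, hs, LinearMap.id_apply, sub_self])
  rw [map_sub, sub_eq_zero] at h1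
  exact h1

/-- The functional `∑_ε (∏ ε_i) / ((∑ ε_i) ^ 2 - 1) * (d/dt)^{2m} g(t ε)` on germs, where `ε` runs
over the sign vectors. The denominators are, up to the factor `2`, the values at `ε` of the partial
derivatives `((∑ x_i) ^ 2 - x_i ^ 2) / 2`. -/
noncomputable def cubeFunctional (m : ℕ) : analyticGerms (2 * m) →ₗ[ℝ] ℝ :=
  ∑ ε : Fin (2 * m) → ℤˣ,
    ((∏ i, signVec ε i) / ((∑ i, signVec ε i) ^ 2 - 1)) • lineDerivGerm (signVec ε) (2 * m)

lemma cubeFunctional_apply (m : ℕ) (g : analyticGerms (2 * m)) :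
    cubeFunctional m g = ∑ ε : Fin (2 * m) → ℤˣ,
      (∏ i, signVec ε i) / ((∑ i, signVec ε i) ^ 2 - 1) * lineDerivGerm (signVec ε) (2 * m) g := by
  simp [cubeFunctional, LinearMap.sum_apply]

lemma lineDerivGerm_algebraMap_mul {k : ℕ} (v : EuclideanSpace ℝ (Fin k)) (d : ℕ) (c : ℝ)
    (g : analyticGerms k) :
    lineDerivGerm v d (algebraMap ℝ _ c * g) = c * lineDerivGerm v d g := by
  rw [← Algebra.smul_def, map_smul, smul_eq_mul]

lemma cubeFunctional_eq_zero_of_mem {m : ℕ} (hm : 1 ≤ m) {g : analyticGerms (2 * m)}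
    (hg : g ∈ jacobianIdeal (areaGerm m)) : cubeFunctional m g = 0 := by
  obtain ⟨h, rfl⟩ := Ideal.mem_span_range_iff_exists_fun.1 hg
  rw [map_sum]
  refine Finset.sum_eq_zero fun i _ => ?_
  rw [cubeFunctional_apply]
  have key := sum_prod_signVec_mul_lineDerivGerm_eq_zero (2 * m - 1 - 1) Finset.univ (h i)
    (by rw [Finset.card_univ, Fintype.card_fin]; omega)
  rw [← mul_zero (1 / 2 * ((2 * m : ℕ) : ℝ) * ((2 * m - 1 : ℕ) : ℝ)), ← key, Finset.mul_sum]
  refine Finset.sum_congr rfl fun ε _ => ?_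
  have e : h i * pderivGerm i (areaGerm m) = algebraMap ℝ _ (1 / 2) *
      ((∑ j, coordGerm j) * ((∑ j, coordGerm j) * h i) - coordGerm i * (coordGerm i * h i)) := by
    rw [pderivGerm_areaGerm]; ring
  rw [e, lineDerivGerm_algebraMap_mul, map_sub, lineDerivGerm_sum_coordGerm_mul,
    lineDerivGerm_sum_coordGerm_mul, lineDerivGerm_coordGerm_mul, lineDerivGerm_coordGerm_mul]
  have h1 := sum_signVec_sq_sub_one_ne_zero ε
  have h2 := signVec_sq ε i
  field_simp
  rw [h2]
  ring

/-- The weights that `cubeFunctional` gives to the monomials of degree `2m`, up to the factor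
`(2m)!`, as a function of the set of odd exponents. -/
noncomputable def cubeWeight (m : ℕ) (R : Finset (Fin (2 * m))) : ℝ :=
  ∑ ε : Fin (2 * m) → ℤˣ,
    (∏ i, signVec ε i) / ((∑ i, signVec ε i) ^ 2 - 1) * ∏ i ∈ R, signVec ε i

lemma cubeWeight_congr (m : ℕ) {R R' : Finset (Fin (2 * m))} (h : R.card = R'.card) :
    cubeWeight m R = cubeWeight m R' := by
  refine Finset.eq_of_swap_invariant (X := Finset.univ) (d := R.card) ?_ R
    (Finset.mem_powersetCard.2 ⟨Finset.subset_univ _, rfl⟩) R'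
    (Finset.mem_powersetCard.2 ⟨Finset.subset_univ _, h.symm⟩)
  intro i _ j _ hij T hT _
  have hiT : i ∉ T := fun hh => by simpa using hT hh
  have hjT : j ∉ T := fun hh => by simpa using hT hh
  rw [cubeWeight, ← Equiv.sum_comp (Equiv.arrowCongr (Equiv.swap i j) (Equiv.refl ℤˣ))]
  refine Finset.sum_congr rfl fun ε _ => ?_
  have hs : ∀ k, signVec (Equiv.arrowCongr (Equiv.swap i j) (Equiv.refl ℤˣ) ε) k
      = signVec ε (Equiv.swap i j k) := fun k => by simp [signVec]
  simp only [hs]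
  rw [Equiv.prod_comp (Equiv.swap i j) fun k => signVec ε k,
    Equiv.sum_comp (Equiv.swap i j) fun k => signVec ε k, Finset.prod_insert hiT,
    Finset.prod_insert hjT, Equiv.swap_apply_left]
  congr 2
  refine Finset.prod_congr rfl fun k hk => ?_
  rw [Equiv.swap_apply_of_ne_of_ne (ne_of_mem_of_not_mem hk hiT) (ne_of_mem_of_not_mem hk hjT)]

lemma cubeFunctional_monomial (m : ℕ) {a : Fin (2 * m) → ℕ} (ha : ∑ i, a i = 2 * m) :
    cubeFunctional m (∏ i, coordGerm i ^ a i)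
      = (2 * m)! * cubeWeight m (Finset.univ.filter fun i => Odd (a i)) := by
  rw [cubeFunctional_apply, cubeWeight, Finset.mul_sum]
  refine Finset.sum_congr rfl fun ε _ => ?_
  rw [lineDerivGerm_prod, if_pos ha, prod_pow_eq_pow_mul_prod (signVec_sq ε), one_pow, one_mul]
  ring

lemma cubeFunctional_prod (m : ℕ) {S : Finset (Fin (2 * m))} (hS : S ≠ Finset.univ) :
    cubeFunctional m (∏ i ∈ S, coordGerm i) = 0 := by
  rw [cubeFunctional_apply]
  refine Finset.sum_eq_zero fun ε _ => ?_
  rw [lineDerivGerm_prod_coordGerm, if_neg, mul_zero]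
  intro h
  exact hS ((Finset.card_eq_iff_eq_univ S).1 (by rw [h, Fintype.card_fin]))

/-- In the Milnor algebra `x_i * ∏_{k ≠ j} x_k` is the product of all coordinates for `i = j`, and
has a factor `x_i ^ 2` otherwise. -/
lemma coordClass_mul_prod_erase (m : ℕ) (i j : Fin (2 * m)) :
    coordClass m i * squarefreeClass (areaGerm m) (Finset.univ.erase j)
      = if i = j then squarefreeClass (areaGerm m) Finset.univ
        else (∑ k, coordClass m k) ^ 2
          * squarefreeClass (areaGerm m) ((Finset.univ.erase j).erase i) := by
  simp only [squarefreeClass_eq]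
  split_ifs with h
  · rw [h, Finset.mul_prod_erase _ _ (Finset.mem_univ j)]
  · rw [← coordClass_sq m i, ← Finset.mul_prod_erase (Finset.univ.erase j) (coordClass m)
      (Finset.mem_erase.2 ⟨h, Finset.mem_univ i⟩)]
    ring

lemma exists_functional_eq_cubeFunctional {m : ℕ} (hm : 1 ≤ m) :
    ∃ l : MilnorAlgebra (areaGerm m) →ₗ[ℝ] ℝ, ∀ g,
      l (Ideal.Quotient.mk (jacobianIdeal (areaGerm m)) g) = cubeFunctional m g := by
  obtain ⟨l, hl⟩ := LinearMap.exists_comp_eq_of_ker_le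
    (f := (Ideal.Quotient.mkₐ ℝ (jacobianIdeal (areaGerm m))).toLinearMap)
    Ideal.Quotient.mk_surjective (g := cubeFunctional m) fun g hg =>
      cubeFunctional_eq_zero_of_mem hm (Ideal.Quotient.eq_zero_iff_mem.1 hg)
  exact ⟨l, fun g => LinearMap.congr_fun hl g⟩

/-- If `cubeFunctional` vanished on `∏ x_i`, it would vanish on all monomials of degree `2m`. But on
the polynomial `(∑ x_i) * ∑_j ∏_{k ≠ j} x_k - ∏ x_i` each term of its defining sum is `(2m)!`. -/
lemma cubeFunctional_prod_univ_ne_zero {m : ℕ} (hm : 1 ≤ m) :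
    cubeFunctional m (∏ i, coordGerm i) ≠ 0 := by
  intro h0
  obtain ⟨l, hl⟩ := exists_functional_eq_cubeFunctional hm
  have hsq : ∀ S, l (squarefreeClass (areaGerm m) S) = 0 := fun S => by
    rw [squarefreeClass, hl]
    by_cases hS : S = Finset.univ
    · rw [hS, h0]
    · exact cubeFunctional_prod m hS
  have hl0 := eq_zero_of_map_squarefreeClass hsq
  have h1 : cubeFunctional m
      ((∑ i, coordGerm i) * ∑ j, ∏ k ∈ Finset.univ.erase j, coordGerm k
        - ∏ i, coordGerm i) = 0 := by
    rw [← hl, hl0, LinearMap.zero_apply]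
  have h2 : cubeFunctional m
      ((∑ i, coordGerm i) * ∑ j, ∏ k ∈ Finset.univ.erase j, coordGerm k
        - ∏ i, coordGerm i) = ∑ _ε : Fin (2 * m) → ℤˣ, ((2 * m)! : ℝ) := by
    rw [cubeFunctional_apply]
    refine Finset.sum_congr rfl fun ε _ => ?_
    rw [map_sub, lineDerivGerm_sum_coordGerm_mul, map_sum, lineDerivGerm_prod_coordGerm,
      if_pos (by simp)]
    have h3 : ∀ j : Fin (2 * m), lineDerivGerm (signVec ε) (2 * m - 1)
        (∏ k ∈ Finset.univ.erase j, coordGerm k)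
        = ((2 * m - 1)! : ℝ) * (signVec ε j * ∏ k, signVec ε k) := by
      intro j
      rw [lineDerivGerm_prod_coordGerm, if_pos (by
        rw [Finset.card_erase_of_mem (Finset.mem_univ j), Finset.card_univ, Fintype.card_fin]),
        ← Finset.mul_prod_erase _ _ (Finset.mem_univ j), ← mul_assoc (signVec ε j),
        ← pow_two, signVec_sq, one_mul]
    rw [Finset.sum_congr rfl fun j _ => h3 j, ← Finset.mul_sum, ← Finset.sum_mul]
    have h4 : ((2 * m)! : ℝ) = (2 * m : ℕ) * ((2 * m - 1)! : ℝ) := by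
      exact_mod_cast (Nat.mul_factorial_pred (by omega)).symm
    have h5 : (∏ i, signVec ε i) ^ 2 = 1 := by
      rw [← Finset.prod_pow, Finset.prod_eq_one fun i _ => signVec_sq ε i]
    have h6 := sum_signVec_sq_sub_one_ne_zero ε
    rw [h4, div_mul_eq_mul_div, div_eq_iff h6]
    linear_combination ((2 * m : ℕ) * ((2 * m - 1)! : ℝ)) * ((∑ i, signVec ε i) ^ 2 - 1) * h5
  rw [h1] at h2
  rw [Finset.sum_const, Finset.card_univ, nsmul_eq_mul] at h2
  have : (0 : ℝ) < Fintype.card (Fin (2 * m) → ℤˣ) * ((2 * m)! : ℝ) := by positivity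
  linarith

lemma exists_isNormalized_eq_cubeFunctional {m : ℕ} (hm : 1 ≤ m) (ω : ℝ) :
    ∃ l : MilnorAlgebra (areaGerm m) →ₗ[ℝ] ℝ, IsNormalized l ω ∧ ∃ c : ℝ, ∀ g,
      l (Ideal.Quotient.mk (jacobianIdeal (areaGerm m)) g) = c * cubeFunctional m g := by
  obtain ⟨l, hl⟩ := exists_functional_eq_cubeFunctional hm
  have h0 := cubeFunctional_prod_univ_ne_zero hm
  refine ⟨(ω / cubeFunctional m (∏ i, coordGerm i)) • l, ⟨?_, fun S hS => ?_⟩,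
    _, fun g => by rw [LinearMap.smul_apply, hl, smul_eq_mul]⟩
  · rw [LinearMap.smul_apply, squarefreeClass, hl, smul_eq_mul, div_mul_cancel₀ _ h0]
  · rw [LinearMap.smul_apply, squarefreeClass, hl, cubeFunctional_prod m hS, smul_zero]

lemma existsUnique_isNormalized {m : ℕ} (hm : 1 ≤ m) (ω : ℝ) :
    ∃! l : MilnorAlgebra (areaGerm m) →ₗ[ℝ] ℝ, IsNormalized l ω := by
  obtain ⟨l, hl, -⟩ := exists_isNormalized_eq_cubeFunctional hm ω
  exact ⟨l, hl, fun l' hl' => hl'.unique hl⟩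

lemma IsNormalized.map_monomialClass_congr {m : ℕ} (hm : 1 ≤ m)
    {l : MilnorAlgebra (areaGerm m) →ₗ[ℝ] ℝ} {ω : ℝ} (h : IsNormalized l ω)
    {a b : Fin (2 * m) → ℕ} (ha : ∑ i, a i = 2 * m) (hb : ∑ i, b i = 2 * m)
    (hab : (Finset.univ.filter fun i => Odd (a i)).card
      = (Finset.univ.filter fun i => Odd (b i)).card) :
    l (monomialClass (areaGerm m) a) = l (monomialClass (areaGerm m) b) := by
  obtain ⟨l', hl', c, hc⟩ := exists_isNormalized_eq_cubeFunctional hm ω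
  rw [h.unique hl', monomialClass, monomialClass, hc, hc, cubeFunctional_monomial m ha,
    cubeFunctional_monomial m hb, cubeWeight_congr m hab]

lemma bCoeff_zero (m : ℕ) (ω : ℝ) : bCoeff m ω 0 = ω := by
  have : (((2 * m - 1)‼ : ℕ) : ℝ) ≠ 0 := by
    exact_mod_cast (Nat.doubleFactorial_pos _).ne'
  rw [bCoeff]
  simp only [mul_zero, Nat.doubleFactorial, pow_zero, one_mul, Nat.cast_one, mul_one, Nat.sub_zero]
  rw [mul_div_assoc, div_self this, mul_one]

lemma bCoeff_succ {m p : ℕ} (hp : p < m) (ω : ℝ) :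
    (2 * m - 2 * p - 1 : ℝ) * bCoeff m ω (p + 1) = -(2 * p + 2) * bCoeff m ω p := by
  have h1 : (2 * m - 2 * p - 1)‼ = (2 * m - 2 * p - 1) * (2 * m - 2 * (p + 1) - 1)‼ := by
    rcases Nat.lt_or_ge (p + 1) m with h | h
    · rw [show 2 * m - 2 * p - 1 = (2 * m - 2 * (p + 1) - 1) + 2 by omega]
      exact Nat.doubleFactorial_add_two _
    · obtain rfl : m = p + 1 := by omega
      rw [show 2 * (p + 1) - 2 * p - 1 = 1 by omega,
        show 2 * (p + 1) - 2 * (p + 1) - 1 = 0 by omega]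
      rfl
  have h2 : (2 * (p + 1))‼ = (2 * p + 2) * (2 * p)‼ := Nat.doubleFactorial_add_two _
  have h3 : ((2 * m - 2 * p - 1 : ℕ) : ℝ) = 2 * m - 2 * p - 1 := by
    rw [Nat.sub_sub, Nat.cast_sub (by omega)]; push_cast; ring
  rw [bCoeff, bCoeff, h1, h2, Nat.cast_mul, Nat.cast_mul, h3]
  push_cast
  ring

/-- The value of the normalized functional on a monomial of degree `2m` depends only on the number
of odd exponents, and `mul_esymm_relations` relates the values for `2p` and `2p + 2`. -/
lemma IsNormalized.map_pow_mul_squarefreeClass {m : ℕ} (hm : 1 ≤ m)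
    {l : MilnorAlgebra (areaGerm m) →ₗ[ℝ] ℝ} {ω : ℝ} (h : IsNormalized l ω) {j : ℕ} (hj : j ≤ m) :
    ∀ S : Finset (Fin (2 * m)), S.card + 2 * j = 2 * m →
      l (((∑ i, coordClass m i) ^ 2) ^ j * squarefreeClass (areaGerm m) S) = bCoeff m ω j := by
  induction j with
  | zero =>
    intro S hS
    have : S = Finset.univ := (Finset.card_eq_iff_eq_univ S).1 (by rw [Fintype.card_fin]; omega)
    rw [this, pow_zero, one_mul, h.1, bCoeff_zero]
  | succ j ih =>
    intro S hS
    set q := (∑ i, coordClass m i) ^ 2 with hq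
    obtain ⟨p, hp⟩ : ∃ p, m = p + j + 1 := ⟨m - j - 1, by omega⟩
    have hSp : S.card = 2 * p := by omega
    -- a monomial in the class `q ^ (j + 1) * ∏_{i ∈ S} x_i`
    have hmon : ∀ S : Finset (Fin (2 * m)), S.card = 2 * p → ∃ a : Fin (2 * m) → ℕ,
        ∑ i, a i = 2 * m ∧ (Finset.univ.filter fun i => Odd (a i)) = S ∧
        q ^ (j + 1) * squarefreeClass (areaGerm m) S = monomialClass (areaGerm m) a := by
      intro S hS
      have i₀ : Fin (2 * m) := ⟨0, by omega⟩
      set a : Fin (2 * m) → ℕ :=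
        fun i => (if i ∈ S then 1 else 0) + 2 * (if i = i₀ then j + 1 else 0) with ha
      have hodd : (Finset.univ.filter fun i => Odd (a i)) = S := by
        ext i
        simp only [ha, Finset.mem_filter, Finset.mem_univ, true_and]
        by_cases hi : i ∈ S
        · simp only [hi, if_true, iff_true]
          exact ⟨_, add_comm _ _⟩
        · simp only [hi, if_false, zero_add, iff_false, Nat.not_odd_iff_even]
          exact even_two_mul _
      have hhalf : ∑ i, a i / 2 = j + 1 := by
        have : ∀ i, a i / 2 = if i = i₀ then j + 1 else 0 := by
          intro i
          simp only [ha]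
          split_ifs <;> omega
        rw [Finset.sum_congr rfl fun i _ => this i]
        simp
      refine ⟨a, ?_, hodd, ?_⟩
      · rw [sum_eq_two_mul_sum_half_add_card_odd, hodd, hhalf]; omega
      · rw [monomialClass_eq, prod_pow_eq_pow_mul_prod (coordClass_sq m), hodd, hhalf,
          squarefreeClass_eq]
    have hconst : ∀ T ∈ Finset.univ.powersetCard (2 * p),
        l (q ^ (j + 1) * squarefreeClass (areaGerm m) T)
          = l (q ^ (j + 1) * squarefreeClass (areaGerm m) S) := by
      intro T hT
      obtain ⟨a, ha1, ha2, ha3⟩ := hmon T (Finset.mem_powersetCard.1 hT).2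
      obtain ⟨b, hb1, hb2, hb3⟩ := hmon S hSp
      rw [ha3, hb3]
      refine h.map_monomialClass_congr hm ha1 hb1 ?_
      rw [ha2, hb2, hSp, (Finset.mem_powersetCard.1 hT).2]
    have hrel := (mul_esymm_relations (X := Finset.univ) (w := q ^ j) (coordClass_sq m)
      rfl p).2
    have hrel2 := congrArg l hrel
    rw [map_smul, map_smul, ← mul_assoc, ← pow_succ', Finset.mul_sum, Finset.mul_sum, map_sum,
      map_sum] at hrel2
    simp only [← squarefreeClass_eq] at hrel2
    rw [Finset.sum_congr rfl hconst, Finset.sum_congr rfl fun T hT => ih (by omega) T (by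
      rw [(Finset.mem_powersetCard.1 hT).2]; omega), Finset.sum_const, Finset.sum_const,
      Finset.card_powersetCard, Finset.card_powersetCard, Finset.card_univ, Fintype.card_fin,
      nsmul_eq_mul, nsmul_eq_mul, smul_eq_mul, smul_eq_mul] at hrel2
    have hb := bCoeff_succ (m := m) (p := j) (by omega) ω
    have hc1 := Nat.choose_succ_right_eq (2 * m) (2 * p)
    have hc2 := Nat.choose_succ_right_eq (2 * m) (2 * p + 1)
    have hc1' : ((2 * m).choose (2 * p + 1) : ℝ) * (2 * p + 1)
        = (2 * m).choose (2 * p) * (2 * j + 2) := by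
      rw [show 2 * m - 2 * p = 2 * j + 2 by omega] at hc1
      exact_mod_cast hc1
    have hc2' : ((2 * m).choose (2 * p + 2) : ℝ) * (2 * p + 2)
        = (2 * m).choose (2 * p + 1) * (2 * j + 1) := by
      rw [show 2 * m - (2 * p + 1) = 2 * j + 1 by omega] at hc2
      exact_mod_cast hc2
    have hm' : (m : ℝ) = p + j + 1 := by exact_mod_cast hp
    have hpos : ((2 * m).choose (2 * p) : ℝ) ≠ 0 := by
      exact_mod_cast (Nat.choose_pos (by omega)).ne'
    have hne1 : (2 * (p : ℝ) + 1) ≠ 0 := by positivity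
    have hne2 : (2 * (j : ℝ) + 1) ≠ 0 := by positivity
    set X := l (q ^ (j + 1) * squarefreeClass (areaGerm m) S)
    set C0 : ℝ := ((2 * m).choose (2 * p) : ℝ)
    set C1 : ℝ := ((2 * m).choose (2 * p + 1) : ℝ)
    set C2 : ℝ := ((2 * m).choose (2 * p + 2) : ℝ)
    push_cast at hrel2
    rw [hm'] at hrel2 hb
    have e1 : (2 * (j : ℝ) + 1) * (C0 * (2 * p + 1)) * X
        = (2 * (j : ℝ) + 1) * (C0 * (2 * p + 1)) * bCoeff m ω (j + 1) := by
      linear_combination (2 * (p : ℝ) + 1) * hrel2 - (2 * p + 1) * bCoeff m ω j * hc2'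
        - (2 * j + 1) * bCoeff m ω j * hc1' - (2 * j + 1) * C0 * hb
    exact mul_left_cancel₀ (by positivity) e1

lemma IsNormalized.map_monomialClass {m : ℕ} (hm : 1 ≤ m)
    {l : MilnorAlgebra (areaGerm m) →ₗ[ℝ] ℝ} {ω : ℝ} (h : IsNormalized l ω)
    {a : Fin (2 * m) → ℕ} {p : ℕ} (ha : ∑ i, a i = 2 * m)
    (hp : (Finset.univ.filter fun i => Odd (a i)).card = 2 * p) :
    l (monomialClass (areaGerm m) a) = bCoeff m ω (m - p) := by
  have hsum := sum_eq_two_mul_sum_half_add_card_odd a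
  rw [monomialClass_eq, prod_pow_eq_pow_mul_prod (coordClass_sq m),
    show ∑ i, a i / 2 = m - p by omega, ← squarefreeClass_eq]
  exact h.map_pow_mul_squarefreeClass hm (by omega) _ (by omega)

/-! ### Eigenvalues of an endomorphism that is triangular with respect to a flag -/

section Flag

variable {V : Type*} [AddCommGroup V] [Module ℝ V] {f : Module.End ℝ V} {μ : ℕ → ℝ} {M : ℕ}
  {G : ℕ → Submodule ℝ V}

lemma exists_mem_flag_succ_notMem (h0 : G 0 = ⊥) {N : ℕ} {v : V} (hv : v ≠ 0) (hN : v ∈ G N) :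
    ∃ k < N, v ∈ G (k + 1) ∧ v ∉ G k := by
  classical
  have hex : ∃ n, v ∈ G n := ⟨N, hN⟩
  have h1 : Nat.find hex ≠ 0 := by
    intro h
    have := Nat.find_spec hex
    rw [h, h0, Submodule.mem_bot] at this
    exact hv this
  obtain ⟨k, hk⟩ := Nat.exists_eq_succ_of_ne_zero h1
  have h2 := Nat.find_spec hex
  have h3 := Nat.find_min' hex hN
  rw [hk] at h2 h3
  exact ⟨k, h3, h2, Nat.find_min hex (by omega)⟩

lemma eq_of_apply_eq_smul_of_flag (hf : ∀ k ≤ M, ∀ v ∈ G (k + 1), f v - μ k • v ∈ G k)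
    {k : ℕ} (hk : k ≤ M) {v : V} {x : ℝ} (hv : f v = x • v) (h1 : v ∈ G (k + 1)) (h2 : v ∉ G k) :
    x = μ k := by
  by_contra hne
  have h3 := hf k hk v h1
  rw [hv, ← sub_smul] at h3
  exact h2 ((Submodule.smul_mem_iff _ (sub_ne_zero.2 hne)).1 h3)

lemma exists_eq_of_hasEigenvalue_of_flag (h0 : G 0 = ⊥) (htop : G (M + 1) = ⊤)
    (hf : ∀ k ≤ M, ∀ v ∈ G (k + 1), f v - μ k • v ∈ G k) {x : ℝ}
    (hx : Module.End.HasEigenvalue f x) : ∃ k ≤ M, x = μ k := by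
  obtain ⟨v, hv⟩ := hx.exists_hasEigenvector
  obtain ⟨k, hk, h1, h2⟩ := exists_mem_flag_succ_notMem h0 hv.2 (htop ▸ Submodule.mem_top)
  exact ⟨k, by omega, eq_of_apply_eq_smul_of_flag hf (by omega) hv.apply_eq_smul h1 h2⟩

/-- If `f - μ k` maps the `(k+1)`-st step of a flag into the `k`-th, and the `μ k` are distinct,
then the eigenspace of `μ k` is a complement of the `k`-th step in the `(k+1)`-st. -/
lemma finrank_eigenspace_add_finrank_flag [FiniteDimensional ℝ V] (hG : Monotone G)
    (h0 : G 0 = ⊥) (htop : G (M + 1) = ⊤)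
    (hf : ∀ k ≤ M, ∀ v ∈ G (k + 1), f v - μ k • v ∈ G k) (hμ : Set.InjOn μ (Set.Iic M))
    {k : ℕ} (hk : k ≤ M) :
    Module.finrank ℝ (Module.End.eigenspace f (μ k)) + Module.finrank ℝ (G k)
      = Module.finrank ℝ (G (k + 1)) := by
  have hle : Module.End.eigenspace f (μ k) ≤ G (k + 1) := by
    intro v hv
    rw [Module.End.mem_eigenspace_iff] at hv
    by_cases hv0 : v = 0
    · rw [hv0]; exact Submodule.zero_mem _
    obtain ⟨j, hj, h1, h2⟩ := exists_mem_flag_succ_notMem h0 hv0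
      (show v ∈ G (M + 1) from htop ▸ Submodule.mem_top)
    have hjk := hμ (Set.mem_Iic.2 hk) (Set.mem_Iic.2 (show j ≤ M by omega))
      (eq_of_apply_eq_smul_of_flag hf (by omega) hv h1 h2)
    rwa [hjk]
  have hinf : Module.End.eigenspace f (μ k) ⊓ G k = ⊥ := by
    rw [Submodule.eq_bot_iff]
    rintro v ⟨hv, hvG⟩
    by_contra hv0
    have hv' := Module.End.mem_eigenspace_iff.1 hv
    obtain ⟨j, hj, h1, h2⟩ := exists_mem_flag_succ_notMem h0 hv0 hvG
    have hjk := hμ (Set.mem_Iic.2 hk) (Set.mem_Iic.2 (show j ≤ M by omega))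
      (eq_of_apply_eq_smul_of_flag hf (by omega) hv' h1 h2)
    omega
  have hsup : Module.End.eigenspace f (μ k) ⊔ G k = G (k + 1) := by
    refine le_antisymm (sup_le hle (hG (Nat.le_succ k))) fun v hv => ?_
    -- `f - μ k` is injective, hence surjective, on `G k`
    let g : G k →ₗ[ℝ] G k := (f - μ k • LinearMap.id).restrict fun w hw => by
      simpa using hf k hk w (hG (Nat.le_succ k) hw)
    have hg : Function.Injective g := by
      rw [← LinearMap.ker_eq_bot, Submodule.eq_bot_iff]
      rintro ⟨w, hw⟩ hgw
      have hgw' : f w - μ k • w = 0 := by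
        have := congrArg Subtype.val (LinearMap.mem_ker.1 hgw)
        simpa [g] using this
      have : w ∈ Module.End.eigenspace f (μ k) ⊓ G k :=
        ⟨Module.End.mem_eigenspace_iff.2 (sub_eq_zero.1 hgw'), hw⟩
      rw [hinf, Submodule.mem_bot] at this
      exact Subtype.ext this
    obtain ⟨⟨w, hw⟩, hgw⟩ := LinearMap.injective_iff_surjective.1 hg ⟨_, hf k hk v hv⟩
    have hgw' : f w - μ k • w = f v - μ k • v := by
      have := congrArg Subtype.val hgw
      simpa [g] using this
    refine Submodule.mem_sup.2 ⟨v - w, ?_, w, hw, sub_add_cancel v w⟩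
    rw [Module.End.mem_eigenspace_iff, map_sub, smul_sub, sub_eq_sub_iff_sub_eq_sub, hgw']
  rw [← hsup, ← Submodule.finrank_sup_add_finrank_inf_eq, hinf, finrank_bot, add_zero]

end Flag

/-! ### The inclusion vectors -/

/-- The indicator, on the `m`-element subsets of `Fin n`, of the sets that contain `T`. -/
noncomputable def inclVec (n m : ℕ) (T : Finset (Fin n)) :
    {σ : Finset (Fin n) // σ.card = m} → ℝ :=
  fun σ => if T ⊆ σ.1 then 1 else 0

lemma sum_inclVec_insert {n m : ℕ} (T : Finset (Fin n)) :
    ∑ i ∈ Tᶜ, inclVec n m (insert i T) = ((m : ℝ) - T.card) • inclVec n m T := by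
  funext σ
  rw [Finset.sum_apply, Pi.smul_apply, smul_eq_mul]
  simp only [inclVec]
  split_ifs with h
  · have : ∀ i ∈ Tᶜ, (if insert i T ⊆ σ.1 then (1 : ℝ) else 0) = if i ∈ σ.1 then 1 else 0 := by
      intro i _
      simp only [Finset.insert_subset_iff, h, and_true]
    rw [Finset.sum_congr rfl this, Finset.sum_boole, mul_one]
    have h2 : (Tᶜ.filter fun i => i ∈ σ.1) = σ.1 \ T := by
      ext i; simp [and_comm]
    rw [h2, Finset.card_sdiff_of_subset h, Nat.cast_sub (Finset.card_le_card h), σ.2]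
  · rw [mul_zero]
    refine Finset.sum_eq_zero fun i _ => if_neg fun hh => h ((Finset.subset_insert i T).trans hh)

/-- The span of the inclusion vectors of the sets with fewer than `k` elements. -/
noncomputable def inclFlag (n m k : ℕ) : Submodule ℝ ({σ : Finset (Fin n) // σ.card = m} → ℝ) :=
  Submodule.span ℝ (inclVec n m '' {T | T.card < k})

lemma inclVec_mem_inclFlag {n m k : ℕ} {T : Finset (Fin n)} (hT : T.card < k) :
    inclVec n m T ∈ inclFlag n m k := Submodule.subset_span ⟨T, hT, rfl⟩

lemma monotone_inclFlag (n m : ℕ) : Monotone (inclFlag n m) := fun _ _ h =>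
  Submodule.span_mono (Set.image_mono fun _ hT => lt_of_lt_of_le hT h)

lemma inclFlag_zero (n m : ℕ) : inclFlag n m 0 = ⊥ := by simp [inclFlag]

lemma inclFlag_succ_self (n m : ℕ) : inclFlag n m (m + 1) = ⊤ := by
  rw [eq_top_iff]
  intro v _
  have : v = ∑ σ, v σ • inclVec n m σ.1 := by
    funext τ
    rw [Finset.sum_apply, Finset.sum_eq_single τ]
    · simp [inclVec]
    · intro σ _ hστ
      rw [Pi.smul_apply, inclVec, if_neg, smul_zero]
      intro h
      exact hστ (Subtype.ext (Finset.eq_of_subset_of_card_le h (by rw [σ.2, τ.2])))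
    · simp
  rw [this]
  exact Submodule.sum_mem _ fun σ _ => Submodule.smul_mem _ _
    (inclVec_mem_inclFlag (by rw [σ.2]; omega))

lemma inclFlag_succ_eq_span {n m k : ℕ} (hk : k ≤ m) :
    inclFlag n m (k + 1)
      = Submodule.span ℝ (Set.range fun T : {T : Finset (Fin n) // T.card = k} =>
          inclVec n m T.1) := by
  set N := Submodule.span ℝ (Set.range fun T : {T : Finset (Fin n) // T.card = k} =>
          inclVec n m T.1)
  refine le_antisymm (Submodule.span_le.2 ?_) (Submodule.span_le.2 ?_)
  · suffices H : ∀ d, ∀ T : Finset (Fin n), T.card + d = k → inclVec n m T ∈ N by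
      rintro _ ⟨T, hT, rfl⟩
      have hT' : T.card < k + 1 := hT
      exact H (k - T.card) T (by omega)
    intro d
    induction d with
    | zero => intro T hT; exact Submodule.subset_span ⟨⟨T, hT⟩, rfl⟩
    | succ d ih =>
      intro T hT
      have hne : (m : ℝ) - T.card ≠ 0 := by
        have : (T.card : ℝ) < m := by exact_mod_cast (by omega : T.card < m)
        linarith
      rw [← Submodule.smul_mem_iff N hne, ← sum_inclVec_insert]
      refine Submodule.sum_mem _ fun i hi => ih _ ?_
      rw [Finset.card_insert_of_notMem (Finset.mem_compl.1 hi)]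
      omega
  · rintro _ ⟨T, rfl⟩
    exact inclVec_mem_inclFlag (by rw [T.2]; omega)

lemma finrank_inclFlag_succ {n m k : ℕ} (hk : k ≤ m) (hn : k + m ≤ n) :
    Module.finrank ℝ (inclFlag n m (k + 1)) = n.choose k := by
  rw [inclFlag_succ_eq_span hk, finrank_span_eq_card, Fintype.card_finset_len, Fintype.card_fin]
  rw [Fintype.linearIndependent_iff]
  intro g hg T
  set y : Finset (Fin n) → ℝ := fun S => if h : S.card = k then g ⟨S, h⟩ else 0 with hy
  have hgy : ∀ S : {T : Finset (Fin n) // T.card = k}, g S = y S.1 := fun S => by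
    simp [hy, S.2]
  rw [hgy]
  refine Finset.eq_zero_of_sum_powersetCard_eq_zero k m Finset.univ y hk (by simpa using hn) ?_ _
    (by simp [Finset.mem_powersetCard, T.2])
  intro σ hσ
  have h1 := congrFun hg ⟨σ, (Finset.mem_powersetCard.1 hσ).2⟩
  rw [Finset.sum_apply] at h1
  simp only [Pi.smul_apply, inclVec, smul_eq_mul, mul_ite, mul_one, mul_zero, Pi.zero_apply] at h1
  simp only [hgy] at h1
  rw [← h1, ← Finset.sum_subtype (Finset.univ.powersetCard k)
      (fun S => by simp [Finset.mem_powersetCard])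
      (fun S => if S ⊆ σ then y S else 0), ← Finset.sum_filter]
  refine Finset.sum_congr ?_ fun _ _ => rfl
  ext S
  simp [Finset.mem_powersetCard, and_comm]

/-! ### The action of the block on the inclusion vectors -/

/-- The factor `(2r-1)!! / (2r)!!`. -/
noncomputable def centralRatio (r : ℕ) : ℝ := ∏ s ∈ Finset.range r, (2 * s + 1 : ℝ) / (2 * s + 2)

lemma centralRatio_mul_doubleFactorial (r : ℕ) :
    centralRatio r * ((2 * r)‼ : ℝ) * (2 * r + 1) = ((2 * r + 1)‼ : ℝ) := by
  induction r with
  | zero => simp [centralRatio]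
  | succ r ih =>
    have h1 : (2 * (r + 1))‼ = (2 * r + 2) * (2 * r)‼ := Nat.doubleFactorial_add_two _
    have h2 : (2 * (r + 1) + 1)‼ = (2 * r + 3) * (2 * r + 1)‼ := Nat.doubleFactorial_add_two _
    rw [h1, h2, centralRatio, Finset.prod_range_succ]
    push_cast
    rw [← ih, centralRatio]
    field_simp
    ring

/-- The recursion `bCoeff_succ` makes the sums over the `m`-sets that contain `S` collapse to a
single coefficient. -/
lemma sum_bCoeff_mul_inclVec {m : ℕ} (ω : ℝ) (σ : {σ : Finset (Fin (2 * m)) // σ.card = m})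
    (r : ℕ) : ∀ S : Finset (Fin (2 * m)), S.card + r = m →
      ∑ τ : {τ : Finset (Fin (2 * m)) // τ.card = m},
          bCoeff m ω (σ.1 ∩ τ.1).card * inclVec (2 * m) m S τ
        = centralRatio r * bCoeff m ω (r + (σ.1 ∩ S).card) := by
  induction r with
  | zero =>
    intro S hS
    rw [Finset.sum_eq_single ⟨S, by omega⟩]
    · simp [inclVec, centralRatio]
    · intro τ _ hτ
      rw [inclVec, if_neg, mul_zero]
      intro h
      exact hτ (Subtype.ext (Finset.eq_of_subset_of_card_le h (by rw [τ.2]; omega)).symm)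
    · simp
  | succ r ih =>
    intro S hS
    set e := (σ.1 ∩ S).card with he
    have heS : e ≤ S.card := Finset.card_le_card Finset.inter_subset_right
    have hsum : ((m : ℝ) - S.card) * ∑ τ : {τ : Finset (Fin (2 * m)) // τ.card = m},
          bCoeff m ω (σ.1 ∩ τ.1).card * inclVec (2 * m) m S τ
        = ∑ i ∈ Sᶜ, centralRatio r * bCoeff m ω (r + (σ.1 ∩ insert i S).card) := by
      have h1 : ∀ i ∈ Sᶜ, centralRatio r * bCoeff m ω (r + (σ.1 ∩ insert i S).card)
          = ∑ τ : {τ : Finset (Fin (2 * m)) // τ.card = m},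
            bCoeff m ω (σ.1 ∩ τ.1).card * inclVec (2 * m) m (insert i S) τ := fun i hi =>
        (ih (insert i S) (by
          rw [Finset.card_insert_of_notMem (Finset.mem_compl.1 hi)]; omega)).symm
      rw [Finset.sum_congr rfl h1, Finset.sum_comm, Finset.mul_sum]
      refine Finset.sum_congr rfl fun τ _ => ?_
      have h2 := congrFun (sum_inclVec_insert (m := m) S) τ
      rw [Finset.sum_apply, Pi.smul_apply, smul_eq_mul] at h2
      rw [← Finset.mul_sum, h2]
      ring
    have hval : ∀ i ∈ Sᶜ, centralRatio r * bCoeff m ω (r + (σ.1 ∩ insert i S).card)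
        = centralRatio r * bCoeff m ω (r + e)
          + (if i ∈ σ.1 then 1 else 0) *
            (centralRatio r * (bCoeff m ω (r + e + 1) - bCoeff m ω (r + e))) := by
      intro i hi
      rw [Finset.mem_compl] at hi
      split_ifs with hiσ
      · rw [Finset.inter_insert_of_mem hiσ, Finset.card_insert_of_notMem (by simp [hi]), ← he,
          ← add_assoc]
        ring
      · rw [Finset.inter_insert_of_notMem hiσ, ← he]
        ring
    have hcard : (Sᶜ.filter fun i => i ∈ σ.1).card = m - e := by
      have : (Sᶜ.filter fun i => i ∈ σ.1) = σ.1 \ S := by ext i; simp [and_comm]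
      rw [this, Finset.card_sdiff, σ.2, he, Finset.inter_comm]
    rw [Finset.sum_congr rfl hval, Finset.sum_add_distrib, Finset.sum_const, Finset.card_compl,
      Fintype.card_fin, ← Finset.sum_mul, Finset.sum_boole, hcard, nsmul_eq_mul,
      Nat.cast_sub (by omega), Nat.cast_sub (by omega)] at hsum
    have hb := bCoeff_succ (m := m) (p := r + e) (by omega) ω
    have hSm : (m : ℝ) = S.card + (r + 1) := by exact_mod_cast hS.symm
    rw [centralRatio, Finset.prod_range_succ, ← centralRatio,
      show r + 1 + e = r + e + 1 by ring]
    have hr : (2 * (r : ℝ) + 2) ≠ 0 := by positivity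
    field_simp
    push_cast at hsum hb
    rw [hSm] at hsum hb
    linear_combination 2 * hsum + centralRatio r * hb

lemma fwdDiff_iter_bCoeff (m : ℕ) (ω : ℝ) (j : ℕ) : ∀ p : ℕ, p + j ≤ m →
    (fwdDiff 1)^[j] (bCoeff m ω) p
      = (-1) ^ (p + j) * ω * (2 * m + 1) * ((2 * p)‼ : ℝ) * ((2 * (m - p - j) - 1)‼ : ℝ)
        / ((2 * (m - j) + 1)‼ : ℝ) := by
  induction j with
  | zero =>
    intro p hp
    have h1 : (2 * (m - 0) + 1)‼ = (2 * m + 1) * (2 * m - 1)‼ := by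
      rcases m with _ | m
      · rfl
      · exact Nat.doubleFactorial_add_two _
    have h2 : ((2 * m - 1)‼ : ℝ) ≠ 0 := by exact_mod_cast (Nat.doubleFactorial_pos _).ne'
    rw [Function.iterate_zero, id, bCoeff, h1,
      show 2 * (m - p - 0) - 1 = 2 * m - 2 * p - 1 by omega]
    push_cast
    field_simp
    ring
  | succ j ih =>
    intro p hp
    rw [Function.iterate_succ_apply', fwdDiff, ih p (by omega), ih (p + 1) (by omega)]
    obtain ⟨t, ht⟩ : ∃ t, m = p + j + 1 + t := ⟨m - p - j - 1, by omega⟩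
    have h1 : (2 * (p + 1))‼ = (2 * p + 2) * (2 * p)‼ := Nat.doubleFactorial_add_two _
    have h2 : (2 * (m - p - j) - 1)‼ = (2 * t + 1) * (2 * t - 1)‼ := by
      rw [show 2 * (m - p - j) - 1 = 2 * t + 1 by omega]
      rcases t with _ | t
      · rfl
      · exact Nat.doubleFactorial_add_two _
    have h3 : (2 * (m - j) + 1)‼ = (2 * (p + t + 1) + 1) * (2 * (p + t) + 1)‼ := by
      rw [show 2 * (m - j) + 1 = 2 * (p + t) + 1 + 2 by omega]
      exact Nat.doubleFactorial_add_two _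
    rw [h1, h2, h3, show m - (p + 1) - j = t by omega, show m - p - (j + 1) = t by omega,
      show m - (j + 1) = p + t by omega]
    have h4 : ((2 * (p + t) + 1)‼ : ℝ) ≠ 0 := by exact_mod_cast (Nat.doubleFactorial_pos _).ne'
    push_cast
    field_simp
    ring

lemma centralRatio_mul_fwdDiff_iter_bCoeff {m k : ℕ} (hk : k ≤ m) (ω : ℝ) :
    centralRatio (m - k) * (fwdDiff 1)^[k] (bCoeff m ω) (m - k) = lambdaEig m ω k := by
  obtain ⟨r, rfl⟩ : ∃ r, m = k + r := ⟨m - k, by omega⟩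
  rw [fwdDiff_iter_bCoeff _ _ _ _ (by omega), show k + r - k = r by omega,
    show 2 * (k + r - r - k) - 1 = 0 by omega, ← centralRatio_mul_doubleFactorial, lambdaEig]
  have h1 : ((2 * r)‼ : ℝ) ≠ 0 := by exact_mod_cast (Nat.doubleFactorial_pos _).ne'
  have h2 : centralRatio r ≠ 0 := by
    refine Finset.prod_ne_zero_iff.2 fun s _ => ?_
    positivity
  have h3 : (2 * (r : ℝ) + 1) ≠ 0 := by positivity
  have h4 : (2 * ((k + r : ℕ) : ℝ) - 2 * k + 1) = 2 * r + 1 := by push_cast; ring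
  rw [h4, Nat.doubleFactorial, add_comm r k]
  push_cast
  field_simp

/-- Expanding `bCoeff (r + |σ ∩ S|)` by Newton's formula in the binomial coefficients of `|σ ∩ S|`,
which count the `j`-subsets of `S` contained in `σ`, shows that the matrix is triangular for the
flag of the inclusion vectors. -/
lemma toLin'_inclVec_sub_mem {m : ℕ} (ω : ℝ)
    {B : Matrix {σ : Finset (Fin (2 * m)) // σ.card = m}
      {σ : Finset (Fin (2 * m)) // σ.card = m} ℝ}
    (hB : ∀ σ τ, B σ τ = bCoeff m ω (σ.1 ∩ τ.1).card) {S : Finset (Fin (2 * m))}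
    (hS : S.card ≤ m) :
    Matrix.toLin' B (inclVec (2 * m) m S) - lambdaEig m ω S.card • inclVec (2 * m) m S
      ∈ inclFlag (2 * m) m S.card := by
  set k := S.card with hk
  have hexp : Matrix.toLin' B (inclVec (2 * m) m S)
      = ∑ j ∈ Finset.range (k + 1),
        (centralRatio (m - k) * (fwdDiff 1)^[j] (bCoeff m ω) (m - k)) •
          ∑ T ∈ S.powersetCard j, inclVec (2 * m) m T := by
    funext σ
    rw [Matrix.toLin'_apply, Matrix.mulVec, dotProduct,
      Finset.sum_congr rfl fun τ _ => by rw [hB σ τ],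
      sum_bCoeff_mul_inclVec ω σ (m - k) S (by omega), Finset.sum_apply]
    have hN := shift_eq_sum_fwdDiff_iter 1 (bCoeff m ω) (σ.1 ∩ S).card (m - k)
    rw [smul_eq_mul, mul_one] at hN
    rw [hN, Finset.mul_sum]
    have hle : (σ.1 ∩ S).card ≤ k := Finset.card_le_card Finset.inter_subset_right
    rw [← Finset.sum_subset (Finset.range_subset_range.2 (Nat.succ_le_succ hle))]
    · refine Finset.sum_congr rfl fun j _ => ?_
      rw [Pi.smul_apply, Finset.sum_apply]
      simp only [inclVec]
      rw [Finset.sum_boole, ← Finset.card_powersetCard]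
      have : (S.powersetCard j).filter (fun T => T ⊆ σ.1) = (σ.1 ∩ S).powersetCard j := by
        ext T
        simp only [Finset.mem_filter, Finset.mem_powersetCard, Finset.subset_inter_iff]
        tauto
      rw [this, nsmul_eq_mul, smul_eq_mul]
      ring
    · intro j _ hj
      rw [Pi.smul_apply, Finset.sum_apply, Finset.sum_eq_zero, smul_zero]
      intro T hT
      rw [inclVec, if_neg]
      intro h
      rw [Finset.mem_powersetCard] at hT
      have := Finset.card_le_card (Finset.subset_inter h hT.1)
      rw [Finset.mem_range] at hj
      omega
  rw [hexp, Finset.sum_range_succ, centralRatio_mul_fwdDiff_iter_bCoeff hS, hk,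
    Finset.powersetCard_self, Finset.sum_singleton, add_sub_cancel_right]
  refine Submodule.sum_mem _ fun j hj => Submodule.smul_mem _ _
    (Submodule.sum_mem _ fun T hT => inclVec_mem_inclFlag ?_)
  rw [(Finset.mem_powersetCard.1 hT).2]
  exact Finset.mem_range.1 hj

lemma toLin'_sub_mem_inclFlag {m : ℕ} (ω : ℝ)
    {B : Matrix {σ : Finset (Fin (2 * m)) // σ.card = m}
      {σ : Finset (Fin (2 * m)) // σ.card = m} ℝ}
    (hB : ∀ σ τ, B σ τ = bCoeff m ω (σ.1 ∩ τ.1).card) {k : ℕ} (hk : k ≤ m)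
    {v : {σ : Finset (Fin (2 * m)) // σ.card = m} → ℝ} (hv : v ∈ inclFlag (2 * m) m (k + 1)) :
    Matrix.toLin' B v - lambdaEig m ω k • v ∈ inclFlag (2 * m) m k := by
  have hle : inclFlag (2 * m) m (k + 1) ≤
      (inclFlag (2 * m) m k).comap (Matrix.toLin' B - lambdaEig m ω k • LinearMap.id) := by
    rw [inclFlag, Submodule.span_le]
    rintro _ ⟨S, hS, rfl⟩
    have hS' : S.card < k + 1 := hS
    have h := toLin'_inclVec_sub_mem ω hB (S := S) (by omega)
    rw [SetLike.mem_coe, Submodule.mem_comap, LinearMap.sub_apply, LinearMap.smul_apply,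
      LinearMap.id_apply]
    rcases Nat.lt_succ_iff_lt_or_eq.1 hS' with hlt | heq
    · have h1 := inclVec_mem_inclFlag (m := m) hlt
      have h2 := Submodule.add_mem _ (monotone_inclFlag _ _ hlt.le h)
        (Submodule.smul_mem _ (lambdaEig m ω S.card) h1)
      rw [sub_add_cancel] at h2
      exact Submodule.sub_mem _ h2 (Submodule.smul_mem _ _ h1)
    · rwa [heq] at h
  simpa using hle hv

lemma lambdaEig_injOn {m : ℕ} {ω : ℝ} (hω : ω ≠ 0) : Set.InjOn (lambdaEig m ω) (Set.Iic m) := by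
  intro j hj k hk h
  rw [Set.mem_Iic] at hj hk
  have hj' : (j : ℝ) ≤ m := by exact_mod_cast hj
  have hk' : (k : ℝ) ≤ m := by exact_mod_cast hk
  have h1 : (2 * m - 2 * j + 1 : ℝ) ≠ 0 := by linarith
  have h2 : (2 * m - 2 * k + 1 : ℝ) ≠ 0 := by linarith
  have h3 : (2 * m + 1 : ℝ) ≠ 0 := by positivity
  rw [lambdaEig, lambdaEig] at h
  have h4 := mul_left_cancel₀ (pow_ne_zero m (by norm_num : (-1 : ℝ) ≠ 0)) (mul_right_cancel₀ hω h)
  rw [div_eq_div_iff h1 h2] at h4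
  have h5 := mul_left_cancel₀ h3 h4
  have : (j : ℝ) = k := by linarith
  exact_mod_cast this

lemma choose_sub_choose_eq {n k : ℕ} (hk : k < n) :
    (n.choose (k + 1) : ℝ) - n.choose k
      = (n ! : ℝ) * (n - 2 * (k + 1) + 1) / (((k + 1)! : ℝ) * ((n - (k + 1) + 1)! : ℝ)) := by
  obtain ⟨r, rfl⟩ : ∃ r, n = k + 1 + r := ⟨n - k - 1, by omega⟩
  have h1 := Nat.choose_mul_factorial_mul_factorial (show k + 1 ≤ k + 1 + r by omega)
  have h2 := Nat.choose_mul_factorial_mul_factorial (show k ≤ k + 1 + r by omega)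
  rw [show k + 1 + r - (k + 1) = r by omega] at h1
  rw [show k + 1 + r - k = r + 1 by omega] at h2
  have h1' : ((k + 1 + r).choose (k + 1) : ℝ) * ((k + 1)! : ℝ) * (r ! : ℝ)
      = ((k + 1 + r)! : ℝ) := by
    exact_mod_cast h1
  have h2' : ((k + 1 + r).choose k : ℝ) * (k ! : ℝ) * ((r + 1)! : ℝ) = ((k + 1 + r)! : ℝ) := by
    exact_mod_cast h2
  rw [show k + 1 + r - (k + 1) + 1 = r + 1 by omega, eq_div_iff (by positivity)]
  have h3 : ((k + 1)! : ℝ) = (k + 1) * (k ! : ℝ) := by rw [Nat.factorial_succ]; push_cast; ring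
  have h4 : ((r + 1)! : ℝ) = (r + 1) * (r ! : ℝ) := by rw [Nat.factorial_succ]; push_cast; ring
  rw [h4] at h2' ⊢
  rw [h3] at h1' ⊢
  push_cast
  linear_combination (r + 1 : ℝ) * h1' - (k + 1 : ℝ) * h2'

lemma finrank_eigenspace_lambdaEig {m : ℕ} {ω : ℝ} (hω : ω ≠ 0)
    {B : Matrix {σ : Finset (Fin (2 * m)) // σ.card = m}
      {σ : Finset (Fin (2 * m)) // σ.card = m} ℝ}
    (hB : ∀ σ τ, B σ τ = bCoeff m ω (σ.1 ∩ τ.1).card) {k : ℕ} (hk : k ≤ m) :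
    (Module.finrank ℝ (Module.End.eigenspace (Matrix.toLin' B) (lambdaEig m ω k)) : ℝ)
      = ((2 * m)! : ℝ) * (2 * m - 2 * k + 1 : ℝ) / ((k ! : ℝ) * ((2 * m - k + 1)! : ℝ)) := by
  have h := finrank_eigenspace_add_finrank_flag (monotone_inclFlag (2 * m) m)
    (inclFlag_zero (2 * m) m) (inclFlag_succ_self (2 * m) m)
    (fun k hk v hv => toLin'_sub_mem_inclFlag ω hB hk hv) (lambdaEig_injOn hω) hk
  rw [finrank_inclFlag_succ hk (by omega)] at h
  rcases k with _ | k
  · rw [inclFlag_zero, finrank_bot, add_zero, Nat.choose_zero_right] at h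
    rw [h, Nat.sub_zero, Nat.factorial_succ, Nat.factorial_zero]
    have h1 : ((2 * m)! : ℝ) ≠ 0 := by positivity
    push_cast
    field_simp
    ring
  · rw [finrank_inclFlag_succ (by omega) (by omega)] at h
    have h1 := choose_sub_choose_eq (n := 2 * m) (k := k) (by omega)
    push_cast at h1 ⊢
    rw [← h1, ← h]
    push_cast
    ring

lemma hasEigenvalue_toLin'_iff {m : ℕ} {ω : ℝ}
    {B : Matrix {σ : Finset (Fin (2 * m)) // σ.card = m}
      {σ : Finset (Fin (2 * m)) // σ.card = m} ℝ}
    (hB : ∀ σ τ, B σ τ = bCoeff m ω (σ.1 ∩ τ.1).card) (μ : ℝ) :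
    Module.End.HasEigenvalue (Matrix.toLin' B) μ ↔ ∃ k : ℕ, k ≤ m ∧ μ = lambdaEig m ω k := by
  constructor
  · exact fun h => exists_eq_of_hasEigenvalue_of_flag (inclFlag_zero (2 * m) m)
      (inclFlag_succ_self (2 * m) m) (fun k hk v hv => toLin'_sub_mem_inclFlag ω hB hk hv) h
  · rintro ⟨k, hk, rfl⟩
    have hne : (0 : ℝ) < 2 * m - 2 * k + 1 := by
      have : (k : ℝ) ≤ m := by exact_mod_cast hk
      linarith
    rcases eq_or_ne ω 0 with rfl | hω
    · have hB0 : B = 0 := by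
        ext σ τ
        rw [hB, bCoeff]
        simp
      obtain ⟨σ, hσ⟩ : ∃ σ : Finset (Fin (2 * m)), σ.card = m := by
        obtain ⟨σ, -, hσ⟩ := Finset.exists_subset_card_eq
          (show m ≤ (Finset.univ : Finset (Fin (2 * m))).card by simp; omega)
        exact ⟨σ, hσ⟩
      have : Nonempty {σ : Finset (Fin (2 * m)) // σ.card = m} := ⟨⟨σ, hσ⟩⟩
      refine Module.End.hasEigenvalue_of_hasEigenvector (x := fun _ => 1)
        (Module.End.hasEigenvector_iff.2 ⟨Module.End.mem_eigenspace_iff.2 ?_, ?_⟩)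
      · simp [hB0, lambdaEig]
      · exact fun h => one_ne_zero (congrFun h ⟨σ, hσ⟩)
    · intro h
      have h1 := finrank_eigenspace_lambdaEig hω hB hk
      have h2 :
          Module.finrank ℝ (Module.End.eigenspace (Matrix.toLin' B) (lambdaEig m ω k)) = 0 := by
        rw [Submodule.finrank_eq_zero]
        exact h
      rw [h2, Nat.cast_zero] at h1
      have : (0 : ℝ) < ((2 * m)! : ℝ) * (2 * m - 2 * k + 1 : ℝ)
          / ((k ! : ℝ) * ((2 * m - k + 1)! : ℝ)) := by
        positivity
      linarith

/-! ### The signature of a form with two isotropic subspaces -/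

/-- Let a symmetric form be positive definite on `C` and zero on `L` and on `H`, where `C` is
orthogonal to `L` and `H`, and let the three subspaces span the whole space. Then its signature is
the dimension of `C`: the semidefinite subspaces `L + rad`, `H + rad`, `L + rad + C` and
`H + rad + C` bound the positive and the negative index from above, and the bounds add up to the
rank. -/
lemma formSignature_eq_finrank {V : Type*} [AddCommGroup V] [Module ℝ V] [FiniteDimensional ℝ V]
    {β : LinearMap.BilinForm ℝ V} (hβ : ∀ x y, β x y = β y x) {L C H : Submodule ℝ V}
    (htop : L ⊔ H ⊔ C = ⊤) (hL : ∀ x ∈ L, ∀ y ∈ L, β x y = 0) (hH : ∀ x ∈ H, ∀ y ∈ H, β x y = 0)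
    (hCL : ∀ x ∈ C, ∀ y ∈ L, β x y = 0) (hCH : ∀ x ∈ C, ∀ y ∈ H, β x y = 0)
    (hC : ∀ x ∈ C, x ≠ 0 → 0 < β x x) :
    formSignature β = Module.finrank ℝ C := by
  set Q := β.toQuadraticMap with hQ
  set N := Q.radical with hN
  have hQa : ∀ x, Q x = β x x := fun x => rfl
  have hrad : ∀ x ∈ N, ∀ y, β x y = 0 := by
    intro x hx y
    rw [hN, QuadraticMap.mem_radical_iff'] at hx
    have h1 := hx.2 y
    have h2 := hx.1
    rw [hQa, hQa] at h1
    simp only [map_add, LinearMap.add_apply] at h1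
    rw [hβ y x] at h1
    rw [hQa] at h2
    linarith
  have hCnonneg : ∀ x ∈ C, 0 ≤ β x x := by
    intro x hx
    rcases eq_or_ne x 0 with rfl | h
    · simp
    · exact (hC x hx h).le
  have hpos : ∀ W : Submodule ℝ V, (∀ x ∈ W, ∀ y ∈ W, β x y = 0) →
      sigPos Q + Module.finrank ℝ (W ⊔ N : Submodule ℝ V) ≤ Module.finrank ℝ V := by
    intro W hW
    refine QuadraticForm.sigPos_add_finrank_le_of_nonpos fun x hx => ?_
    obtain ⟨w, hw, n, hn, rfl⟩ := Submodule.mem_sup.1 hx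
    rw [hQa]
    simp only [map_add, LinearMap.add_apply]
    rw [hrad n hn, hrad n hn, hW w hw w hw, hβ w n, hrad n hn]
    simp
  have hneg : ∀ W : Submodule ℝ V, (∀ x ∈ W, ∀ y ∈ W, β x y = 0) →
      (∀ x ∈ C, ∀ y ∈ W, β x y = 0) →
      sigNeg Q + (Module.finrank ℝ (W ⊔ N : Submodule ℝ V) + Module.finrank ℝ C)
        ≤ Module.finrank ℝ V := by
    intro W hW hCW
    have hdisj : (W ⊔ N) ⊓ C = ⊥ := by
      rw [Submodule.eq_bot_iff]
      rintro x ⟨hx, hxC⟩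
      by_contra h0
      have h1 := hC x hxC h0
      obtain ⟨w, hw, n, hn, hwn⟩ := Submodule.mem_sup.1 hx
      nth_rw 2 [← hwn] at h1
      rw [map_add, hCW x hxC w hw, hβ x n, hrad n hn] at h1
      simp at h1
    rw [← Submodule.finrank_sup_add_finrank_inf_eq, hdisj, finrank_bot, add_zero]
    refine QuadraticForm.sigPos_add_finrank_le_of_nonpos (Q := -Q) fun x hx => ?_
    obtain ⟨y, hy, c, hc, rfl⟩ := Submodule.mem_sup.1 hx
    obtain ⟨w, hw, n, hn, rfl⟩ := Submodule.mem_sup.1 hy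
    rw [neg_apply, hQa]
    simp only [map_add, LinearMap.add_apply]
    rw [hrad n hn, hrad n hn, hrad n hn, hβ w n, hβ c n, hrad n hn, hrad n hn, hW w hw w hw,
      hβ w c, hCW c hc w hw]
    have := hCnonneg c hc
    linarith
  have h1 := hpos L hL
  have h2 := hpos H hH
  have h3 := hneg L hL hCL
  have h4 := hneg H hH hCH
  have h5 := Submodule.finrank_sup_add_finrank_inf_eq (L ⊔ N) (H ⊔ N)
  have h6 : Module.finrank ℝ N ≤ Module.finrank ℝ ((L ⊔ N) ⊓ (H ⊔ N) : Submodule ℝ V) :=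
    Submodule.finrank_mono (le_inf le_sup_right le_sup_right)
  have h7 : Module.finrank ℝ V
      ≤ Module.finrank ℝ ((L ⊔ N) ⊔ (H ⊔ N) : Submodule ℝ V) + Module.finrank ℝ C := by
    refine le_trans ?_ (Submodule.finrank_add_le_finrank_add_finrank _ C)
    have : (L ⊔ N) ⊔ (H ⊔ N) ⊔ C = ⊤ := by
      rw [eq_top_iff, ← htop]
      exact sup_le_sup_right (sup_le_sup le_sup_left le_sup_left) C
    rw [this, finrank_top]
  have h8 := QuadraticForm.sigPos_add_sigNeg_add_radical (Q := Q)
  rw [← hN] at h8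
  rw [formSignature, ← hQ]
  omega

lemma formSignature_neg {V : Type*} [AddCommGroup V] [Module ℝ V]
    (β : LinearMap.BilinForm ℝ V) : formSignature (-β) = -formSignature β := by
  rw [formSignature, formSignature, LinearMap.BilinMap.toQuadraticMap_neg, sigPos_neg, sigNeg_neg]
  ring

/-! ### The form on the Milnor algebra -/

lemma Finset.card_symmDiff_add_two_mul_card_inter {α : Type*} [DecidableEq α] (σ τ : Finset α) :
    (symmDiff σ τ).card + 2 * (σ ∩ τ).card = σ.card + τ.card := by
  have h1 := Finset.card_sdiff_add_card_inter σ τ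
  have h2 := Finset.card_sdiff_add_card_inter τ σ
  rw [Finset.inter_comm] at h2
  have h3 : (symmDiff σ τ).card = (σ \ τ).card + (τ \ σ).card :=
    Finset.card_union_of_disjoint disjoint_sdiff_sdiff
  omega

lemma squarefreeClass_mul_squarefreeClass (m : ℕ) (σ τ : Finset (Fin (2 * m))) :
    squarefreeClass (areaGerm m) σ * squarefreeClass (areaGerm m) τ
      = ((∑ i, coordClass m i) ^ 2) ^ (σ ∩ τ).card
        * squarefreeClass (areaGerm m) (symmDiff σ τ) := by
  simp only [squarefreeClass_eq]
  rw [← Finset.prod_sdiff (Finset.inter_subset_left : σ ∩ τ ⊆ σ),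
    ← Finset.prod_sdiff (Finset.inter_subset_right : σ ∩ τ ⊆ τ), Finset.sdiff_inter_self_left,
    Finset.sdiff_inter_self_right, ← Finset.prod_const,
    ← Finset.prod_congr rfl fun i _ => coordClass_sq m i, Finset.prod_pow]
  have h : symmDiff σ τ = (σ \ τ) ∪ (τ \ σ) := rfl
  rw [h, Finset.prod_union disjoint_sdiff_sdiff]
  ring

section Form

variable {m : ℕ} {l : MilnorAlgebra (areaGerm m) →ₗ[ℝ] ℝ} {ω : ℝ}

lemma milnorForm_apply (g h : MilnorAlgebra (areaGerm m)) : milnorForm l g h = l (g * h) := rfl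

lemma IsNormalized.milnorForm_squarefreeClass (hm : 1 ≤ m) (h : IsNormalized l ω)
    {σ τ : Finset (Fin (2 * m))} (hστ : σ.card + τ.card = 2 * m) :
    milnorForm l (squarefreeClass (areaGerm m) σ) (squarefreeClass (areaGerm m) τ)
      = bCoeff m ω (σ ∩ τ).card := by
  have h1 := Finset.card_symmDiff_add_two_mul_card_inter σ τ
  rw [milnorForm_apply, squarefreeClass_mul_squarefreeClass]
  exact h.map_pow_mul_squarefreeClass hm (by omega) _ (by omega)

lemma IsNormalized.milnorForm_squarefreeClass_eq_zero (h : IsNormalized l ω)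
    {σ τ : Finset (Fin (2 * m))} (hστ : σ.card + τ.card ≠ 2 * m) :
    milnorForm l (squarefreeClass (areaGerm m) σ) (squarefreeClass (areaGerm m) τ) = 0 := by
  have h1 := Finset.card_symmDiff_add_two_mul_card_inter σ τ
  rw [milnorForm_apply, squarefreeClass_mul_squarefreeClass]
  refine map_pow_mul_squarefreeClass_eq_zero l _ _ fun R hR => h.2 R ?_
  rintro rfl
  rw [Finset.card_univ, Fintype.card_fin] at hR
  omega

lemma IsNormalized.blockB_apply (hm : 1 ≤ m) (h : IsNormalized l ω)
    (σ τ : {σ : Finset (Fin (2 * m)) // σ.card = m}) :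
    blockB m l σ τ = bCoeff m ω (σ.1 ∩ τ.1).card :=
  h.milnorForm_squarefreeClass hm (by rw [σ.2, τ.2]; ring)

lemma neg_one_pow_mul_lambdaEig_pos (hω : 0 < ω) {k : ℕ} (hk : k ≤ m) :
    0 < (-1) ^ m * lambdaEig m ω k := by
  have hk' : (k : ℝ) ≤ m := by exact_mod_cast hk
  have h1 : (0 : ℝ) < 2 * m - 2 * k + 1 := by linarith
  rw [lambdaEig, ← mul_assoc, ← mul_assoc, ← mul_pow, neg_one_mul, neg_neg, one_pow, one_mul]
  positivity

lemma IsNormalized.hasEigenvalue_pos (hm : 1 ≤ m) (h : IsNormalized l ω) (hω : 0 < ω) {μ : ℝ}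
    (hμ : Module.End.HasEigenvalue (Matrix.toLin' (blockB m l)) μ) : 0 < (-1) ^ m * μ := by
  obtain ⟨k, hk, rfl⟩ := (hasEigenvalue_toLin'_iff (h.blockB_apply hm) μ).1 hμ
  exact neg_one_pow_mul_lambdaEig_pos hω hk

lemma IsNormalized.posDef_blockB (hm : 1 ≤ m) (h : IsNormalized l ω) (hω : 0 < ω) :
    ((-1 : ℝ) ^ m • blockB m l).PosDef := by
  have hsymm : ((-1 : ℝ) ^ m • blockB m l).IsHermitian := by
    ext σ τ
    rw [Matrix.conjTranspose_apply, Matrix.smul_apply, Matrix.smul_apply, h.blockB_apply hm,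
      h.blockB_apply hm, Finset.inter_comm, star_trivial]
  rw [hsymm.posDef_iff_eigenvalues_pos]
  intro i
  have h1 : Module.End.HasEigenvalue (Matrix.toLin' ((-1 : ℝ) ^ m • blockB m l))
      (hsymm.eigenvalues i) := by
    rw [Module.End.hasEigenvalue_iff_mem_spectrum, Matrix.spectrum_toLin']
    exact hsymm.eigenvalues_mem_spectrum_real i
  obtain ⟨v, hv⟩ := h1.exists_hasEigenvector
  have hone : (-1 : ℝ) ^ m * (-1) ^ m = 1 := by rw [← mul_pow]; simp
  have h2 : Module.End.HasEigenvalue (Matrix.toLin' (blockB m l))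
      ((-1) ^ m * hsymm.eigenvalues i) := by
    refine Module.End.hasEigenvalue_of_hasEigenvector (x := v)
      (Module.End.hasEigenvector_iff.2 ⟨Module.End.mem_eigenspace_iff.2 ?_, hv.2⟩)
    have h3 := hv.apply_eq_smul
    rw [map_smul, LinearMap.smul_apply] at h3
    rw [mul_smul, ← h3, smul_smul, hone, one_smul]
  have h4 := h.hasEigenvalue_pos hm hω h2
  rwa [← mul_assoc, hone, one_mul] at h4

/-- The span of the squarefree monomials whose degree satisfies `P`. -/
noncomputable def squarefreeSpan (m : ℕ) (P : ℕ → Prop) :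
    Submodule ℝ (MilnorAlgebra (areaGerm m)) :=
  Submodule.span ℝ (squarefreeClass (areaGerm m) '' {S | P S.card})

lemma IsNormalized.milnorForm_eq_zero_of_mem (h : IsNormalized l ω) {P P' : ℕ → Prop}
    (hP : ∀ i j, P i → P' j → i + j ≠ 2 * m) {x y : MilnorAlgebra (areaGerm m)}
    (hx : x ∈ squarefreeSpan m P) (hy : y ∈ squarefreeSpan m P') : milnorForm l x y = 0 := by
  induction hx using Submodule.span_induction with
  | mem x hx =>
    obtain ⟨S, hS, rfl⟩ := hx
    induction hy using Submodule.span_induction with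
    | mem y hy =>
      obtain ⟨T, hT, rfl⟩ := hy
      exact h.milnorForm_squarefreeClass_eq_zero (hP _ _ hS hT)
    | zero => rw [map_zero]
    | add y z _ _ hy hz => rw [map_add, hy, hz, add_zero]
    | smul c y _ hy => rw [map_smul, hy, smul_zero]
  | zero => rw [map_zero, LinearMap.zero_apply]
  | add y z _ _ hy hz => rw [map_add, LinearMap.add_apply, hy, hz, add_zero]
  | smul c y _ hy => rw [map_smul, LinearMap.smul_apply, hy, smul_zero]

lemma milnorForm_sum_smul (a : {σ : Finset (Fin (2 * m)) // σ.card = m} → ℝ) :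
    milnorForm l (∑ σ, a σ • squarefreeClass (areaGerm m) σ.1)
      (∑ σ, a σ • squarefreeClass (areaGerm m) σ.1) = a ⬝ᵥ (blockB m l).mulVec a := by
  rw [LinearMap.map_sum₂, dotProduct]
  refine Finset.sum_congr rfl fun σ _ => ?_
  rw [map_smul, LinearMap.smul_apply, map_sum, Matrix.mulVec, dotProduct, smul_eq_mul]
  congr 1
  refine Finset.sum_congr rfl fun τ _ => ?_
  rw [map_smul, smul_eq_mul, mul_comm]
  rfl

lemma IsNormalized.milnorForm_sum_smul_pos (hm : 1 ≤ m) (h : IsNormalized l ω) (hω : 0 < ω)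
    {a : {σ : Finset (Fin (2 * m)) // σ.card = m} → ℝ} (ha : a ≠ 0) :
    0 < (-1) ^ m * milnorForm l (∑ σ, a σ • squarefreeClass (areaGerm m) σ.1)
      (∑ σ, a σ • squarefreeClass (areaGerm m) σ.1) := by
  have h1 := (h.posDef_blockB hm hω).dotProduct_mulVec_pos ha
  rw [star_trivial, Matrix.smul_mulVec, dotProduct_smul, smul_eq_mul] at h1
  rwa [milnorForm_sum_smul]

lemma squarefreeSpan_eq_span_range :
    squarefreeSpan m (· = m) = Submodule.span ℝ
      (Set.range fun σ : {σ : Finset (Fin (2 * m)) // σ.card = m} =>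
        squarefreeClass (areaGerm m) σ.1) := by
  rw [squarefreeSpan, Set.image_eq_range]
  rfl

/-- The definiteness of the middle block makes the squarefree monomials of degree `m` linearly
independent. -/
lemma IsNormalized.finrank_squarefreeSpan (hm : 1 ≤ m) (h : IsNormalized l ω) (hω : 0 < ω) :
    Module.finrank ℝ (squarefreeSpan m (· = m)) = (2 * m).choose m := by
  rw [squarefreeSpan_eq_span_range, finrank_span_eq_card, Fintype.card_finset_len, Fintype.card_fin]
  rw [Fintype.linearIndependent_iff]
  intro a ha
  by_contra hne
  push Not at hne
  obtain ⟨σ, hσ⟩ := hne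
  have h1 := h.milnorForm_sum_smul_pos hm hω (a := a) fun h0 => hσ (congrFun h0 σ)
  rw [ha, map_zero, mul_zero] at h1
  exact lt_irrefl _ h1

lemma squarefreeSpan_sup_eq_top :
    squarefreeSpan m (· < m) ⊔ squarefreeSpan m (m < ·) ⊔ squarefreeSpan m (· = m) = ⊤ := by
  rw [eq_top_iff, ← span_squarefreeClass_eq_top, Submodule.span_le]
  rintro _ ⟨S, rfl⟩
  rcases lt_trichotomy S.card m with h | h | h
  · exact le_sup_left (a := squarefreeSpan m (· < m) ⊔ squarefreeSpan m (m < ·))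
      (le_sup_left (a := squarefreeSpan m (· < m)) (Submodule.subset_span ⟨S, h, rfl⟩))
  · exact le_sup_right (a := squarefreeSpan m (· < m) ⊔ squarefreeSpan m (m < ·))
      (Submodule.subset_span ⟨S, h, rfl⟩)
  · exact le_sup_left (a := squarefreeSpan m (· < m) ⊔ squarefreeSpan m (m < ·))
      (le_sup_right (a := squarefreeSpan m (· < m)) (Submodule.subset_span ⟨S, h, rfl⟩))

lemma two_mul_choose_pred_pred (hm : 1 ≤ m) :
    2 * (2 * m - 1).choose (m - 1) = (2 * m).choose m := by
  obtain ⟨k, rfl⟩ : ∃ k, m = k + 1 := ⟨m - 1, by omega⟩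
  have h1 : (2 * k + 1).choose (k + 1) = (2 * k + 1).choose k :=
    Nat.choose_symm_of_eq_add (by ring)
  rw [show 2 * (k + 1) - 1 = 2 * k + 1 by omega, show 2 * (k + 1) = (2 * k + 1) + 1 by ring,
    Nat.choose_succ_succ, Nat.add_sub_cancel, h1]
  ring

lemma IsNormalized.formSignature_milnorForm (hm : 1 ≤ m) (h : IsNormalized l ω) (hω : 0 < ω) :
    formSignature (milnorForm l) = 2 * (-1) ^ m * ((2 * m - 1).choose (m - 1) : ℤ) := by
  have hsymm : ∀ x y, milnorForm l x y = milnorForm l y x := fun x y => by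
    rw [milnorForm_apply, milnorForm_apply, mul_comm x y]
  have hpos : ∀ x ∈ squarefreeSpan m (· = m), x ≠ 0 → 0 < (-1) ^ m * milnorForm l x x := by
    intro x hx hx0
    rw [squarefreeSpan_eq_span_range] at hx
    obtain ⟨a, rfl⟩ := (Submodule.mem_span_range_iff_exists_fun ℝ).1 hx
    exact h.milnorForm_sum_smul_pos hm hω fun h0 => hx0 (by simp [h0])
  have hch : ((2 * m).choose m : ℤ) = 2 * ((2 * m - 1).choose (m - 1) : ℤ) := by
    exact_mod_cast (two_mul_choose_pred_pred hm).symm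
  have hLL : ∀ x ∈ squarefreeSpan m (· < m), ∀ y ∈ squarefreeSpan m (· < m),
      milnorForm l x y = 0 := fun x hx y hy =>
    h.milnorForm_eq_zero_of_mem (fun i j hi hj => by omega) hx hy
  have hHH : ∀ x ∈ squarefreeSpan m (m < ·), ∀ y ∈ squarefreeSpan m (m < ·),
      milnorForm l x y = 0 := fun x hx y hy =>
    h.milnorForm_eq_zero_of_mem (fun i j hi hj => by omega) hx hy
  have hCL : ∀ x ∈ squarefreeSpan m (· = m), ∀ y ∈ squarefreeSpan m (· < m),
      milnorForm l x y = 0 := fun x hx y hy =>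
    h.milnorForm_eq_zero_of_mem (fun i j hi hj => by omega) hx hy
  have hCH : ∀ x ∈ squarefreeSpan m (· = m), ∀ y ∈ squarefreeSpan m (m < ·),
      milnorForm l x y = 0 := fun x hx y hy =>
    h.milnorForm_eq_zero_of_mem (fun i j hi hj => by omega) hx hy
  rcases Nat.even_or_odd m with he | ho
  · have h1 := formSignature_eq_finrank hsymm squarefreeSpan_sup_eq_top hLL hHH hCL hCH
      (fun x hx hx0 => by simpa [he.neg_one_pow] using hpos x hx hx0)
    rw [h1, h.finrank_squarefreeSpan hm hω, he.neg_one_pow, hch]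
    ring
  · have h1 := formSignature_eq_finrank (β := -milnorForm l) (fun x y => by simp [hsymm x y])
      squarefreeSpan_sup_eq_top (fun x hx y hy => by simp [hLL x hx y hy])
      (fun x hx y hy => by simp [hHH x hx y hy]) (fun x hx y hy => by simp [hCL x hx y hy])
      (fun x hx y hy => by simp [hCH x hx y hy])
      (fun x hx hx0 => by simpa [ho.neg_one_pow] using hpos x hx hx0)
    rw [formSignature_neg, h.finrank_squarefreeSpan hm hω, hch] at h1
    rw [ho.neg_one_pow]
    linarith

end Form

/-! ### The determinant of a rank-one perturbation of a diagonal matrix -/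

lemma Matrix.det_diagonal_add_const_of_ne_zero {K ι : Type*} [Field K] [Fintype ι] [DecidableEq ι]
    {d : ι → K} (hd : ∀ i, d i ≠ 0) (c : K) :
    (Matrix.diagonal d + Matrix.of fun _ _ => c).det
      = ∏ i, d i + c * ∑ i, ∏ j ∈ Finset.univ.erase i, d j := by
  have hdet : (Matrix.diagonal d).det = ∏ i, d i := Matrix.det_diagonal
  have hunit : IsUnit (Matrix.diagonal d).det := by
    rw [hdet, isUnit_iff_ne_zero]
    exact Finset.prod_ne_zero_iff.2 fun i _ => hd i
  have e : (Matrix.of fun _ _ => c : Matrix ι ι K)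
      = Matrix.replicateCol Unit (fun _ => c) * Matrix.replicateRow Unit (fun _ => (1 : K)) := by
    ext i j; simp [Matrix.mul_apply]
  have hinv : (Matrix.diagonal d)⁻¹ = Matrix.diagonal fun i => (d i)⁻¹ := by
    refine Matrix.inv_eq_right_inv ?_
    rw [Matrix.diagonal_mul_diagonal]
    simp [hd]
  rw [e, Matrix.det_add_replicateCol_mul_replicateRow hunit, hdet, hinv]
  have h1 : ∀ A : Matrix Unit Unit K, (1 + A).det = 1 + A () () := fun A => by
    rw [Matrix.det_unique]; rfl
  rw [h1, Matrix.mul_apply]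
  simp only [Matrix.mul_diagonal, Matrix.replicateRow_apply, Matrix.replicateCol_apply, one_mul]
  rw [mul_add, mul_one, Finset.mul_sum, Finset.mul_sum]
  congr 1
  refine Finset.sum_congr rfl fun i _ => ?_
  rw [← Finset.mul_prod_erase _ _ (Finset.mem_univ i)]
  have := hd i
  field_simp

/-- The identity holds for indeterminates over the field of fractions of a polynomial ring, hence in
every commutative ring. -/
lemma Matrix.det_diagonal_add_const {R ι : Type*} [CommRing R] [Fintype ι] [DecidableEq ι]
    (d : ι → R) (c : R) :
    (Matrix.diagonal d + Matrix.of fun _ _ => c).det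
      = ∏ i, d i + c * ∑ i, ∏ j ∈ Finset.univ.erase i, d j := by
  let P := MvPolynomial (Option ι) ℤ
  let K := FractionRing P
  let x : ι → P := fun i => MvPolynomial.X (some i)
  let y : P := MvPolynomial.X none
  have hP : (Matrix.diagonal x + Matrix.of fun _ _ => y).det
      = ∏ i, x i + y * ∑ i, ∏ j ∈ Finset.univ.erase i, x j := by
    have hinj := IsFractionRing.injective P K
    refine hinj ?_
    rw [RingHom.map_det]
    simp only [map_add, map_mul, map_prod, map_sum]
    rw [← Matrix.det_diagonal_add_const_of_ne_zero (fun i => by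
      rw [Ne, map_eq_zero_iff _ hinj]; exact MvPolynomial.X_ne_zero _)]
    congr 1
    ext i j
    by_cases hij : i = j <;> simp [hij]
  let f : P →+* R := MvPolynomial.eval₂Hom (Int.castRingHom R) fun o => o.elim c d
  have hx : ∀ i, f (x i) = d i := fun i => MvPolynomial.eval₂_X _ _ _
  have hy : f y = c := MvPolynomial.eval₂_X _ _ _
  have h := congrArg f hP
  rw [RingHom.map_det] at h
  simp only [map_add, map_mul, map_prod, map_sum, hx, hy] at h
  rw [← h]
  congr 1
  ext i j
  by_cases hij : i = j <;> simp [hij, hx, hy]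

lemma Matrix.det_const_sub_diagonal {R ι : Type*} [CommRing R] [Fintype ι] [DecidableEq ι]
    (hι : Even (Fintype.card ι)) (d : ι → R) (c : R) :
    (Matrix.of fun i j => c - if i = j then d i else 0).det
      = ∏ i, d i - c * ∑ i, ∏ j ∈ Finset.univ.erase i, d j := by
  have hmat : (Matrix.of fun i j => c - if i = j then d i else 0)
      = Matrix.diagonal (fun i => -d i) + Matrix.of fun _ _ => c := by
    ext i j
    by_cases hij : i = j
    · simp [hij]; ring
    · simp [hij]
  have hneg : ∀ i, ∏ j ∈ Finset.univ.erase i, -d j = -∏ j ∈ Finset.univ.erase i, d j := by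
    intro i
    have hodd : Odd (Finset.univ.erase i).card := by
      rw [Finset.card_erase_of_mem (Finset.mem_univ i), Finset.card_univ]
      exact Nat.Even.sub_odd (Fintype.card_pos_iff.2 ⟨i⟩) hι odd_one
    rw [Finset.prod_neg, hodd.neg_one_pow, neg_one_mul]
  rw [hmat, Matrix.det_diagonal_add_const, Finset.sum_congr rfl fun i _ => hneg i,
    Finset.sum_neg_distrib, mul_neg, ← sub_eq_add_neg, Finset.prod_neg, Finset.card_univ,
    hι.neg_one_pow, one_mul]

/-! ### The class of the Hessian -/

lemma pderivGerm_germAt {k : ℕ} {f g : EuclideanSpace ℝ (Fin k) → ℝ} (hf : AnalyticAt ℝ f 0)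
    (hg : AnalyticAt ℝ g 0) (i : Fin k) (h : ∀ x, fderiv ℝ f x (EuclideanSpace.single i 1) = g x) :
    pderivGerm i (germAt f hf) = germAt g hg :=
  Subtype.ext (congrArg Germ.ofFun (funext h))

lemma pderivGerm_pderivGerm_areaGerm (m : ℕ) (i j : Fin (2 * m)) :
    pderivGerm i (pderivGerm j (areaGerm m))
      = (∑ k, coordGerm k) - if i = j then coordGerm i else 0 := by
  have hc := fun i => analyticAt_coord (k := 2 * m) i 0
  have h1 : AnalyticAt ℝ (fun x : EuclideanSpace ℝ (Fin (2 * m)) => ∑ i, x i) 0 :=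
    Finset.analyticAt_fun_sum _ fun i _ => hc i
  have hd1 : AnalyticAt ℝ (fun x : EuclideanSpace ℝ (Fin (2 * m)) =>
      1 / 2 * ((∑ k, x k) ^ 2 - x j ^ 2)) 0 :=
    analyticAt_const.fun_mul ((h1.fun_pow 2).fun_sub ((hc j).fun_pow 2))
  have hd2 : AnalyticAt ℝ (fun x : EuclideanSpace ℝ (Fin (2 * m)) =>
      (∑ k, x k) - if i = j then x i else 0) 0 := by
    split_ifs
    · exact h1.fun_sub (hc i)
    · exact h1.fun_sub analyticAt_const
  rw [areaGerm, pderivGerm_germAt _ hd1 j (fun x => fderiv_cubicJet m x j),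
    pderivGerm_germAt hd1 hd2 i]
  · refine Subtype.ext ?_
    rw [AddSubgroupClass.coe_sub, coe_sum_coordGerm]
    split_ifs
    · rfl
    · rfl
  · intro x
    have hp : ∀ j, HasFDerivAt (fun x : EuclideanSpace ℝ (Fin (2 * m)) => x j)
        (EuclideanSpace.proj j : EuclideanSpace ℝ (Fin (2 * m)) →L[ℝ] ℝ) x := fun j =>
      (EuclideanSpace.proj j : EuclideanSpace ℝ (Fin (2 * m)) →L[ℝ] ℝ).hasFDerivAt
    have h3 := (((HasFDerivAt.fun_sum (u := Finset.univ) fun j _ => hp j).pow 2).sub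
      ((hp j).pow 2)).const_mul (1 / 2 : ℝ)
    rw [HasFDerivAt.fderiv (f := fun x : EuclideanSpace ℝ (Fin (2 * m)) =>
      1 / 2 * ((∑ k, x k) ^ 2 - x j ^ 2)) h3]
    by_cases hij : i = j
    · subst hij
      simp
      ring
    · simp [hij, Ne.symm hij]

lemma mk_hessianGerm (m : ℕ) :
    Ideal.Quotient.mk (jacobianIdeal (areaGerm m)) (hessianGerm (areaGerm m))
      = squarefreeClass (areaGerm m) Finset.univ
        - ∑ i, ∑ j, coordClass m j * squarefreeClass (areaGerm m) (Finset.univ.erase i) := by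
  have hmat : (Matrix.of fun i j => pderivGerm i (pderivGerm j (areaGerm m)))
      = Matrix.of fun i j => (∑ k, coordGerm k) - if i = j then coordGerm i else 0 :=
    congrArg Matrix.of (funext fun i => funext fun j => pderivGerm_pderivGerm_areaGerm m i j)
  rw [hessianGerm, hmat, Matrix.det_const_sub_diagonal (by simp), map_sub, map_mul, map_sum,
    map_sum, Finset.mul_sum]
  simp only [Finset.sum_mul]
  rfl

lemma IsNormalized.map_hessianGerm {m : ℕ} (hm : 1 ≤ m)
    {l : MilnorAlgebra (areaGerm m) →ₗ[ℝ] ℝ} {ω : ℝ} (h : IsNormalized l ω) :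
    l (Ideal.Quotient.mk (jacobianIdeal (areaGerm m)) (hessianGerm (areaGerm m)))
      = (2 * m + 1) * ω := by
  have hval : ∀ i j : Fin (2 * m),
      l (coordClass m j * squarefreeClass (areaGerm m) (Finset.univ.erase i))
        = bCoeff m ω 1 + if i = j then ω - bCoeff m ω 1 else 0 := by
    intro i j
    rw [coordClass_mul_prod_erase]
    by_cases hij : j = i
    · rw [if_pos hij, if_pos hij.symm, h.1]; ring
    · rw [if_neg hij, if_neg (Ne.symm hij), add_zero]
      have h1 := h.map_pow_mul_squarefreeClass hm hm ((Finset.univ.erase i).erase j) (by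
        rw [Finset.card_erase_of_mem (Finset.mem_erase.2 ⟨hij, Finset.mem_univ j⟩),
          Finset.card_erase_of_mem (Finset.mem_univ i), Finset.card_univ, Fintype.card_fin]
        omega)
      rwa [pow_one] at h1
  have hb := bCoeff_succ (m := m) (p := 0) (by omega) ω
  rw [bCoeff_zero] at hb
  rw [mk_hessianGerm, map_sub, h.1, map_sum]
  simp only [map_sum, hval, Finset.sum_add_distrib, Finset.sum_const, Finset.sum_ite_eq,
    Finset.mem_univ, if_true, Finset.card_univ, Fintype.card_fin, nsmul_eq_mul]
  push_cast at hb ⊢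
  linear_combination (-2 * (m : ℝ)) * hb

/-! ### Signed count of the zeros of a function of one variable -/

lemma HasDerivAt.eventually_sign_eq {F : ℝ → ℝ} {z d : ℝ} (h : HasDerivAt F d z) (hz : F z = 0)
    (hd : d ≠ 0) :
    ∀ᶠ t in 𝓝 z, SignType.sign (F t) = SignType.sign d * SignType.sign (t - z) := by
  rcases hd.lt_or_gt with hd | hd
  · filter_upwards [eventually_nhdsWithin_sign_eq_of_deriv_neg (h.deriv.symm ▸ hd) hz] with t ht
    rw [ht, sign_neg hd, ← neg_sub, Left.sign_neg, neg_one_mul]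
  · filter_upwards [eventually_nhdsWithin_sign_eq_of_deriv_pos (h.deriv.symm ▸ hd) hz] with t ht
    rw [ht, sign_pos hd, one_mul]

lemma sign_eq_of_forall_ne_zero {F : ℝ → ℝ} {a b : ℝ} (hab : a ≤ b)
    (hF : ContinuousOn F (Set.Icc a b)) (h0 : ∀ t ∈ Set.Icc a b, F t ≠ 0) :
    SignType.sign (F a) = SignType.sign (F b) := by
  have ha := h0 a (Set.left_mem_Icc.2 hab)
  have hb := h0 b (Set.right_mem_Icc.2 hab)
  rcases ha.lt_or_gt with ha | ha <;> rcases hb.lt_or_gt with hb | hb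
  · rw [sign_neg ha, sign_neg hb]
  · obtain ⟨t, ht, h⟩ := intermediate_value_Icc hab hF ⟨ha.le, hb.le⟩
    exact absurd h (h0 t ht)
  · obtain ⟨t, ht, h⟩ := intermediate_value_Icc' hab hF ⟨hb.le, ha.le⟩
    exact absurd h (h0 t ht)
  · rw [sign_pos ha, sign_pos hb]

lemma finite_zeros_of_hasDerivAt {F F' : ℝ → ℝ} {a b : ℝ}
    (hF : ContinuousOn F (Set.Icc a b)) (ha : F a ≠ 0) (hb : F b ≠ 0)
    (hz : ∀ z ∈ Set.Ioo a b, F z = 0 → HasDerivAt F (F' z) z ∧ F' z ≠ 0) :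
    {z | z ∈ Set.Ioo a b ∧ F z = 0}.Finite := by
  have hset : {z | z ∈ Set.Ioo a b ∧ F z = 0} = Set.Icc a b ∩ F ⁻¹' {0} := by
    ext z
    constructor
    · rintro ⟨h1, h2⟩
      exact ⟨Set.Ioo_subset_Icc_self h1, h2⟩
    · rintro ⟨h1, h2⟩
      refine ⟨⟨lt_of_le_of_ne h1.1 ?_, lt_of_le_of_ne h1.2 ?_⟩, h2⟩
      · rintro rfl; exact ha h2
      · rintro rfl; exact hb h2
  have hcomp : IsCompact {z | z ∈ Set.Ioo a b ∧ F z = 0} := by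
    rw [hset]
    exact isCompact_Icc.of_isClosed_subset
      (hF.preimage_isClosed_of_isClosed isClosed_Icc isClosed_singleton) Set.inter_subset_left
  by_contra hinf
  obtain ⟨z, hz1, hne⟩ := exists_nhds_ne_inf_principal_neBot hcomp hinf
  obtain ⟨hd, hd0⟩ := hz z hz1.1 hz1.2
  have hev : ∀ᶠ t in 𝓝[≠] z ⊓ 𝓟 {z | z ∈ Set.Ioo a b ∧ F z = 0}, False := by
    rw [eventually_inf_principal]
    filter_upwards [hd.eventually_ne (c := 0) hd0] with t ht ht'
    exact ht ht'.2
  exact hne.ne (eventually_false_iff_eq_bot.1 hev)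

/-- Between consecutive zeros the sign is constant, and it jumps by twice the sign of the derivative
at each zero. -/
lemma two_mul_sum_sign_deriv {F F' : ℝ → ℝ} {b : ℝ} (hb : F b ≠ 0) (n : ℕ) :
    ∀ a < b, ContinuousOn F (Set.Icc a b) → F a ≠ 0 →
      (∀ z ∈ Set.Ioo a b, F z = 0 → HasDerivAt F (F' z) z ∧ F' z ≠ 0) →
      ∀ Z : Finset ℝ, Z.card = n → (∀ z, z ∈ Z ↔ z ∈ Set.Ioo a b ∧ F z = 0) →
      2 * ∑ z ∈ Z, (SignType.sign (F' z) : ℤ)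
        = (SignType.sign (F b) : ℤ) - (SignType.sign (F a) : ℤ) := by
  induction n with
  | zero =>
    intro a hab hF ha _ Z hZ hmem
    rw [Finset.card_eq_zero] at hZ
    subst hZ
    rw [sign_eq_of_forall_ne_zero hab.le hF, Finset.sum_empty, mul_zero, sub_self]
    intro t ht h0
    have := (hmem t).2 ⟨⟨lt_of_le_of_ne ht.1 ?_, lt_of_le_of_ne ht.2 ?_⟩, h0⟩
    · simp at this
    · rintro rfl; exact ha h0
    · rintro rfl; exact hb h0
  | succ n ih =>
    intro a hab hF ha hz Z hZ hmem
    have hne : Z.Nonempty := Finset.card_pos.1 (by omega)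
    set w := Z.min' hne with hw
    have hwZ : w ∈ Z := Z.min'_mem hne
    have hmin : ∀ z ∈ Z, w ≤ z := fun z hz => Z.min'_le z hz
    obtain ⟨⟨haw, hwb⟩, hFw⟩ := (hmem w).1 hwZ
    obtain ⟨hd, hd0⟩ := hz w ⟨haw, hwb⟩ hFw
    obtain ⟨δ, hδ, hball⟩ := Metric.eventually_nhds_iff.1 (hd.eventually_sign_eq hFw hd0)
    -- points on both sides of the first zero `w`, close enough to see the sign of the derivative
    have hsign : ∀ t, |t - w| < δ →
        SignType.sign (F t) = SignType.sign (F' w) * SignType.sign (t - w) :=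
      fun t ht => hball (by rwa [Real.dist_eq])
    obtain ⟨c, hwc, hc⟩ : ∃ c, w < c ∧ c < min b (w + δ) :=
      exists_between (lt_min hwb (by linarith))
    obtain ⟨e, he, hew⟩ : ∃ e, max a (w - δ) < e ∧ e < w :=
      exists_between (max_lt haw (by linarith))
    have hcb : c < b := lt_of_lt_of_le hc (min_le_left _ _)
    have hcδ : c < w + δ := lt_of_lt_of_le hc (min_le_right _ _)
    have hae : a < e := lt_of_le_of_lt (le_max_left _ _) he
    have heδ : w - δ < e := lt_of_le_of_lt (le_max_right _ _) he
    have hpos : ∀ t, w < t → t ≤ c → SignType.sign (F t) = SignType.sign (F' w) := by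
      intro t h1 h2
      rw [hsign t (abs_lt.2 ⟨by linarith, by linarith⟩), sign_pos (sub_pos.2 h1), mul_one]
    have hFc := hpos c hwc le_rfl
    have hFe : SignType.sign (F e) = -SignType.sign (F' w) := by
      rw [hsign e (abs_lt.2 ⟨by linarith, by linarith⟩), sign_neg (sub_neg.2 hew), mul_neg_one]
    have hs0 : SignType.sign (F' w) ≠ 0 := sign_ne_zero.2 hd0
    have hFa : SignType.sign (F a) = -SignType.sign (F' w) := by
      rw [← hFe]
      refine sign_eq_of_forall_ne_zero hae.le
        (hF.mono (Set.Icc_subset_Icc_right (by linarith))) fun t ht h0 => ?_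
      have hta : a ≠ t := by rintro rfl; exact ha h0
      have := hmin t ((hmem t).2 ⟨⟨lt_of_le_of_ne ht.1 hta, by linarith [ht.2]⟩, h0⟩)
      linarith [ht.2]
    have key := ih c hcb (hF.mono (Set.Icc_subset_Icc_left (by linarith)))
      (sign_ne_zero.1 (hFc ▸ hs0)) (fun z hzc => hz z ⟨by linarith [hzc.1], hzc.2⟩) (Z.erase w)
      (by rw [Finset.card_erase_of_mem hwZ, hZ]; rfl) (fun z => by
        rw [Finset.mem_erase, hmem]
        constructor
        · rintro ⟨h1, h2, h3⟩
          refine ⟨⟨?_, h2.2⟩, h3⟩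
          by_contra hzc
          have hwz := lt_of_le_of_ne (hmin z ((hmem z).2 ⟨h2, h3⟩)) (Ne.symm h1)
          have := hpos z hwz (not_lt.1 hzc)
          rw [h3, sign_zero] at this
          exact hs0 this.symm
        · rintro ⟨h1, h3⟩
          exact ⟨by rintro rfl; linarith [h1.1], ⟨by linarith [h1.1], h1.2⟩, h3⟩)
    rw [← Finset.add_sum_erase _ _ hwZ, mul_add, key, hFc, hFa, SignType.coe_neg]
    ring

lemma two_mul_finsum_sign_deriv {F F' : ℝ → ℝ} {a b : ℝ} (hab : a < b)
    (hF : ContinuousOn F (Set.Icc a b)) (ha : F a ≠ 0) (hb : F b ≠ 0)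
    (hz : ∀ z ∈ Set.Ioo a b, F z = 0 → HasDerivAt F (F' z) z ∧ F' z ≠ 0) :
    2 * ∑ᶠ z ∈ {z | z ∈ Set.Ioo a b ∧ F z = 0}, (SignType.sign (F' z) : ℤ)
      = (SignType.sign (F b) : ℤ) - (SignType.sign (F a) : ℤ) := by
  have hfin := finite_zeros_of_hasDerivAt hF ha hb hz
  rw [finsum_mem_eq_finite_toFinset_sum _ hfin]
  exact two_mul_sum_sign_deriv hb _ a hab hF ha hz _ rfl fun z => by simp

/-! ### The gradient of the signed area -/

lemma gradient_signedArea (m : ℕ) :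
    gradient (signedArea m)
      = fun x => WithLp.toLp 2 fun i => Real.cos (x i) - Real.cos (∑ j, x j) := by
  funext x
  have hp : ∀ j, HasFDerivAt (fun x : EuclideanSpace ℝ (Fin (2 * m)) => x j)
      (EuclideanSpace.proj j : EuclideanSpace ℝ (Fin (2 * m)) →L[ℝ] ℝ) x := fun j =>
    (EuclideanSpace.proj j : EuclideanSpace ℝ (Fin (2 * m)) →L[ℝ] ℝ).hasFDerivAt
  have h1 := (HasFDerivAt.fun_sum (u := Finset.univ) fun j _ => (hp j).sin).add
    (HasFDerivAt.fun_sum (u := Finset.univ) fun j _ => hp j).neg.sin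
  refine HasGradientAt.gradient ?_
  rw [hasGradientAt_iff_hasFDerivAt]
  refine h1.congr_fderiv ?_
  ext v
  simp [PiLp.inner_apply, mul_comm, sub_eq_add_neg, add_mul, Finset.sum_add_distrib]
  rw [← Finset.mul_sum, mul_comm]

lemma contDiff_gradient_signedArea (m : ℕ) : ContDiff ℝ 1 (gradient (signedArea m)) := by
  rw [gradient_signedArea, contDiff_euclidean]
  intro i
  have hp : ∀ j, ContDiff ℝ 1 fun x : EuclideanSpace ℝ (Fin (2 * m)) => x j := fun j =>
    (EuclideanSpace.proj j : EuclideanSpace ℝ (Fin (2 * m)) →L[ℝ] ℝ).contDiff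
  exact (hp i).cos.sub (ContDiff.sum fun j _ => hp j).cos

lemma det_fderiv_gradient_signedArea (m : ℕ) (x : EuclideanSpace ℝ (Fin (2 * m))) :
    (fderiv ℝ (gradient (signedArea m)) x).det
      = ∏ i, Real.sin (x i)
        - Real.sin (∑ j, x j) * ∑ i, ∏ j ∈ Finset.univ.erase i, Real.sin (x j) := by
  have hp : ∀ j, HasFDerivAt (fun x : EuclideanSpace ℝ (Fin (2 * m)) => x j)
      (EuclideanSpace.proj j : EuclideanSpace ℝ (Fin (2 * m)) →L[ℝ] ℝ) x := fun j =>
    (EuclideanSpace.proj j : EuclideanSpace ℝ (Fin (2 * m)) →L[ℝ] ℝ).hasFDerivAt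
  have hd : DifferentiableAt ℝ (gradient (signedArea m)) x :=
    (contDiff_gradient_signedArea m).differentiable one_ne_zero x
  have hentry : ∀ i j, fderiv ℝ (gradient (signedArea m)) x (EuclideanSpace.single j 1) i
      = Real.sin (∑ j, x j) - if i = j then Real.sin (x i) else 0 := by
    intro i j
    have h1 := (EuclideanSpace.proj i : EuclideanSpace ℝ (Fin (2 * m)) →L[ℝ] ℝ).hasFDerivAt.comp x
      hd.hasFDerivAt
    have h2 := (hp i).cos.sub (HasFDerivAt.fun_sum (u := Finset.univ) fun j _ => hp j).cos
    have h3 := congrArg (fun L => L (EuclideanSpace.single j 1)) (h1.unique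
      (h2.congr_of_eventuallyEq
      (Eventually.of_forall fun z => by simp [gradient_signedArea])))
    have h4 : fderiv ℝ (gradient (signedArea m)) x (EuclideanSpace.single j 1) i
        = ((EuclideanSpace.proj i : EuclideanSpace ℝ (Fin (2 * m)) →L[ℝ] ℝ).comp
          (fderiv ℝ (gradient (signedArea m)) x)) (EuclideanSpace.single j 1) := rfl
    rw [h4, h3]
    by_cases hij : i = j
    · subst hij; simp; ring
    · simp [hij]
  rw [← Matrix.det_const_sub_diagonal (by simp), ContinuousLinearMap.det,
    ← LinearMap.det_toMatrix (EuclideanSpace.basisFun (Fin (2 * m)) ℝ).toBasis]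
  congr 1
  ext i j
  rw [LinearMap.toMatrix_apply]
  simpa using hentry i j

/-! ### Closed polygons near the degenerate star -/

/-- All the `k + 1` angles of the polygon: the last one, indexed by `none`, makes the sum zero. -/
noncomputable def closedAngles {k : ℕ} (x : EuclideanSpace ℝ (Fin k)) (o : Option (Fin k)) : ℝ :=
  o.elim (-∑ i, x i) fun i => x i

lemma sum_closedAngles {k : ℕ} (x : EuclideanSpace ℝ (Fin k)) : ∑ o, closedAngles x o = 0 := by
  rw [Fintype.sum_option]
  exact neg_add_cancel _

lemma continuous_closedAngles {k : ℕ} (o : Option (Fin k)) :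
    Continuous fun x : EuclideanSpace ℝ (Fin k) => closedAngles x o := by
  cases o with
  | none => exact (continuous_finsetSum _ fun i _ => PiLp.continuous_apply 2 _ i).neg
  | some i => exact PiLp.continuous_apply 2 _ i

lemma closedAngles_toLp {k : ℕ} {a : Option (Fin k) → ℝ} (ha : ∑ o, a o = 0) :
    closedAngles (WithLp.toLp 2 fun i => a (some i)) = a := by
  rw [Fintype.sum_option] at ha
  funext o
  cases o with
  | none => exact (eq_neg_of_add_eq_zero_left ha).symm
  | some i => rfl

lemma toLp_closedAngles {k : ℕ} (x : EuclideanSpace ℝ (Fin k)) :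
    (WithLp.toLp 2 fun i => closedAngles x (some i)) = x := rfl

lemma gradient_signedArea_eq_iff {m : ℕ} (x y : EuclideanSpace ℝ (Fin (2 * m)))
    (j : Option (Fin (2 * m))) :
    gradient (signedArea m) x = y ↔ ∀ o, Real.cos (closedAngles x o)
      = Real.cos (closedAngles x j) - (j.elim 0 (fun i => y i) - o.elim 0 fun i => y i) := by
  have h0 : Real.cos (closedAngles x none) = Real.cos (∑ i, x i) := Real.cos_neg _
  have h1 : gradient (signedArea m) x = y ↔ ∀ i, Real.cos (x i) - Real.cos (∑ i, x i) = y i := by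
    rw [gradient_signedArea]
    exact ⟨fun h i => congrArg (fun v : EuclideanSpace ℝ (Fin (2 * m)) => v i) h,
      fun h => PiLp.ext h⟩
  rw [h1]
  constructor
  · intro h
    have h2 : ∀ o, Real.cos (closedAngles x o)
        = Real.cos (∑ i, x i) + o.elim 0 fun i => y i := by
      rintro (_ | i)
      · rw [h0]; simp
      · have := h i
        simp only [Option.elim_some, closedAngles]
        linarith
    intro o
    rw [h2 o, h2 j]
    ring
  · intro h i
    have h2 := h (some i)
    have h3 := h none
    rw [h0] at h3
    simp only [Option.elim_some, Option.elim_none, closedAngles] at h2 h3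
    linarith

/-- The Jacobian determinant is the elementary symmetric function of degree `2 m` of the sines of
all the `2 m + 1` angles. -/
lemma det_fderiv_gradient_signedArea_eq_sum {m : ℕ} (x : EuclideanSpace ℝ (Fin (2 * m))) :
    (fderiv ℝ (gradient (signedArea m)) x).det
      = ∑ o, ∏ o' ∈ Finset.univ.erase o, Real.sin (closedAngles x o') := by
  have h0 : Finset.univ.erase (none : Option (Fin (2 * m)))
      = Finset.univ.map Function.Embedding.some := by
    ext o; cases o <;> simp
  have h1 : ∀ i : Fin (2 * m), Finset.univ.erase (some i)
      = Finset.insertNone (Finset.univ.erase i) := by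
    intro i
    ext o; cases o <;> simp
  rw [det_fderiv_gradient_signedArea, Fintype.sum_option, h0, Finset.prod_map, sub_eq_add_neg,
    ← neg_mul, ← Real.sin_neg, Finset.mul_sum]
  simp only [h1, Finset.prod_insertNone]
  rfl

lemma eq_zero_of_gradient_signedArea_eq_zero {m : ℕ} {x : EuclideanSpace ℝ (Fin (2 * m))}
    (h : gradient (signedArea m) x = 0) (hx : ∀ o, |closedAngles x o| ≤ Real.pi) : x = 0 := by
  rw [gradient_signedArea_eq_iff x 0 none] at h
  have habs : ∀ o, |closedAngles x o| = |closedAngles x none| := by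
    intro o
    have h1 := h o
    have h2 : Real.cos (closedAngles x o) = Real.cos (closedAngles x none) := by
      rw [h1]; cases o <;> simp
    rw [← Real.arccos_cos (abs_nonneg _) (hx o), ← Real.arccos_cos (abs_nonneg _) (hx none),
      Real.cos_abs, Real.cos_abs, h2]
  set s := |closedAngles x none| with hs
  -- an odd number of signs cannot add up to zero
  have hsum : ∃ z : ℤ, ∑ o, closedAngles x o = (2 * z + 1 : ℤ) * s := by
    have h1 : ∀ o, ∃ e : ℤ, closedAngles x o = (2 * e + 1 : ℤ) * s := by
      intro o
      rcases abs_eq (abs_nonneg (closedAngles x none)) |>.1 (habs o) with h | h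
      · exact ⟨0, by rw [h]; simp [hs]⟩
      · exact ⟨-1, by rw [h]; simp [hs]⟩
    choose e he using h1
    refine ⟨∑ o, e o + m, ?_⟩
    rw [Finset.sum_congr rfl fun o _ => he o, ← Finset.sum_mul]
    congr 1
    push_cast
    rw [Finset.sum_add_distrib, ← Finset.mul_sum]
    simp
    ring
  obtain ⟨z, hz⟩ := hsum
  rw [sum_closedAngles] at hz
  have hz0 : ((2 * z + 1 : ℤ) : ℝ) ≠ 0 := by
    rw [Int.cast_ne_zero]; omega
  have hs0 : s = 0 := (mul_eq_zero.1 hz.symm).resolve_left hz0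
  refine PiLp.ext fun i => ?_
  have := habs (some i)
  rw [hs0, abs_eq_zero] at this
  exact this

/-! ### The branches of the fibre -/

section branch

variable {ι : Type*} [DecidableEq ι]

/-- The angles with `cos (α_j) = cos p - c_j` for `j ≠ j₀` and `α_{j₀} = p`, where the angles that
are taken to be nonpositive are those with index in `T`. -/
noncomputable def branch (c : ι → ℝ) (j₀ : ι) (T : Finset ι) (p : ℝ) (j : ι) : ℝ :=
  if j = j₀ then p else (if j ∈ T then -1 else 1) * Real.arccos (Real.cos p - c j)

variable {c : ι → ℝ} {j₀ : ι} {T : Finset ι}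

@[simp] lemma branch_self (p : ℝ) : branch c j₀ T p j₀ = p := if_pos rfl

lemma branch_of_ne {j : ι} (hj : j ≠ j₀) (p : ℝ) :
    branch c j₀ T p j = (if j ∈ T then -1 else 1) * Real.arccos (Real.cos p - c j) := if_neg hj

lemma continuous_branch (j : ι) : Continuous fun p => branch c j₀ T p j := by
  unfold branch
  split_ifs
  · exact continuous_id
  all_goals
    exact continuous_const.mul (Real.continuous_arccos.comp
      (Real.continuous_cos.sub continuous_const))

lemma cos_branch {p : ℝ} {j : ι} (hj : j ≠ j₀) (h1 : -1 ≤ Real.cos p - c j)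
    (h2 : Real.cos p - c j ≤ 1) : Real.cos (branch c j₀ T p j) = Real.cos p - c j := by
  rw [branch_of_ne hj]
  split_ifs
  · rw [neg_one_mul, Real.cos_neg, Real.cos_arccos h1 h2]
  · rw [one_mul, Real.cos_arccos h1 h2]

lemma abs_branch {p : ℝ} {j : ι} (hj : j ≠ j₀) :
    |branch c j₀ T p j| = Real.arccos (Real.cos p - c j) := by
  rw [branch_of_ne hj]
  split_ifs
  · rw [neg_one_mul, abs_neg, abs_of_nonneg (Real.arccos_nonneg _)]
  · rw [one_mul, abs_of_nonneg (Real.arccos_nonneg _)]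

lemma branch_neg_iff {p : ℝ} {j : ι} (hj : j ≠ j₀) (h : Real.cos p - c j < 1) :
    branch c j₀ T p j < 0 ↔ j ∈ T := by
  have hpos := Real.arccos_pos.2 h
  rw [branch_of_ne hj]
  split_ifs with hT
  · simp [hT, hpos]
  · simp [hT, hpos.le]

lemma sin_branch {p : ℝ} {j : ι} (hj : j ≠ j₀) :
    Real.sin (branch c j₀ T p j)
      = (if j ∈ T then -1 else 1) * Real.sqrt (1 - (Real.cos p - c j) ^ 2) := by
  rw [branch_of_ne hj, ← Real.sin_arccos]
  split_ifs
  · rw [neg_one_mul, Real.sin_neg, neg_one_mul]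
  · rw [one_mul, one_mul]

lemma hasDerivAt_branch {p : ℝ} {j : ι} (hj : j ≠ j₀) (h1 : -1 < Real.cos p - c j)
    (h2 : Real.cos p - c j < 1) :
    HasDerivAt (fun p => branch c j₀ T p j) (Real.sin p / Real.sin (branch c j₀ T p j)) p := by
  have h := ((Real.hasDerivAt_arccos h1.ne' h2.ne).comp p
    ((Real.hasDerivAt_cos p).sub_const (c j))).const_mul (if j ∈ T then (-1 : ℝ) else 1)
  have hfun : (fun p => branch c j₀ T p j)
      = fun p => (if j ∈ T then (-1 : ℝ) else 1) * (Real.arccos ∘ fun p => Real.cos p - c j) p :=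
    funext fun p => branch_of_ne hj p
  rw [hfun]
  refine h.congr_deriv ?_
  rw [sin_branch hj]
  split_ifs <;> ring

variable [Fintype ι]

lemma prod_erase_sin_branch (hT : T ⊆ Finset.univ.erase j₀) {p : ℝ}
    (h : ∀ j, j ≠ j₀ → -1 < Real.cos p - c j ∧ Real.cos p - c j < 1) :
    SignType.sign (∏ j ∈ Finset.univ.erase j₀, Real.sin (branch c j₀ T p j))
      = (-1) ^ T.card := by
  have hpos : 0 < ∏ j ∈ Finset.univ.erase j₀, Real.sqrt (1 - (Real.cos p - c j) ^ 2) := by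
    refine Finset.prod_pos fun j hj => Real.sqrt_pos.2 ?_
    obtain ⟨h1, h2⟩ := h j (Finset.ne_of_mem_erase hj)
    nlinarith
  rw [Finset.prod_congr rfl fun j hj => sin_branch (Finset.ne_of_mem_erase hj),
    Finset.prod_mul_distrib, sign_mul, sign_pos hpos, mul_one, Finset.prod_ite_mem,
    Finset.inter_eq_right.2 hT, Finset.prod_const, sign_pow, sign_neg (by norm_num)]

lemma sum_prod_erase {s : ι → ℝ} (hs : ∀ j, j ≠ j₀ → s j ≠ 0) :
    ∑ k, ∏ j ∈ Finset.univ.erase k, s j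
      = (∏ j ∈ Finset.univ.erase j₀, s j)
        * (1 + ∑ j ∈ Finset.univ.erase j₀, s j₀ / s j) := by
  rw [← Finset.add_sum_erase _ _ (Finset.mem_univ j₀), mul_add, mul_one, Finset.mul_sum]
  congr 1
  refine Finset.sum_congr rfl fun k hk => ?_
  have hk' := Finset.ne_of_mem_erase hk
  have := hs k hk'
  rw [← Finset.mul_prod_erase _ _ hk, ← Finset.mul_prod_erase (Finset.univ.erase k) _
    (Finset.mem_erase.2 ⟨hk'.symm, Finset.mem_univ j₀⟩), Finset.erase_right_comm]
  field_simp

lemma hasDerivAt_sum_branch {p : ℝ}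
    (h : ∀ j, j ≠ j₀ → -1 < Real.cos p - c j ∧ Real.cos p - c j < 1) :
    HasDerivAt (fun p => ∑ j, branch c j₀ T p j)
      (1 + ∑ j ∈ Finset.univ.erase j₀, Real.sin p / Real.sin (branch c j₀ T p j)) p := by
  have hfun : (fun p => ∑ j, branch c j₀ T p j)
      = fun p => p + ∑ j ∈ Finset.univ.erase j₀, branch c j₀ T p j := by
    funext p
    rw [← Finset.add_sum_erase _ _ (Finset.mem_univ j₀), branch_self]
  rw [hfun]
  refine (hasDerivAt_id p).add (HasDerivAt.fun_sum fun j hj => ?_)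
  have hj' := Finset.ne_of_mem_erase hj
  exact hasDerivAt_branch hj' (h j hj').1 (h j hj').2

/-- For small `c` the branches at `p = ± A` are close to `± A`, so that their sum has the sign of
the odd integer that counts the signs. -/
lemma sign_sum_branch (hT : T ⊆ Finset.univ.erase j₀) {A p : ℝ} (e : ℤ) (hA : 0 < A)
    (hp : p = e * A)
    (hc : ∀ j, j ≠ j₀ → |Real.arccos (Real.cos p - c j) - A| * (2 * Fintype.card ι) ≤ A)
    (he : e + (Fintype.card ι - 1 : ℤ) - 2 * T.card ≠ 0) :
    SignType.sign (∑ j, branch c j₀ T p j)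
      = SignType.sign (e + (Fintype.card ι - 1 : ℤ) - 2 * T.card) := by
  set N := Fintype.card ι with hN
  set q : ℤ := e + (N - 1 : ℤ) - 2 * T.card with hq
  have hN1 : 1 ≤ N := Fintype.card_pos_iff.2 ⟨j₀⟩
  have hNr : (1 : ℝ) ≤ N := by exact_mod_cast hN1
  have hcardE : (Finset.univ.erase j₀).card = N - 1 := by
    rw [Finset.card_erase_of_mem (Finset.mem_univ j₀), Finset.card_univ]
  have hsgn : ∑ j ∈ Finset.univ.erase j₀, (if j ∈ T then (-1 : ℝ) else 1) * A
      = (N - 1 - 2 * T.card) * A := by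
    have h1 : ∀ j, (if j ∈ T then (-1 : ℝ) else 1) = 1 - 2 * if j ∈ T then 1 else 0 := by
      intro j; split_ifs <;> norm_num
    rw [← Finset.sum_mul, Finset.sum_congr rfl fun j _ => h1 j, Finset.sum_sub_distrib,
      ← Finset.mul_sum, Finset.sum_ite_mem, Finset.inter_eq_right.2 hT]
    simp only [Finset.sum_const, hcardE, nsmul_eq_mul, mul_one]
    rw [Nat.cast_sub hN1, Nat.cast_one]
  have hdiff : |∑ j, branch c j₀ T p j - q * A| ≤ A / 2 := by
    have h1 : ∑ j, branch c j₀ T p j - q * A = ∑ j ∈ Finset.univ.erase j₀,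
        (branch c j₀ T p j - (if j ∈ T then (-1 : ℝ) else 1) * A) := by
      rw [Finset.sum_sub_distrib, hsgn, ← Finset.add_sum_erase _ _ (Finset.mem_univ j₀),
        branch_self, hp, hq]
      push_cast
      ring
    rw [h1]
    refine (Finset.abs_sum_le_sum_abs _ _).trans ?_
    have h2 : ∀ j ∈ Finset.univ.erase j₀,
        |branch c j₀ T p j - (if j ∈ T then (-1 : ℝ) else 1) * A| ≤ A / (2 * N) := by
      intro j hj
      have hj' := Finset.ne_of_mem_erase hj
      rw [le_div_iff₀ (by positivity)]
      refine le_trans (le_of_eq ?_) (hc j hj')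
      rw [branch_of_ne hj', ← mul_sub, abs_mul]
      split_ifs <;> simp
    refine (Finset.sum_le_card_nsmul _ _ _ h2).trans ?_
    rw [hcardE, nsmul_eq_mul, Nat.cast_sub hN1, Nat.cast_one, mul_div_assoc',
      div_le_div_iff₀ (by positivity) two_pos]
    nlinarith
  rw [abs_le] at hdiff
  rcases lt_or_gt_of_ne he with h | h
  · have hq1 : (q : ℝ) ≤ -1 := by exact_mod_cast Int.le_sub_one_of_lt h
    rw [sign_neg h, sign_neg]
    nlinarith [hdiff.2]
  · have hq1 : (1 : ℝ) ≤ q := by exact_mod_cast h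
    rw [sign_pos h, sign_pos]
    nlinarith [hdiff.1]

end branch

/-! ### The index of the gradient of the signed area -/

/-- The alternating sum over the sign patterns only sees the balanced ones. -/
lemma sum_powerset_sign_sub_sign {ι : Type*} {E : Finset ι} {m : ℕ} (hE : E.card = 2 * m) :
    ∑ T ∈ E.powerset, (-1 : ℤ) ^ T.card * ((SignType.sign (1 + 2 * m - 2 * T.card : ℤ) : ℤ)
      - (SignType.sign (-1 + 2 * m - 2 * T.card : ℤ) : ℤ))
      = 2 * ((-1) ^ m * ((2 * m).choose m : ℤ)) := by
  rw [Finset.sum_powerset, hE, Finset.sum_eq_single m]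
  · rw [Finset.sum_congr rfl (g := fun _ => (-1 : ℤ) ^ m * 2)]
    · rw [Finset.sum_const, Finset.card_powersetCard, hE, nsmul_eq_mul]
      ring
    · intro T hT
      rw [(Finset.mem_powersetCard.1 hT).2, sign_pos (by omega), sign_neg (by omega)]
      rfl
  · intro k _ hk
    refine Finset.sum_eq_zero fun T hT => ?_
    rw [(Finset.mem_powersetCard.1 hT).2]
    rcases lt_or_gt_of_ne hk with h | h
    · rw [sign_pos (by omega), sign_pos (by omega), sub_self, mul_zero]
    · rw [sign_neg (by omega), sign_neg (by omega), sub_self, mul_zero]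
  · intro h
    simp at h
    omega

lemma abs_closedAngles_le {k : ℕ} (x : EuclideanSpace ℝ (Fin k)) (o : Option (Fin k)) :
    |closedAngles x o| ≤ (k + 1) * ‖x‖ := by
  have h : ∀ i, |x i| ≤ ‖x‖ := fun i => PiLp.norm_apply_le x i
  cases o with
  | none =>
    have h1 : |∑ i, x i| ≤ k * ‖x‖ := by
      refine (Finset.abs_sum_le_sum_abs _ _).trans ?_
      refine (Finset.sum_le_card_nsmul _ _ _ fun i _ => h i).trans ?_
      simp
    rw [closedAngles, Option.elim_none, abs_neg]
    linarith [norm_nonneg x]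
  | some i =>
    refine (h i).trans ?_
    have := mul_nonneg (Nat.cast_nonneg (α := ℝ) k) (norm_nonneg x)
    linarith

lemma EuclideanSpace.norm_le_of_forall_abs_le {k : ℕ} {x : EuclideanSpace ℝ (Fin k)} {s : ℝ}
    (h : ∀ i, |x i| ≤ s) : ‖x‖ ≤ k * s := by
  have h1 : ‖x‖ ≤ ∑ i, |x i| := by
    conv_lhs => rw [← (EuclideanSpace.basisFun (Fin k) ℝ).sum_repr x]
    refine (norm_sum_le _ _).trans (le_of_eq ?_)
    simp [norm_smul]
  refine h1.trans ((Finset.sum_le_card_nsmul _ _ _ fun i _ => h i).trans ?_)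
  simp

/-- The fibre over a regular value `y` is parametrised by the angle `p` of largest index of `y` and
the set `T` of the other angles that are negative: for each `T` it corresponds to the zeros of the
sum of the branches. The Jacobian determinant is the derivative of that sum times the product of
the sines of the other angles, which has the sign `(-1) ^ |T|`. -/
lemma finsum_sign_det_fderiv_gradient_signedArea {m : ℕ} {r A : ℝ}
    {y : EuclideanSpace ℝ (Fin (2 * m))}
    {j₀ : Option (Fin (2 * m))} {c : Option (Fin (2 * m)) → ℝ}
    (hcy : ∀ o, c o = j₀.elim 0 (fun i => y i) - o.elim 0 fun i => y i) (hc : ∀ o, 0 ≤ c o)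
    (hA0 : 0 < A) (hA1 : A ≤ Real.pi) (hlow : ∀ j, -1 < Real.cos A - c j)
    (hr : ∀ x ∈ ball (0 : EuclideanSpace ℝ (Fin (2 * m))) r, ∀ o, |closedAngles x o| ≤ Real.pi)
    (hA : ∀ x ∈ ball (0 : EuclideanSpace ℝ (Fin (2 * m))) r, gradient (signedArea m) x = y →
      |closedAngles x j₀| < A)
    (hball : ∀ x : EuclideanSpace ℝ (Fin (2 * m)), |closedAngles x j₀| < A →
      (∀ j, j ≠ j₀ → |closedAngles x j| ≤ Real.arccos (Real.cos A - c j)) → x ∈ ball 0 r)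
    (hsmall : ∀ j, |Real.arccos (Real.cos A - c j) - A| * (2 * (2 * m + 1)) ≤ A)
    (hreg : ∀ x ∈ ball (0 : EuclideanSpace ℝ (Fin (2 * m))) r, gradient (signedArea m) x = y →
      (fderiv ℝ (gradient (signedArea m)) x).det ≠ 0) :
    ∑ᶠ x ∈ {x | x ∈ ball (0 : EuclideanSpace ℝ (Fin (2 * m))) r ∧ gradient (signedArea m) x = y},
      (SignType.sign (fderiv ℝ (gradient (signedArea m)) x).det : ℤ)
      = (-1) ^ m * ((2 * m).choose m : ℤ) := by
  classical
  set E := Finset.univ.erase j₀ with hE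
  have hEcard : E.card = 2 * m := by
    rw [hE, Finset.card_erase_of_mem (Finset.mem_univ _)]
    simp
  set a : Finset (Option (Fin (2 * m))) → ℝ → Option (Fin (2 * m)) → ℝ := branch c j₀ with ha
  set F : Finset (Option (Fin (2 * m))) → ℝ → ℝ := fun T p => ∑ j, a T p j with hF
  set F' : Finset (Option (Fin (2 * m))) → ℝ → ℝ := fun T p =>
    1 + ∑ j ∈ E, Real.sin p / Real.sin (a T p j) with hF'
  set Z : Finset (Option (Fin (2 * m))) → Set ℝ := fun T => {p | p ∈ Set.Ioo (-A) A ∧ F T p = 0}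
    with hZ
  set Q : Finset (Option (Fin (2 * m))) → ℝ → EuclideanSpace ℝ (Fin (2 * m)) := fun T p =>
    WithLp.toLp 2 fun i => a T p (some i) with hQ
  have hQa : ∀ T, ∀ p ∈ Z T, closedAngles (Q T p) = a T p := fun T p hp => closedAngles_toLp hp.2
  have hcos : ∀ p, |p| ≤ A → Real.cos A ≤ Real.cos p := fun p hp => by
    rw [← Real.cos_abs p]
    exact Real.cos_le_cos_of_nonneg_of_le_pi (abs_nonneg _) hA1 hp
  have hle1 : ∀ p j, Real.cos p - c j ≤ 1 := fun p j => by
    linarith [Real.cos_le_one p, hc j]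
  have hlt : ∀ p, |p| ≤ A → ∀ j, -1 < Real.cos p - c j := fun p hp j => by
    linarith [hlow j, hcos p hp]
  have habs : ∀ T, ∀ p ∈ Z T, |p| < A := fun T p hp => abs_lt.2 hp.1
  have hQmem : ∀ T, ∀ p ∈ Z T, Q T p ∈ ball (0 : EuclideanSpace ℝ (Fin (2 * m))) r := by
    intro T p hp
    refine hball _ ?_ fun j hj => ?_
    · rw [hQa T p hp, ha, branch_self]
      exact habs T p hp
    · rw [hQa T p hp, ha, abs_branch hj]
      exact Real.arccos_le_arccos (by linarith [hcos p (habs T p hp).le])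
  have hQgrad : ∀ T, ∀ p ∈ Z T, gradient (signedArea m) (Q T p) = y := by
    intro T p hp
    rw [gradient_signedArea_eq_iff _ _ j₀, hQa T p hp]
    intro o
    rw [← hcy o]
    by_cases ho : o = j₀
    · have : c o = 0 := by rw [hcy, ho, sub_self]
      rw [this, ho, sub_zero]
    · rw [ha, cos_branch ho (hlt p (habs T p hp).le o).le (hle1 p o), branch_self]
  -- at a regular point at most one of the angles vanishes
  have hrange : ∀ T, ∀ p ∈ Z T, ∀ j, j ≠ j₀ →
      -1 < Real.cos p - c j ∧ Real.cos p - c j < 1 := by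
    intro T p hp j hj
    refine ⟨hlt p (habs T p hp).le j, lt_of_le_of_ne (hle1 p j) fun h => ?_⟩
    refine hreg _ (hQmem T p hp) (hQgrad T p hp) ?_
    have hp1 : Real.cos p = 1 := by linarith [Real.cos_le_one p, hc j]
    have hs0 : Real.sin (a T p j₀) = 0 := by
      rw [ha, branch_self, Real.sin_eq_zero_iff_cos_eq]
      exact Or.inl hp1
    have hsj : Real.sin (a T p j) = 0 := by
      rw [ha, sin_branch hj, h]; simp
    rw [det_fderiv_gradient_signedArea_eq_sum, hQa T p hp]
    refine Finset.sum_eq_zero fun o _ => ?_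
    by_cases ho : o = j₀
    · exact Finset.prod_eq_zero (Finset.mem_erase.2 ⟨ho ▸ hj, Finset.mem_univ j⟩) hsj
    · exact Finset.prod_eq_zero (Finset.mem_erase.2 ⟨Ne.symm ho, Finset.mem_univ j₀⟩) hs0
  have hsin : ∀ T, ∀ p ∈ Z T, ∀ j, j ≠ j₀ → Real.sin (a T p j) ≠ 0 := by
    intro T p hp j hj
    obtain ⟨h1, h2⟩ := hrange T p hp j hj
    rw [ha, sin_branch hj]
    refine mul_ne_zero (by split_ifs <;> norm_num) (Real.sqrt_pos.2 ?_).ne'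
    nlinarith
  have hdet : ∀ T, ∀ p ∈ Z T, (fderiv ℝ (gradient (signedArea m)) (Q T p)).det
      = (∏ j ∈ E, Real.sin (a T p j)) * F' T p := by
    intro T p hp
    rw [det_fderiv_gradient_signedArea_eq_sum, hQa T p hp, sum_prod_erase (hsin T p hp)]
    simp only [ha, branch_self, hF', hE]
  have hsign : ∀ T ⊆ E, ∀ p ∈ Z T,
      (SignType.sign (fderiv ℝ (gradient (signedArea m)) (Q T p)).det : ℤ)
        = (-1) ^ T.card * (SignType.sign (F' T p) : ℤ) := by
    intro T hT p hp
    rw [hdet T p hp, sign_mul, prod_erase_sin_branch hT (hrange T p hp)]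
    push_cast
    rfl
  -- the fibre is the disjoint union of the branches
  have hfibre : {x | x ∈ ball (0 : EuclideanSpace ℝ (Fin (2 * m))) r ∧
      gradient (signedArea m) x = y} = ⋃ T ∈ (E.powerset : Set _), Q T '' Z T := by
    ext x
    simp only [Set.mem_iUnion, Finset.mem_coe, Finset.mem_powerset, exists_prop]
    constructor
    · rintro ⟨hx, hxy⟩
      have hg := (gradient_signedArea_eq_iff x y j₀).1 hxy
      set T := E.filter fun j => closedAngles x j < 0 with hT
      set p := closedAngles x j₀ with hp
      have hxa : a T p = closedAngles x := by
        funext j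
        by_cases hj : j = j₀
        · rw [hj, ha, branch_self]
        · have habsj : Real.arccos (Real.cos p - c j) = |closedAngles x j| := by
            rw [hcy, ← hg j, ← Real.cos_abs, Real.arccos_cos (abs_nonneg _) (hr x hx j)]
          rw [ha, branch_of_ne hj, habsj]
          by_cases hneg : closedAngles x j < 0
          · rw [if_pos (Finset.mem_filter.2 ⟨Finset.mem_erase.2 ⟨hj, Finset.mem_univ j⟩, hneg⟩),
              abs_of_neg hneg]
            ring
          · have hjT : j ∉ T := fun h => hneg (Finset.mem_filter.1 h).2
            rw [if_neg hjT, abs_of_nonneg (not_lt.1 hneg), one_mul]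
      refine ⟨T, Finset.filter_subset _ _, p, ⟨abs_lt.1 (hA x hx hxy), ?_⟩, ?_⟩
      · simp only [hF, hxa]
        exact sum_closedAngles x
      · simp only [hQ, hxa]
        exact toLp_closedAngles x
    · rintro ⟨T, -, p, hp, rfl⟩
      exact ⟨hQmem T p hp, hQgrad T p hp⟩
  have hinj : ∀ T, Set.InjOn (Q T) (Z T) := by
    intro T p hp q hq hpq
    have h := congrFun (congrArg closedAngles hpq) j₀
    rwa [hQa T p hp, hQa T q hq, ha, branch_self, branch_self] at h
  have hdisj : (E.powerset : Set (Finset (Option (Fin (2 * m))))).PairwiseDisjoint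
      fun T => Q T '' Z T := by
    intro T hT T' hT' hne
    refine Set.disjoint_left.2 ?_
    rintro _ ⟨p, hp, rfl⟩ ⟨q, hq, hpq⟩
    refine hne ?_
    have h := congrArg closedAngles hpq
    rw [hQa T p hp, hQa T' q hq] at h
    ext j
    by_cases hj : j = j₀
    · have h1 : ∀ S ∈ (E.powerset : Set (Finset (Option (Fin (2 * m))))), j ∉ S := fun S hS hjS =>
        Finset.ne_of_mem_erase (Finset.mem_powerset.1 hS hjS) hj
      exact iff_of_false (h1 T hT) (h1 T' hT')
    · rw [← branch_neg_iff hj (hrange T p hp j hj).2, ← branch_neg_iff hj (hrange T' q hq j hj).2]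
      change a T p j < 0 ↔ a T' q j < 0
      rw [h]
  have hcontF : ∀ T, Continuous (F T) := fun T =>
    continuous_finsetSum _ fun j _ => continuous_branch j
  have hder : ∀ T, ∀ z ∈ Set.Ioo (-A) A, F T z = 0 → HasDerivAt (F T) (F' T z) z ∧ F' T z ≠ 0 := by
    intro T z hz h0
    refine ⟨hasDerivAt_sum_branch (hrange T z ⟨hz, h0⟩), fun h => ?_⟩
    refine hreg _ (hQmem T z ⟨hz, h0⟩) (hQgrad T z ⟨hz, h0⟩) ?_
    rw [hdet T z ⟨hz, h0⟩, h, mul_zero]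
  have hcardι : (Fintype.card (Option (Fin (2 * m))) : ℤ) = 2 * m + 1 := by simp
  have hend : ∀ T ⊆ E, ∀ e : ℤ, Odd e → ∀ p : ℝ, p = e * A → Real.cos p = Real.cos A →
      SignType.sign (F T p) = SignType.sign (e + 2 * m - 2 * T.card) := by
    rintro T hT e ⟨k, rfl⟩ p hp hcp
    rw [hF, sign_sum_branch hT _ hA0 hp, hcardι, add_sub_cancel_right]
    · intro j _
      rw [hcp]
      simpa using hsmall j
    · rw [hcardι]; omega
  have hne : ∀ T ⊆ E, ∀ e : ℤ, Odd e → ∀ p : ℝ, p = e * A → Real.cos p = Real.cos A →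
      F T p ≠ 0 := by
    intro T hT e he p hp hcp
    rw [← sign_ne_zero, hend T hT e he p hp hcp, sign_ne_zero]
    obtain ⟨k, rfl⟩ := he
    omega
  have hleft : ∀ T ⊆ E, F T (-A) ≠ 0 := fun T hT =>
    hne T hT (-1) (by decide) _ (by push_cast; ring) (Real.cos_neg A)
  have hright : ∀ T ⊆ E, F T A ≠ 0 := fun T hT => hne T hT 1 (by decide) _ (by push_cast; ring) rfl
  have hfin : ∀ T ⊆ E, (Z T).Finite := fun T hT =>
    finite_zeros_of_hasDerivAt (hcontF T).continuousOn (hleft T hT) (hright T hT) (hder T)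
  have hcount : ∀ T ⊆ E, 2 * ∑ᶠ x ∈ Q T '' Z T,
      (SignType.sign (fderiv ℝ (gradient (signedArea m)) x).det : ℤ)
      = (-1) ^ T.card * ((SignType.sign (1 + 2 * m - 2 * T.card : ℤ) : ℤ)
        - (SignType.sign (-1 + 2 * m - 2 * T.card : ℤ) : ℤ)) := by
    intro T hT
    rw [finsum_mem_image (hinj T), finsum_mem_congr rfl (hsign T hT), ← mul_finsum_mem,
      mul_left_comm, two_mul_finsum_sign_deriv (by linarith) (hcontF T).continuousOn (hleft T hT)
        (hright T hT) (hder T), hend T hT 1 (by decide) A (by push_cast; ring) rfl,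
      hend T hT (-1) (by decide) (-A) (by push_cast; ring) (Real.cos_neg A)]
  have htotal := sum_powerset_sign_sub_sign hEcard
  rw [hfibre, finsum_mem_biUnion hdisj (Finset.finite_toSet _)
    fun T hT => (hfin T (Finset.mem_powerset.1 hT)).image _, finsum_mem_coe_finset]
  rw [← Finset.sum_congr rfl fun T hT => hcount T (Finset.mem_powerset.1 hT),
    ← Finset.mul_sum] at htotal
  exact mul_left_cancel₀ two_ne_zero htotal

theorem hasIndexAt_gradient_signedArea {m : ℕ} (hm : 1 ≤ m) :
    HasIndexAt (gradient (signedArea m)) 0 (2 * (-1) ^ m * ((2 * m - 1).choose (m - 1) : ℤ)) := by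
  have hN : (0 : ℝ) < 2 * m + 1 := by positivity
  set r : ℝ := 1 / (2 * m + 1) with hrdef
  have hr0 : 0 < r := by positivity
  have hcont := (contDiff_gradient_signedArea m).continuous
  have hzero : gradient (signedArea m) 0 = 0 := by
    rw [gradient_signedArea]; ext i; simp
  have hone : ∀ x ∈ closedBall (0 : EuclideanSpace ℝ (Fin (2 * m))) r, ∀ o,
      |closedAngles x o| ≤ 1 := by
    intro x hx o
    rw [mem_closedBall_zero_iff] at hx
    refine (abs_closedAngles_le x o).trans ?_
    push_cast
    calc (2 * m + 1 : ℝ) * ‖x‖ ≤ (2 * m + 1) * r := by gcongr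
      _ = 1 := by rw [hrdef]; field_simp
  have hpi : ∀ x ∈ closedBall (0 : EuclideanSpace ℝ (Fin (2 * m))) r, ∀ o,
      |closedAngles x o| ≤ Real.pi := fun x hx o =>
    (hone x hx o).trans (by linarith [Real.pi_gt_three])
  have hiso : ∀ x ∈ closedBall (0 : EuclideanSpace ℝ (Fin (2 * m))) r,
      gradient (signedArea m) x = 0 → x = 0 := fun x hx h =>
    eq_zero_of_gradient_signedArea_eq_zero h (hpi x hx)
  refine ⟨hzero, r, hr0, fun x _ => (contDiff_gradient_signedArea m).contDiffAt, hiso, ?_⟩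
  -- angles with cosine close to `1` are small
  obtain ⟨η, hη, hηarccos⟩ : ∃ η > 0, ∀ u, |u - 1| < η → Real.arccos u < r / (2 * m + 1) := by
    have h : ∀ᶠ u in 𝓝 (1 : ℝ), Real.arccos u < r / (2 * m + 1) :=
      Real.continuous_arccos.continuousAt.eventually_lt_const (by rw [Real.arccos_one]; positivity)
    obtain ⟨η, hη, h⟩ := Metric.eventually_nhds_iff.1 h
    exact ⟨η, hη, fun u hu => h (by rwa [Real.dist_eq])⟩
  set η' := min η 1 / 2 with hη'
  have hη'0 : 0 < η' := by positivity
  have hη'1 : η' * 2 ≤ η := by rw [hη', div_mul_cancel₀ _ two_ne_zero]; exact min_le_left _ _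
  have hη'2 : η' * 2 ≤ 1 := by rw [hη', div_mul_cancel₀ _ two_ne_zero]; exact min_le_right _ _
  obtain ⟨A, hAcos, hAr, hA0⟩ : ∃ A, 1 - η' < Real.cos A ∧ A < r / (2 * m + 1) ∧ 0 < A := by
    have h1 : ∀ᶠ A in 𝓝 (0 : ℝ), 1 - η' < Real.cos A :=
      Real.continuous_cos.continuousAt.eventually_const_lt (by rw [Real.cos_zero]; linarith)
    have h2 : ∀ᶠ A in 𝓝 (0 : ℝ), A < r / (2 * m + 1) := eventually_lt_nhds (by positivity)
    have h3 := (h1.and h2).filter_mono (nhdsWithin_le_nhds (s := Set.Ioi 0))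
    obtain ⟨A, hA, hA0⟩ := (h3.and self_mem_nhdsWithin).exists
    exact ⟨A, hA.1, hA.2, hA0⟩
  have hApi : A ≤ Real.pi := by
    have h1 : r / (2 * m + 1) ≤ 1 := by
      rw [hrdef, div_div, div_le_one (by positivity)]
      nlinarith [Nat.cast_nonneg (α := ℝ) m]
    linarith [Real.pi_gt_three]
  obtain ⟨δ₁, hδ₁, hδ₁A⟩ : ∃ δ > 0, ∀ t, |t| < δ →
      |Real.arccos (Real.cos A - t) - A| * (2 * (2 * m + 1)) < A := by
    have hc : Continuous fun t : ℝ =>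
        |Real.arccos (Real.cos A - t) - A| * (2 * (2 * m + 1)) := by
      refine Continuous.mul ?_ continuous_const
      exact ((Real.continuous_arccos.comp (continuous_const.sub continuous_id)).sub
        continuous_const).abs
    have h : ∀ᶠ t in 𝓝 (0 : ℝ), |Real.arccos (Real.cos A - t) - A| * (2 * (2 * m + 1)) < A :=
      hc.continuousAt.eventually_lt_const (by
        beta_reduce
        rw [sub_zero, Real.arccos_cos hA0.le hApi, sub_self, abs_zero, zero_mul]
        exact hA0)
    obtain ⟨δ, hδ, h⟩ := Metric.eventually_nhds_iff.1 h
    exact ⟨δ, hδ, fun t ht => h (by rwa [Real.dist_eq, sub_zero])⟩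
  -- by compactness, small values are only taken near the zero
  obtain ⟨δ₂, hδ₂, hδ₂A⟩ : ∃ δ > 0, ∀ x ∈ closedBall (0 : EuclideanSpace ℝ (Fin (2 * m))) r,
      ‖gradient (signedArea m) x‖ < δ → ∀ o, |closedAngles x o| < A := by
    have hopen : IsOpen {x : EuclideanSpace ℝ (Fin (2 * m)) | ∀ o, |closedAngles x o| < A} := by
      rw [Set.ofPred_forall]
      exact isOpen_iInter_of_finite fun o =>
        isOpen_lt (continuous_closedAngles o).abs continuous_const
    obtain ⟨δ, hδ, h⟩ := ((isCompact_closedBall (0 : EuclideanSpace ℝ (Fin (2 * m))) r).diff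
      hopen).exists_forall_le' (a := 0) hcont.norm.continuousOn fun x hx => by
        refine norm_pos_iff.2 fun h0 => hx.2 ?_
        rw [hiso x hx.1 h0]
        intro o
        have : closedAngles (0 : EuclideanSpace ℝ (Fin (2 * m))) o = 0 := by
          cases o <;> simp [closedAngles]
        rw [this, abs_zero]
        exact hA0
    refine ⟨δ, hδ, fun x hx hlt => ?_⟩
    by_contra hcon
    exact absurd (h x ⟨hx, hcon⟩) (not_le.2 hlt)
  have hδ : 0 < min (min (η' / 2) (δ₁ / 2)) δ₂ := by positivity
  filter_upwards [ball_mem_nhds 0 hδ] with y hy hreg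
  rw [mem_ball_zero_iff, lt_min_iff, lt_min_iff] at hy
  obtain ⟨⟨hy1, hy2⟩, hy3⟩ := hy
  obtain ⟨j₀, hj₀⟩ := Finite.exists_max fun o : Option (Fin (2 * m)) => o.elim 0 fun i => y i
  have hyle : ∀ o : Option (Fin (2 * m)), |o.elim 0 fun i => y i| ≤ ‖y‖ := by
    rintro (_ | i)
    · simp
    · exact PiLp.norm_apply_le y i
  set c : Option (Fin (2 * m)) → ℝ := fun o => j₀.elim 0 (fun i => y i) - o.elim 0 fun i => y i
    with hc
  have hc0 : ∀ o, 0 ≤ c o := fun o => sub_nonneg.2 (hj₀ o)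
  have hc1 : ∀ o, c o ≤ 2 * ‖y‖ := fun o => by
    have h1 := abs_le.1 (hyle j₀)
    have h2 := abs_le.1 (hyle o)
    simp only [hc]
    linarith [h1.2, h2.1]
  have hsub : ∀ x ∈ ball (0 : EuclideanSpace ℝ (Fin (2 * m))) r,
      x ∈ closedBall (0 : EuclideanSpace ℝ (Fin (2 * m))) r := fun x hx => ball_subset_closedBall hx
  have harc : ∀ o, Real.arccos (Real.cos A - c o) < r / (2 * m + 1) := fun o => by
    refine hηarccos _ (abs_lt.2 ⟨?_, ?_⟩)
    · linarith [hc1 o]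
    · linarith [hc0 o, Real.cos_le_one A]
  refine (finsum_sign_det_fderiv_gradient_signedArea (j₀ := j₀) (c := c) (A := A) (fun _ => rfl)
    hc0 hA0 hApi
    (fun o => by linarith [hc1 o]) (fun x hx => hpi x (hsub x hx))
    (fun x hx hxy => hδ₂A x (hsub x hx) (by rw [hxy]; exact hy3) j₀) ?_
    (fun o => (hδ₁A _ (abs_lt.2 ⟨by linarith [hc0 o], by linarith [hc1 o]⟩)).le) hreg).trans ?_
  · intro x hx0 hx
    have hall : ∀ o, |closedAngles x o| ≤ r / (2 * m + 1) := fun o => by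
      by_cases ho : o = j₀
      · rw [ho]; exact (hx0.trans hAr).le
      · exact (hx o ho).trans (harc o).le
    have h := EuclideanSpace.norm_le_of_forall_abs_le (x := x) fun i => hall (some i)
    rw [mem_ball_zero_iff]
    refine h.trans_lt ?_
    push_cast
    rw [mul_div_assoc', div_lt_iff₀ hN]
    nlinarith
  · have h := two_mul_choose_pred_pred hm
    rw [← h]
    push_cast
    ring

/-! ### The signature formula -/

theorem mainTheorem3 (m : ℕ) (hm : 1 ≤ m) :
    -- the Milnor algebra is finite-dimensional, and the normalization determines `l`
    Module.Finite ℝ (MilnorAlgebra (areaGerm m)) ∧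
    (∀ ω : ℝ, ∃! l : MilnorAlgebra (areaGerm m) →ₗ[ℝ] ℝ, IsNormalized l ω) ∧
    (∀ (ω : ℝ) (l : MilnorAlgebra (areaGerm m) →ₗ[ℝ] ℝ), IsNormalized l ω →
      -- `l(w_p) = b_{m-p}`, where `w_p` is the class of the monomials of degree `2m` in which
      -- exactly `2p` of the exponents are odd
      (∀ (a : Fin (2 * m) → ℕ) (p : ℕ), ∑ i, a i = 2 * m →
        (Finset.univ.filter fun i => Odd (a i)).card = 2 * p →
        l (monomialClass (areaGerm m) a) = bCoeff m ω (m - p)) ∧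
      -- the entries of `B_{m,m}`
      (∀ σ τ, blockB m l σ τ = bCoeff m ω (σ.1 ∩ τ.1).card) ∧
      -- the eigenvalues of `B_{m,m}`
      (∀ μ : ℝ, Module.End.HasEigenvalue (Matrix.toLin' (blockB m l)) μ ↔
        ∃ k : ℕ, k ≤ m ∧ μ = lambdaEig m ω k) ∧
      -- their multiplicities
      (ω ≠ 0 → ∀ k : ℕ, k ≤ m →
        (Module.finrank ℝ
          (Module.End.eigenspace (Matrix.toLin' (blockB m l)) (lambdaEig m ω k)) : ℝ) =
          ((2 * m)! : ℝ) * (2 * m - 2 * k + 1 : ℝ) / ((k ! : ℝ) * ((2 * m - k + 1)! : ℝ))) ∧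
      -- for `ω > 0` the functional is positive on the class of the Hessian, all the eigenvalues
      -- have the same sign, and the signature of `β` is the asserted index
      (0 < ω →
        0 < l (Ideal.Quotient.mk (jacobianIdeal (areaGerm m)) (hessianGerm (areaGerm m))) ∧
        (∀ μ : ℝ, Module.End.HasEigenvalue (Matrix.toLin' (blockB m l)) μ → 0 < (-1) ^ m * μ) ∧
        formSignature (milnorForm l) = 2 * (-1) ^ m * ((2 * m - 1).choose (m - 1) : ℤ))) ∧
    -- the index of the gradient vector field of the signed area at the degenerate star
    HasIndexAt (gradient (signedArea m)) 0 (2 * (-1) ^ m * ((2 * m - 1).choose (m - 1) : ℤ)) := by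
  refine ⟨inferInstance, existsUnique_isNormalized hm, fun ω l h => ⟨?_, h.blockB_apply hm,
    hasEigenvalue_toLin'_iff (h.blockB_apply hm), ?_, ?_⟩, hasIndexAt_gradient_signedArea hm⟩
  · exact fun a p ha hp => h.map_monomialClass hm ha hp
  · exact fun hω k hk => finrank_eigenspace_lambdaEig hω (h.blockB_apply hm) hk
  · intro hω
    refine ⟨?_, fun μ hμ => h.hasEigenvalue_pos hm hω hμ, h.formSignature_milnorForm hm hω⟩
    rw [h.map_hessianGerm hm]
    positivity
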